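/- Let $X$ be the number of induced copies of the 4-cycle $C_4$ in the binomial random graph $G_{n,p}$ (that is, the number of 4-element vertex sets inducing a $C_4$), so that $X$ and $\mathbb E[X]$ depend on $n$ and $p$. Let $c_1=0$ and $c_k=\frac{1}{2+\sqrt{(k+1)/(k-1)}}$ for $k\ge 2$. Let $r_0=2$ and $r_k=2\sqrt{k/(k-1)}$ for $k\ge2$. For reals $\delta,\varepsilon>0$ put $$m_k=r_k\sqrt{(\delta+\varepsilon)\,\mathbb E[X]}\quad(k=0\text{ or }k\ge 2),\qquad m_*=\frac{\bigl(\sqrt{r+d^2}-d\bigr)\sqrt{\mathbb E[X]}}{2},\quad r=16\bigl(\delta+\tfrac{3\varepsilon}{2}\bigr),\ d=\frac{\sqrt2}{1+\varepsilon}.$$ **Theorem.** Let $k\ge 2$ be an integer and let $\delta,\eta>0$ be real. There is $\varepsilon_0>0$ such that for every $0<\varepsilon<\varepsilon_0$ the following hold. 1. There is $n_0$ such that for all $n>n_0$ and all $p\in[0,1]$ with $\max\{\frac{\log^9 n}{n},\,n^{-1+c_{k-1}}\}\le p\le n^{-1+c_k}$, $$\log\mathbb P\bigl(X\ge(1+\delta)\mathbb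 E[X]\bigr)\le(1-\eta)\log\left(p^{m_k}\binom{n}{\lfloor m_k/k\rfloor}\right).$$ 2. There is $n_0$ such that for all $n>n_0$ and all $p\in[0,1]$ with $n^{-2/3}\le p\le\frac{1}{\sqrt n\,\log n}$, $$\log\mathbb P\bigl(X\ge(1+\delta)\mathbb E[X]\bigr)\le(1-\eta)\,m_0\log p.$$ 3. For every sequence $p=p(n)\in[0,1]$ with $n^{-1/2}\ll p\ll1$ (where $a\ll b$ means $a=o(b)$ as $n\to\infty$) there is $n_0$ such that for all $n>n_0$, $$\log\mathbb P\bigl(X\ge(1+\delta)\mathbb E[X]\bigr)\le(1-\eta)\,m_*\log p.$$ Here $\log 0=-\infty$ on the left-hand sides. -/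

import Mathlib

open Filter Asymptotics MeasureTheory unitInterval
open scoped SimpleGraph

namespace InducedC4

/-- The number of induced copies of `C₄` in a graph on `{0, …, n - 1}`: the number of vertex sets
whose induced subgraph is a 4-cycle (copies are not counted with automorphisms, so `K_{s,t}` has
`(s choose 2) * (t choose 2)` of them). -/
noncomputable def count {n : ℕ} (G : SimpleGraph (Fin n)) : ℕ :=
  {s : Finset (Fin n) |
    Nonempty (G.induce (s : Set (Fin n)) ≃g SimpleGraph.cycleGraph 4)}.ncard

/-- `E[X]`, where `X` is the number of induced copies of `C₄` in the binomial random graph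
`G(n, p)`. -/
noncomputable def mean (n : ℕ) (p : I) : ℝ :=
  ∫ G, (count G : ℝ) ∂(SimpleGraph.binomialRandom (Fin n) p)

/-- The upper tail probability `P(X ≥ (1 + δ) E[X])`. -/
noncomputable def upperTail (n : ℕ) (p : I) (δ : ℝ) : ENNReal :=
  SimpleGraph.binomialRandom (Fin n) p
    {G : SimpleGraph (Fin n) | (1 + δ) * mean n p ≤ (count G : ℝ)}

/-- The exponents `c₁ = 0` and `c_k = 1 / (2 + √((k + 1) / (k - 1)))` for `k ≥ 2`
(the value at `k = 0` is irrelevant). -/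
noncomputable def c (k : ℕ) : ℝ :=
  if k = 1 then 0 else 1 / (2 + √(((k : ℝ) + 1) / ((k : ℝ) - 1)))

/-- `r₀ = 2` and `r_k = 2 √(k / (k - 1))` for `k ≥ 2` (the value at `k = 1` is irrelevant). -/
noncomputable def r (k : ℕ) : ℝ :=
  if k = 0 then 2 else 2 * √((k : ℝ) / ((k : ℝ) - 1))

/-- `m_k = r_k √((δ + ε) E[X])`. -/
noncomputable def m (k n : ℕ) (p : I) (δ ε : ℝ) : ℝ :=
  r k * √((δ + ε) * mean n p)

/-- `m_* = (√(r + d²) - d) √E[X] / 2` with `r = 16 (δ + 3ε/2)` and `d = √2 / (1 + ε)`. -/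
noncomputable def mStar (n : ℕ) (p : I) (δ ε : ℝ) : ℝ :=
  (√(16 * (δ + 3 * ε / 2) + (√2 / (1 + ε)) ^ 2) - √2 / (1 + ε)) * √(mean n p) / 2

end InducedC4

/-! ### Probabilities of intervals of graphs in the binomial random graph -/

namespace InducedC4

/-! Write `Q = n²p²`, `a = log (1/p)`; then `8 E[X]` is about `Q²`. The upper tail is attributed to
small planted subgraphs, and the cheapest way of planting one is found by optimisation.

Moments. The planted sum of `U` bounds the conditional expectation of `8X` given that `G` contains
`U`. Call `U` a seed if it has few edges and planted sum at least `M`, where `M` is slightly below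
`(1 + δ) Q²`. On the event that `G` contains no seed, the `l`-th moment of `8X` is at most `M ^ l`
(`moment_le`): cycles are revealed one at a time, and the revealed graph is never a seed. With `l`
of order `Q a`, Markov's inequality makes this event negligible.

Cores. A seed contains a core, a subgraph each of whose edges contributes substantially to the
planted sum (`exists_isCore_le`). By `plantedSum_sub_deleteEdges_le`, such an edge `uv` has `(d(u) -
1)(d(v) - 1)` large compared with the number of edges, or an endpoint of nearly linear degree, up to
factors of order `a²`. Hence the graphs with `m` edges and `v` non-isolated vertices that can be
cores number at most `n.choose v` times a power of `a` per edge (`card_graphs_le`), which is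
negligible against `p ^ (-m)`. The union bound leaves the problem of minimising the cost `m a - v
log (n/m)` (`tail_le_of_cores`), subject to `orderedCount H + 4p² pathSum H` being at least about `δ
Q²`.

Sparse range. The path term is negligible and the vertices of bounded degree form an independent
set. `orderedCount_le_of_independent` bounds the number of cycles by twice a square, in which a
vertex of degree `j` contributes `√(j (j - 1))` and an edge avoiding the independent set contributes
`1`. The former costs about `j a - log (n/Q)`, the latter `a`. The best degree is found from
`costRatio_identity`, whose sign changes at `c j`; for `p ≥ n ^ (-2/3)` the rate `a` is optimal,
which gives `m 0`.

Dense range. Here `n` is smaller than the number of edges of a core, so the choice of vertices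
brings no gain. The cycle count is at most `2m²` and the path term is essentially at most `Q m`, so
`2m² + Q m` must reach `δ Q²`; the positive root of this quadratic is the source of `mStar`. -/

theorem sum_weights_between {α : Type*} [DecidableEq α] (A T : Finset α) (hAT : A ⊆ T) (p : ℝ) :
    ∑ E ∈ Finset.Icc A T, p ^ E.card * (1 - p) ^ (T.card - E.card) = p ^ A.card := by
  rw [Finset.Icc_eq_image_powerset hAT, Finset.sum_image]
  · have h1 : ∀ S ∈ (T \ A).powerset, p ^ (A ∪ S).card * (1 - p) ^ (T.card - (A ∪ S).card) =
        p ^ A.card * (p ^ S.card * (1 - p) ^ ((T \ A).card - S.card)) := by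
      intro S hS
      rw [Finset.mem_powerset] at hS
      have hd : Disjoint A S := Finset.disjoint_of_subset_right hS Finset.disjoint_sdiff
      rw [Finset.card_union_of_disjoint hd, Finset.card_sdiff_of_subset hAT, pow_add,
        Nat.sub_sub]
      ring
    rw [Finset.sum_congr rfl h1, ← Finset.mul_sum, Finset.sum_pow_mul_eq_add_pow]
    simp
  · intro S hS S' hS' h
    simp only [Finset.coe_powerset, Set.mem_preimage, Set.mem_powerset_iff, Finset.coe_subset]
      at hS hS'
    have hd : Disjoint S A := Finset.disjoint_of_subset_left hS Finset.sdiff_disjoint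
    have hd' : Disjoint S' A := Finset.disjoint_of_subset_left hS' Finset.sdiff_disjoint
    have := congrArg (· \ A) h
    simpa [Finset.union_sdiff_left, Finset.sdiff_eq_self_of_disjoint hd,
      Finset.sdiff_eq_self_of_disjoint hd'] using this

instance measurableSingletonClass_simpleGraph {V : Type*} [Countable V] :
    MeasurableSingletonClass (SimpleGraph V) where
  measurableSet_singleton G := by
    have h : ({G} : Set (SimpleGraph V)) = SimpleGraph.edgeSet ⁻¹' {G.edgeSet} := by
      ext H; simp
    rw [h]
    exact SimpleGraph.measurable_edgeSet (measurableSet_singleton _)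

theorem binomialRandom_real_singleton {n : ℕ} (p : I) (G : SimpleGraph (Fin n)) :
    (SimpleGraph.binomialRandom (Fin n) p).real {G} =
      (p : ℝ) ^ G.edgeSet.ncard * (1 - (p : ℝ)) ^ (n.choose 2 - G.edgeSet.ncard) := by
  rw [measureReal_def, SimpleGraph.binomialRandom_singleton]
  simp

open scoped Classical in
-- The edges of `H` are forced, the non-edges of `K` are excluded, and the remaining pairs are free,
-- so their weights sum to one.
theorem binomialRandom_real_between {n : ℕ} (p : I) (H K : SimpleGraph (Fin n)) (hHK : H ≤ K) :
    (SimpleGraph.binomialRandom (Fin n) p).real {G | H ≤ G ∧ G ≤ K} =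
      (p : ℝ) ^ H.edgeSet.ncard * (1 - (p : ℝ)) ^ (n.choose 2 - K.edgeSet.ncard) := by
  have hcard : ∀ G : SimpleGraph (Fin n), G.edgeSet.ncard = G.edgeFinset.card := fun G => by
    rw [← SimpleGraph.coe_edgeFinset, Set.ncard_coe_finset]
  have hN : ∀ G : SimpleGraph (Fin n), G.edgeFinset.card ≤ n.choose 2 := fun G => by
    simpa using G.card_edgeFinset_le_card_choose_two
  have hset : ({G | H ≤ G ∧ G ≤ K} : Set (SimpleGraph (Fin n))) =
      (↑(Finset.univ.filter fun G => H ≤ G ∧ G ≤ K) : Set (SimpleGraph (Fin n))) := by simp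
  rw [hset, ← sum_measureReal_singleton, hcard, hcard,
    ← sum_weights_between H.edgeFinset K.edgeFinset (SimpleGraph.edgeFinset_subset_edgeFinset.2 hHK)
      (p : ℝ), Finset.sum_mul]
  refine Finset.sum_bij' (fun G _ => G.edgeFinset) (fun E _ => SimpleGraph.fromEdgeSet (E : Set _))
    ?_ ?_ ?_ ?_ ?_
  · intro G hG
    simpa using hG
  · intro E hE
    rw [Finset.mem_Icc] at hE
    have hE' : (E : Set (Sym2 (Fin n))) ⊆ K.edgeSet := by
      intro x hx
      simpa using hE.2 hx
    simp only [Finset.mem_filter, Finset.mem_univ, true_and]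
    constructor
    · rw [← SimpleGraph.edgeSet_subset_edgeSet, SimpleGraph.edgeSet_fromEdgeSet]
      intro x hx
      refine ⟨hE.1 (by simpa using hx), ?_⟩
      exact H.edgeSet_subset_compl_diagSet hx
    · rw [← SimpleGraph.edgeSet_subset_edgeSet, SimpleGraph.edgeSet_fromEdgeSet]
      exact fun x hx => hE' hx.1
  · intro G hG
    simp
  · intro E hE
    rw [Finset.mem_Icc] at hE
    have hE' : (E : Set (Sym2 (Fin n))) ⊆ K.edgeSet := by
      intro x hx
      simpa using hE.2 hx
    ext x
    simp only [SimpleGraph.mem_edgeFinset, SimpleGraph.edgeSet_fromEdgeSet, Set.mem_sdiff]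
    refine ⟨fun h => by simpa using h.1, fun h => ⟨by simpa using h, ?_⟩⟩
    exact K.edgeSet_subset_compl_diagSet (hE' h)
  · intro G hG
    simp only [Finset.mem_filter, Finset.mem_univ, true_and] at hG
    rw [binomialRandom_real_singleton, hcard, mul_assoc, ← pow_add]
    congr 2
    have := Finset.card_le_card (SimpleGraph.edgeFinset_subset_edgeFinset.2 hG.2)
    have := hN K
    omega

theorem binomialRandom_real_ge {n : ℕ} (p : I) (H : SimpleGraph (Fin n)) :
    (SimpleGraph.binomialRandom (Fin n) p).real {G | H ≤ G} = (p : ℝ) ^ H.edgeSet.ncard := by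
  classical
  have h := binomialRandom_real_between p H ⊤ le_top
  have hc : (⊤ : SimpleGraph (Fin n)).edgeSet.ncard = n.choose 2 := by
    rw [← SimpleGraph.coe_edgeFinset, Set.ncard_coe_finset,
      SimpleGraph.card_edgeFinset_top_eq_card_choose_two, Fintype.card_fin]
  rw [hc, Nat.sub_self, pow_zero, mul_one] at h
  simpa using h


/-! ### Ordered quadruples and copies of the 4-cycle -/

/-- The ordered quadruple `(a, b, c, d)` induces the 4-cycle `a b c d` in `G`. -/
def IsInducedCycle {V : Type*} (G : SimpleGraph V) (t : V × V × V × V) : Prop :=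
  (G.Adj t.1 t.2.1 ∧ G.Adj t.2.1 t.2.2.1 ∧ G.Adj t.2.2.1 t.2.2.2 ∧ G.Adj t.2.2.2 t.1) ∧
    t.1 ≠ t.2.2.1 ∧ t.2.1 ≠ t.2.2.2 ∧ ¬ G.Adj t.1 t.2.2.1 ∧ ¬ G.Adj t.2.1 t.2.2.2

instance {V : Type*} [DecidableEq V] (G : SimpleGraph V) [DecidableRel G.Adj] :
    DecidablePred (IsInducedCycle G) := fun t => by
  unfold IsInducedCycle; infer_instance

open scoped Classical in
/-- The number of ordered quadruples inducing a 4-cycle, i.e. eight times the number of copies. -/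
noncomputable def orderedCount {n : ℕ} (G : SimpleGraph (Fin n)) : ℕ :=
  (Finset.univ.filter (IsInducedCycle G)).card

theorem card_isInducedCycle_cycleGraph :
    (Finset.univ.filter (IsInducedCycle (SimpleGraph.cycleGraph 4))).card = 8 := by
  decide

set_option maxRecDepth 100000 in
theorem IsInducedCycle.cover_fin_four : ∀ t : Fin 4 × Fin 4 × Fin 4 × Fin 4,
    IsInducedCycle (SimpleGraph.cycleGraph 4) t →
      ∀ x, x = t.1 ∨ x = t.2.1 ∨ x = t.2.2.1 ∨ x = t.2.2.2 := by
  decide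

theorem IsInducedCycle.nonempty_iso {V : Type*} [DecidableEq V] {G : SimpleGraph V}
    {t : V × V × V × V} (ht : IsInducedCycle G t) :
    Nonempty (G.induce (({t.1, t.2.1, t.2.2.1, t.2.2.2} : Finset V) : Set V) ≃g
      SimpleGraph.cycleGraph 4) := by
  obtain ⟨a, b, c, d⟩ := t
  obtain ⟨⟨hab, hbc, hcd, hda⟩, hac, hbd, nac, nbd⟩ := ht
  simp only at *
  let f : Fin 4 → (({a, b, c, d} : Finset V) : Set V) :=
    ![⟨a, by simp⟩, ⟨b, by simp⟩, ⟨c, by simp⟩, ⟨d, by simp⟩]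
  have hf : Function.Bijective f := by
    constructor
    · intro i j hij
      have h1 := hab.ne
      have h2 := hbc.ne
      have h3 := hcd.ne
      have h4 := hda.ne
      fin_cases i <;> fin_cases j <;> simp_all [f, Subtype.ext_iff]
    · rintro ⟨x, hx⟩
      simp only [Finset.coe_insert, Finset.coe_singleton, Set.mem_insert_iff,
        Set.mem_singleton_iff] at hx
      rcases hx with rfl | rfl | rfl | rfl
      exacts [⟨0, rfl⟩, ⟨1, rfl⟩, ⟨2, rfl⟩, ⟨3, rfl⟩]
  refine ⟨(RelIso.symm ⟨Equiv.ofBijective f hf, ?_⟩)⟩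
  intro i j
  have hba := hab.symm
  have hcb := hbc.symm
  have hdc := hcd.symm
  have had := hda.symm
  have nca : ¬ G.Adj c a := fun h => nac h.symm
  have ndb : ¬ G.Adj d b := fun h => nbd h.symm
  fin_cases i <;> fin_cases j <;>
    simp [f, hab, hbc, hcd, hda, hba, hcb, hdc, had, nac, nbd, nca, ndb,
      SimpleGraph.cycleGraph_adj] <;> decide

open scoped Classical in
-- An isomorphism of the induced graph with the 4-cycle carries the quadruples over a fixed vertex
-- set to those of the 4-cycle itself, of which there are eight. Ordered quadruples make rotation
-- available as a symmetry.
theorem orderedCount_eq {n : ℕ} (G : SimpleGraph (Fin n)) : orderedCount G = 8 * count G := by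
  let S : Finset (Finset (Fin n)) := Finset.univ.filter fun s =>
    Nonempty (G.induce (s : Set (Fin n)) ≃g SimpleGraph.cycleGraph 4)
  have hS : count G = S.card := by
    rw [count, ← Set.ncard_coe_finset]
    congr 1
    ext s
    simp [S]
  rw [hS, orderedCount, Finset.card_eq_sum_card_fiberwise (t := S)
    (f := fun t => ({t.1, t.2.1, t.2.2.1, t.2.2.2} : Finset (Fin n)))]
  · rw [Finset.sum_const_nat (m := 8), mul_comm]
    intro s hs
    simp only [S, Finset.mem_filter, Finset.mem_univ, true_and] at hs
    obtain ⟨φ⟩ := hs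
    rw [← card_isInducedCycle_cycleGraph]
    symm
    refine Finset.card_bij (fun t _ => ((φ.symm t.1).1, (φ.symm t.2.1).1, (φ.symm t.2.2.1).1,
      (φ.symm t.2.2.2).1)) ?_ ?_ ?_
    · intro t ht
      simp only [Finset.mem_filter, Finset.mem_univ, true_and] at ht ⊢
      have hadj : ∀ i j, G.Adj (φ.symm i).1 (φ.symm j).1 ↔ (SimpleGraph.cycleGraph 4).Adj i j :=
        fun i j => φ.symm.map_rel_iff
      refine ⟨?_, ?_⟩
      · obtain ⟨h1, h2, h3, h4, h5⟩ := ht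
        refine ⟨?_, ?_, ?_, ?_⟩
        · simpa only [hadj] using h1
        · simpa [Subtype.ext_iff] using h2
        · simpa [Subtype.ext_iff] using h3
        · simpa only [hadj] using ⟨h4, h5⟩
      · have hc := IsInducedCycle.cover_fin_four t ht
        ext x
        simp only [Finset.mem_insert, Finset.mem_singleton]
        constructor
        · rintro (rfl | rfl | rfl | rfl) <;> exact Subtype.coe_prop _
        · intro hx
          have := hc (φ ⟨x, hx⟩)
          have key : ∀ i, φ ⟨x, hx⟩ = i → x = (φ.symm i).1 := by
            rintro i rfl; simp
          rcases this with h | h | h | h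
          · exact Or.inl (key _ h)
          · exact Or.inr (Or.inl (key _ h))
          · exact Or.inr (Or.inr (Or.inl (key _ h)))
          · exact Or.inr (Or.inr (Or.inr (key _ h)))
    · rintro ⟨a, b, c, d⟩ _ ⟨a', b', c', d'⟩ _ h
      simp only [Prod.mk.injEq, ← Subtype.ext_iff, EmbeddingLike.apply_eq_iff_eq] at h
      simpa using h
    · rintro ⟨a, b, c, d⟩ ht
      simp only [Finset.mem_filter, Finset.mem_univ, true_and] at ht
      obtain ⟨ht, rfl⟩ := ht
      obtain ⟨⟨hab, hbc, hcd, hda⟩, hac, hbd, nac, nbd⟩ := ht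
      simp only at *
      refine ⟨(φ ⟨a, by simp⟩, φ ⟨b, by simp⟩, φ ⟨c, by simp⟩, φ ⟨d, by simp⟩), ?_, by simp⟩
      simp only [Finset.mem_filter, Finset.mem_univ, true_and]
      have hadj : ∀ i j, (SimpleGraph.cycleGraph 4).Adj (φ i) (φ j) ↔ G.Adj i.1 j.1 :=
        fun i j => φ.map_rel_iff
      exact ⟨⟨(hadj _ _).2 hab, (hadj _ _).2 hbc, (hadj _ _).2 hcd, (hadj _ _).2 hda⟩,
        by simpa using hac, by simpa using hbd, fun h => nac ((hadj _ _).1 h),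
        fun h => nbd ((hadj _ _).1 h)⟩
  · intro t ht
    simp only [S, Finset.coe_filter, Finset.mem_univ, true_and, Set.mem_ofPred_eq] at ht ⊢
    exact ht.nonempty_iso


/-! ### Weights and the planted sum -/

open scoped Classical in
/-- The probability that `uv` is an edge, given that the edges of `H` are present. -/
noncomputable def edgeWeight {V : Type*} (H : SimpleGraph V) (p : ℝ) (u v : V) : ℝ :=
  if H.Adj u v then 1 else p

/-- The vertices of the quadruple are distinct and neither diagonal of it is an edge of `H`. -/
def Compatible {V : Type*} (H : SimpleGraph V) (t : V × V × V × V) : Prop :=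
  (t.1 ≠ t.2.1 ∧ t.2.1 ≠ t.2.2.1 ∧ t.2.2.1 ≠ t.2.2.2 ∧ t.2.2.2 ≠ t.1) ∧
    t.1 ≠ t.2.2.1 ∧ t.2.1 ≠ t.2.2.2 ∧ ¬ H.Adj t.1 t.2.2.1 ∧ ¬ H.Adj t.2.1 t.2.2.2

/-- The product of the weights of the edges of the 4-cycle `t`. -/
noncomputable def cycleWeight {V : Type*} (H : SimpleGraph V) (p : ℝ) (t : V × V × V × V) : ℝ :=
  edgeWeight H p t.1 t.2.1 * edgeWeight H p t.2.1 t.2.2.1 *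
    edgeWeight H p t.2.2.1 t.2.2.2 * edgeWeight H p t.2.2.2 t.1

open scoped Classical in
/-- An upper bound for the conditional expectation of `orderedCount`, given that the edges of `H`
are present. -/
noncomputable def plantedSum {n : ℕ} (H : SimpleGraph (Fin n)) (p : ℝ) : ℝ :=
  ∑ t with Compatible H t, cycleWeight H p t

/-- The 4-cycle on the quadruple `t`. -/
def cycleOn {V : Type*} (t : V × V × V × V) : SimpleGraph V :=
  SimpleGraph.edge t.1 t.2.1 ⊔ SimpleGraph.edge t.2.1 t.2.2.1 ⊔
    SimpleGraph.edge t.2.2.1 t.2.2.2 ⊔ SimpleGraph.edge t.2.2.2 t.1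

theorem edge_le_iff_adj {V : Type*} {G : SimpleGraph V} {u v : V} (huv : u ≠ v) :
    SimpleGraph.edge u v ≤ G ↔ G.Adj u v := by
  rw [SimpleGraph.edge_le_iff]
  simp [huv]

theorem isInducedCycle_iff {V : Type*} {G : SimpleGraph V} {t : V × V × V × V} :
    IsInducedCycle G t ↔ Compatible G t ∧ cycleOn t ≤ G := by
  obtain ⟨a, b, c, d⟩ := t
  unfold IsInducedCycle Compatible cycleOn
  simp only [sup_le_iff]
  constructor
  · rintro ⟨⟨h1, h2, h3, h4⟩, h5⟩
    exact ⟨⟨⟨h1.ne, h2.ne, h3.ne, h4.ne⟩, h5⟩, ⟨⟨(edge_le_iff_adj h1.ne).2 h1,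
      (edge_le_iff_adj h2.ne).2 h2⟩, (edge_le_iff_adj h3.ne).2 h3⟩, (edge_le_iff_adj h4.ne).2 h4⟩
  · rintro ⟨⟨⟨h1, h2, h3, h4⟩, h5⟩, ⟨⟨h6, h7⟩, h8⟩, h9⟩
    exact ⟨⟨(edge_le_iff_adj h1).1 h6, (edge_le_iff_adj h2).1 h7, (edge_le_iff_adj h3).1 h8,
      (edge_le_iff_adj h4).1 h9⟩, h5⟩

theorem Compatible.mono {V : Type*} {G H : SimpleGraph V} (h : H ≤ G) {t : V × V × V × V}
    (ht : Compatible G t) : Compatible H t :=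
  ⟨ht.1, ht.2.1, ht.2.2.1, fun h' => ht.2.2.2.1 (h h'), fun h' => ht.2.2.2.2 (h h')⟩

theorem edgeWeight_nonneg {V : Type*} (H : SimpleGraph V) {p : ℝ} (hp : 0 ≤ p) (u v : V) :
    0 ≤ edgeWeight H p u v := by
  unfold edgeWeight; split_ifs <;> simp [hp]

theorem cycleWeight_nonneg {V : Type*} (H : SimpleGraph V) {p : ℝ} (hp : 0 ≤ p)
    (t : V × V × V × V) : 0 ≤ cycleWeight H p t := by
  unfold cycleWeight
  have := edgeWeight_nonneg H hp
  exact mul_nonneg (mul_nonneg (mul_nonneg (this _ _) (this _ _)) (this _ _)) (this _ _)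

/-- This makes `edgeWeight` a conditional probability. The identity holds for every real `p`; at `p
= 2` it serves to read off numbers of edges. -/
theorem pow_ncard_sup_edge {V : Type*} [Finite V] (H : SimpleGraph V) (p : ℝ) {u v : V}
    (huv : u ≠ v) : p ^ (H ⊔ SimpleGraph.edge u v).edgeSet.ncard =
      p ^ H.edgeSet.ncard * edgeWeight H p u v ∧
      (H ⊔ SimpleGraph.edge u v).edgeSet.ncard ≤ H.edgeSet.ncard + 1 := by
  classical
  cases nonempty_fintype V
  unfold edgeWeight
  split_ifs with h
  · rw [sup_eq_left.2 ((edge_le_iff_adj huv).2 h)]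
    simp
  · have := H.card_edgeFinset_sup_edge h huv
    rw [← SimpleGraph.coe_edgeFinset, ← SimpleGraph.coe_edgeFinset, Set.ncard_coe_finset,
      Set.ncard_coe_finset, this, pow_succ]
    simp

theorem edgeWeight_sup_edge {V : Type*} (H : SimpleGraph V) (p : ℝ) {u v x y : V}
    (h : s(x, y) ≠ s(u, v)) :
    edgeWeight (H ⊔ SimpleGraph.edge u v) p x y = edgeWeight H p x y := by
  unfold edgeWeight
  have : (H ⊔ SimpleGraph.edge u v).Adj x y ↔ H.Adj x y := by
    rw [SimpleGraph.sup_adj, SimpleGraph.edge_adj]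
    constructor
    · rintro (h' | ⟨h', -⟩)
      · exact h'
      · exact absurd (by simpa [Sym2.eq_iff] using h') h
    · exact Or.inl
  rw [this]

/-- The four edges are added in turn. As the vertices are distinct, so are the edges, and those
already added do not alter the weights of the later ones. -/
theorem pow_ncard_sup_cycleOn {V : Type*} [Finite V] (H : SimpleGraph V) (p : ℝ)
    {t : V × V × V × V} (ht : Compatible H t) :
    p ^ (H ⊔ cycleOn t).edgeSet.ncard = p ^ H.edgeSet.ncard * cycleWeight H p t ∧
      (H ⊔ cycleOn t).edgeSet.ncard ≤ H.edgeSet.ncard + 4 := by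
  obtain ⟨a, b, c, d⟩ := t
  obtain ⟨⟨hab, hbc, hcd, hda⟩, hac, hbd, -⟩ := ht
  unfold cycleOn cycleWeight
  dsimp only at *
  rw [show ∀ A B C D : SimpleGraph V, H ⊔ (A ⊔ B ⊔ C ⊔ D) = H ⊔ A ⊔ B ⊔ C ⊔ D from
    fun A B C D => by simp only [sup_assoc]]
  obtain ⟨e1, l1⟩ := pow_ncard_sup_edge H p hab
  obtain ⟨e2, l2⟩ := pow_ncard_sup_edge (H ⊔ SimpleGraph.edge a b) p hbc
  obtain ⟨e3, l3⟩ := pow_ncard_sup_edge (H ⊔ SimpleGraph.edge a b ⊔ SimpleGraph.edge b c) p hcd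
  obtain ⟨e4, l4⟩ := pow_ncard_sup_edge
    (H ⊔ SimpleGraph.edge a b ⊔ SimpleGraph.edge b c ⊔ SimpleGraph.edge c d) p hda
  refine ⟨?_, by omega⟩
  rw [e4, e3, e2, e1]
  have n1 : s(b, c) ≠ s(a, b) := by simp; grind
  have n2 : s(c, d) ≠ s(b, c) := by simp; grind
  have n3 : s(c, d) ≠ s(a, b) := by simp; grind
  have n4 : s(d, a) ≠ s(c, d) := by simp; grind
  have n5 : s(d, a) ≠ s(b, c) := by simp; grind
  have n6 : s(d, a) ≠ s(a, b) := by simp; grind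
  rw [edgeWeight_sup_edge _ _ n1, edgeWeight_sup_edge _ _ n2, edgeWeight_sup_edge _ _ n3,
    edgeWeight_sup_edge _ _ n4, edgeWeight_sup_edge _ _ n5, edgeWeight_sup_edge _ _ n6]
  ring

/-! ### High moments in the absence of seeds -/

theorem sum_real_singleton_filter {n : ℕ} (p : I) (P : SimpleGraph (Fin n) → Prop)
    [DecidablePred P] :
    ∑ G, (SimpleGraph.binomialRandom (Fin n) p).real {G} * (if P G then 1 else 0) =
      (SimpleGraph.binomialRandom (Fin n) p).real {G | P G} := by
  classical
  have : ({G | P G} : Set (SimpleGraph (Fin n))) = ↑(Finset.univ.filter P) := by simp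
  rw [this, ← sum_measureReal_singleton, Finset.sum_filter]
  simp

/-- No graph with at most `L` edges whose planted sum is at least `M` is contained in `G`. -/
def NoSeed {n : ℕ} (p M : ℝ) (L : ℕ) (G : SimpleGraph (Fin n)) : Prop :=
  ∀ U ≤ G, U.edgeSet.ncard ≤ L → plantedSum U p < M

open scoped Classical in
-- One factor `orderedCount G` is expanded as a sum over induced cycles `t` of `G`; each is
-- compatible with `U`, and `G` contains `U ⊔ cycleOn t`. Induction applies to the enlarged graph,
-- and summing over `t` yields the planted sum of `U`. This is below `M`, for otherwise `U` is a
-- seed and the indicator vanishes. A cycle adds at most four edges, whence the budget `4 * j`.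
theorem moment_le {n : ℕ} (p : I) {M : ℝ} (hM : 0 ≤ M) (L : ℕ) (j : ℕ) :
    ∀ U : SimpleGraph (Fin n), U.edgeSet.ncard + 4 * j ≤ L →
      ∑ G, (SimpleGraph.binomialRandom (Fin n) p).real {G} *
        ((if U ≤ G ∧ NoSeed p M L G then 1 else 0) * (orderedCount G : ℝ) ^ j) ≤
          (p : ℝ) ^ U.edgeSet.ncard * M ^ j := by
  induction j with
  | zero =>
    intro U hU
    rw [← binomialRandom_real_ge, ← sum_real_singleton_filter]
    simp only [pow_zero, mul_one]
    refine Finset.sum_le_sum fun G _ => mul_le_mul_of_nonneg_left ?_ measureReal_nonneg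
    by_cases h : U ≤ G <;> simp [h]
    split_ifs <;> simp
  | succ j ih =>
    intro U hU
    by_cases hs : M ≤ plantedSum U p
    · have : ∀ G : SimpleGraph (Fin n), ¬ (U ≤ G ∧ NoSeed p M L G) := fun G hG =>
        absurd (hG.2 U hG.1 (by omega)) (not_lt.2 hs)
      simp only [this, if_false, zero_mul, mul_zero, Finset.sum_const_zero]
      have := p.2.1
      positivity
    push Not at hs
    have hp := p.2.1
    calc ∑ G, (SimpleGraph.binomialRandom (Fin n) p).real {G} *
          ((if U ≤ G ∧ NoSeed p M L G then 1 else 0) * (orderedCount G : ℝ) ^ (j + 1))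
        ≤ ∑ G, ∑ t with Compatible U t, (SimpleGraph.binomialRandom (Fin n) p).real {G} *
          ((if U ⊔ cycleOn t ≤ G ∧ NoSeed p M L G then 1 else 0) * (orderedCount G : ℝ) ^ j) := by
          refine Finset.sum_le_sum fun G _ => ?_
          rw [← Finset.mul_sum]
          refine mul_le_mul_of_nonneg_left ?_ measureReal_nonneg
          rw [← Finset.sum_mul, pow_succ', ← mul_assoc]
          refine mul_le_mul_of_nonneg_right ?_ (by positivity)
          by_cases hG : U ≤ G ∧ NoSeed p M L G
          · rw [if_pos hG, one_mul, orderedCount, Finset.sum_boole, Nat.cast_le,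
              Finset.filter_filter]
            refine Finset.card_le_card fun t ht => ?_
            simp only [Finset.mem_filter, Finset.mem_univ, true_and] at ht ⊢
            rw [isInducedCycle_iff] at ht
            exact ⟨ht.1.mono hG.1, sup_le hG.1 ht.2, hG.2⟩
          · rw [if_neg hG, zero_mul]
            exact Finset.sum_nonneg fun t _ => by split_ifs <;> simp
      _ = ∑ t with Compatible U t, ∑ G, (SimpleGraph.binomialRandom (Fin n) p).real {G} *
          ((if U ⊔ cycleOn t ≤ G ∧ NoSeed p M L G then 1 else 0) * (orderedCount G : ℝ) ^ j) :=
          Finset.sum_comm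
      _ ≤ ∑ t with Compatible U t, (p : ℝ) ^ U.edgeSet.ncard * cycleWeight U p t * M ^ j := by
          refine Finset.sum_le_sum fun t ht => ?_
          simp only [Finset.mem_filter, Finset.mem_univ, true_and] at ht
          obtain ⟨h1, h2⟩ := pow_ncard_sup_cycleOn U p ht
          rw [← h1]
          exact ih _ (by omega)
      _ = (p : ℝ) ^ U.edgeSet.ncard * plantedSum U p * M ^ j := by
          rw [plantedSum, Finset.mul_sum, Finset.sum_mul]
      _ ≤ (p : ℝ) ^ U.edgeSet.ncard * M ^ (j + 1) := by
          rw [pow_succ' M, mul_assoc]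
          gcongr

/-- The high moment bound for the upper tail in the absence of seeds. -/
theorem noSeed_tail_le {n : ℕ} (p : I) {M x : ℝ} (hM : 0 ≤ M) (hx : 0 < x) (L l : ℕ)
    (hl : 4 * l ≤ L) :
    (SimpleGraph.binomialRandom (Fin n) p).real
      {G | x ≤ (orderedCount G : ℝ) ∧ NoSeed p M L G} ≤ (M / x) ^ l := by
  classical
  have h := moment_le (n := n) p hM L l ⊥ (by simpa using hl)
  simp only [bot_le, true_and, SimpleGraph.edgeSet_bot, Set.ncard_empty, pow_zero, one_mul] at h
  rw [div_pow, le_div_iff₀ (by positivity), ← sum_real_singleton_filter, Finset.sum_mul]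
  refine le_trans (Finset.sum_le_sum fun G _ => ?_) h
  rw [mul_assoc]
  refine mul_le_mul_of_nonneg_left ?_ measureReal_nonneg
  by_cases h1 : NoSeed p M L G <;> by_cases h2 : x ≤ (orderedCount G : ℝ)
  · simp only [h1, h2, and_self, if_true, one_mul]
    gcongr
  all_goals simp [h1, h2]

/-! ### The expectation of the number of copies -/

theorem ncard_diagonals {n : ℕ} {a b c d : Fin n} (hac : a ≠ c) (hbd : b ≠ d)
    (h : s(a, c) ≠ s(b, d)) :
    (SimpleGraph.edge a c ⊔ SimpleGraph.edge b d).edgeSet.ncard = 2 := by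
  -- Multiplicativity in base `2` determines the number of edges, since powers of `2` are injective
  -- in the exponent.
  have h1 := (pow_ncard_sup_edge ⊥ (2 : ℝ) hac).1
  have h2 := (pow_ncard_sup_edge (⊥ ⊔ SimpleGraph.edge a c) (2 : ℝ) hbd).1
  rw [edgeWeight_sup_edge _ _ h.symm, h1] at h2
  simp only [bot_sup_eq, edgeWeight, SimpleGraph.bot_adj, if_false, SimpleGraph.edgeSet_bot,
    Set.ncard_empty, pow_zero, one_mul] at h2
  rw [← pow_two] at h2
  exact pow_right_injective₀ (by norm_num) (by norm_num) h2

/-- The event is an interval of graphs, from the cycle on `t` to the complement of its two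
diagonals. -/
theorem binomialRandom_real_isInducedCycle {n : ℕ} (p : I) {t : Fin n × Fin n × Fin n × Fin n}
    (ht : Compatible ⊥ t) :
    (SimpleGraph.binomialRandom (Fin n) p).real {G | IsInducedCycle G t} =
      (p : ℝ) ^ 4 * (1 - (p : ℝ)) ^ 2 := by
  classical
  obtain ⟨a, b, c, d⟩ := t
  have ht0 := ht
  obtain ⟨⟨hab, hbc, hcd, hda⟩, hac, hbd, -⟩ := ht
  simp only at *
  have hne : s(a, c) ≠ s(b, d) := by simp; grind
  set K : SimpleGraph (Fin n) := (SimpleGraph.edge a c ⊔ SimpleGraph.edge b d)ᶜ with hK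
  have hmem : ∀ G : SimpleGraph (Fin n), G ≤ K ↔ ¬ G.Adj a c ∧ ¬ G.Adj b d := by
    intro G
    rw [hK, le_compl_iff_disjoint_right, disjoint_sup_right, disjoint_comm,
      SimpleGraph.disjoint_edge, disjoint_comm, SimpleGraph.disjoint_edge]
  have hKc : n.choose 2 - K.edgeSet.ncard = 2 := by
    have h1 := ncard_diagonals hac hbd hne
    have h2 : K.edgeSet.ncard + 2 = n.choose 2 := by
      have h3 : K ⊔ (SimpleGraph.edge a c ⊔ SimpleGraph.edge b d) = ⊤ := compl_sup_eq_top
      have h4 : Disjoint K (SimpleGraph.edge a c ⊔ SimpleGraph.edge b d) := disjoint_compl_left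
      rw [show K.edgeSet.ncard + 2 = K.edgeSet.ncard +
        (SimpleGraph.edge a c ⊔ SimpleGraph.edge b d).edgeSet.ncard by rw [h1],
        ← Set.ncard_union_eq (SimpleGraph.disjoint_edgeSet.2 h4),
        ← SimpleGraph.edgeSet_sup, h3, ← SimpleGraph.coe_edgeFinset, Set.ncard_coe_finset,
        SimpleGraph.card_edgeFinset_top_eq_card_choose_two, Fintype.card_fin]
    omega
  have hle : cycleOn (a, b, c, d) ≤ K := by
    have hlt : IsInducedCycle (cycleOn (a, b, c, d)) (a, b, c, d) := by
      rw [isInducedCycle_iff]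
      refine ⟨⟨⟨hab, hbc, hcd, hda⟩, hac, hbd, ?_, ?_⟩, le_rfl⟩ <;>
      · simp only [cycleOn, SimpleGraph.sup_adj, SimpleGraph.edge_adj]
        grind
    exact (hmem _).2 hlt.2.2.2
  have hc : (cycleOn (a, b, c, d)).edgeSet.ncard = 4 := by
    have h4 := (pow_ncard_sup_cycleOn ⊥ (2 : ℝ) ht0).1
    simp only [bot_sup_eq, cycleWeight, edgeWeight, SimpleGraph.bot_adj, if_false,
      SimpleGraph.edgeSet_bot, Set.ncard_empty, pow_zero, one_mul] at h4
    exact pow_right_injective₀ (by norm_num : (0 : ℝ) < 2) (by norm_num) (h4.trans (by norm_num))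
  rw [show {G : SimpleGraph (Fin n) | IsInducedCycle G (a, b, c, d)} =
    {G | cycleOn (a, b, c, d) ≤ G ∧ G ≤ K} from ?_, binomialRandom_real_between p _ _ hle, hc, hKc]
  ext G
  simp only [Set.mem_ofPred_eq, isInducedCycle_iff, hmem, Compatible]
  tauto


open scoped Classical in
theorem card_compatible_bot (n : ℕ) :
    (Finset.univ.filter fun t : Fin n × Fin n × Fin n × Fin n => Compatible ⊥ t).card =
      n.descFactorial 4 := by
  have h := Fintype.card_embedding_eq (α := Fin 4) (β := Fin n)
  rw [Fintype.card_fin, Fintype.card_fin] at h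
  rw [← h, ← Finset.card_univ]
  symm
  refine Finset.card_bij (fun e _ => (e 0, e 1, e 2, e 3)) ?_ ?_ ?_
  · intro e _
    simp [Compatible]
  · intro e _ e' _ h
    ext i
    simp only [Prod.mk.injEq] at h
    fin_cases i <;> simp [h]
  · rintro ⟨a, b, c, d⟩ ht
    simp only [Finset.mem_filter, Finset.mem_univ, true_and, Compatible, SimpleGraph.bot_adj,
      not_false_eq_true, and_true] at ht
    obtain ⟨⟨hab, hbc, hcd, hda⟩, hac, hbd⟩ := ht
    have hinj : Function.Injective ![a, b, c, d] := by
      intro i j hij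
      fin_cases i <;> fin_cases j <;> simp_all
    exact ⟨⟨![a, b, c, d], hinj⟩, Finset.mem_univ _, by simp⟩

theorem integral_orderedCount (n : ℕ) (p : I) :
    8 * mean n p = n.descFactorial 4 * ((p : ℝ) ^ 4 * (1 - (p : ℝ)) ^ 2) := by
  classical
  have h1 : mean n p =
      ∑ G, (SimpleGraph.binomialRandom (Fin n) p).real {G} * (count G : ℝ) := by
    rw [mean, integral_fintype (Integrable.of_finite)]
    simp
  have h2 : ∀ G : SimpleGraph (Fin n), 8 * (count G : ℝ) =
      ∑ t with Compatible ⊥ t, if IsInducedCycle G t then 1 else 0 := by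
    intro G
    have h := orderedCount_eq G
    rw [Finset.sum_boole, Finset.filter_filter]
    have h3 : (8 * count G : ℝ) = orderedCount G := by rw [h]; push_cast; rfl
    rw [h3, orderedCount]
    congr 2
    ext t
    simp only [Finset.mem_filter, Finset.mem_univ, true_and, isInducedCycle_iff]
    exact ⟨fun h => ⟨h.1.mono bot_le, h⟩, fun h => h.2⟩
  rw [h1, Finset.mul_sum, ← card_compatible_bot, ← nsmul_eq_mul, ← Finset.sum_const]
  have h4 : ∀ G : SimpleGraph (Fin n), 8 * ((SimpleGraph.binomialRandom (Fin n) p).real {G} *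
      (count G : ℝ)) = ∑ t with Compatible ⊥ t, (SimpleGraph.binomialRandom (Fin n) p).real {G} *
        if IsInducedCycle G t then 1 else 0 := by
    intro G
    rw [← Finset.mul_sum, ← h2]; ring
  simp_rw [h4]
  rw [Finset.sum_comm]
  refine Finset.sum_congr rfl fun t ht => ?_
  rw [sum_real_singleton_filter]
  exact binomialRandom_real_isInducedCycle p (by simpa using ht)

theorem mean_le (n : ℕ) (p : I) : 8 * mean n p ≤ ((n : ℝ) ^ 2 * (p : ℝ) ^ 2) ^ 2 := by
  rw [integral_orderedCount]
  have hp0 := p.2.1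
  have hp1 := p.2.2
  have h : (n.descFactorial 4 : ℝ) ≤ (n : ℝ) ^ 4 := by
    exact_mod_cast Nat.descFactorial_le_pow n 4
  have h' : (1 - (p : ℝ)) ^ 2 ≤ 1 := pow_le_one₀ (by linarith) (by linarith)
  calc _ ≤ (n : ℝ) ^ 4 * ((p : ℝ) ^ 4 * 1) := by gcongr
    _ = _ := by ring

theorem le_mean (n : ℕ) (hn : 3 ≤ n) (p : I) :
    ((1 - 3 / n) ^ 2 * (1 - (p : ℝ)) * ((n : ℝ) ^ 2 * (p : ℝ) ^ 2)) ^ 2 ≤ 8 * mean n p := by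
  rw [integral_orderedCount]
  have hp0 := p.2.1
  have h : ((n : ℝ) - 3) ^ 4 ≤ (n.descFactorial 4 : ℝ) := by
    have := Nat.pow_sub_le_descFactorial n 4
    rw [show n + 1 - 4 = n - 3 by omega] at this
    calc ((n : ℝ) - 3) ^ 4 = (((n - 3) ^ 4 : ℕ) : ℝ) := by push_cast [hn]; rfl
      _ ≤ _ := by exact_mod_cast this
  have hn0 : (n : ℝ) ≠ 0 := by positivity
  calc _ = ((n : ℝ) - 3) ^ 4 * ((p : ℝ) ^ 4 * (1 - (p : ℝ)) ^ 2) := by field_simp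
    _ ≤ _ := by gcongr

/-! ### Cores and the union bound -/

/-- `H` has at most `L` edges and planted sum at least `M`, and every edge of it contributes at
least `τ` to the planted sum. -/
def IsCore {n : ℕ} (p M τ : ℝ) (L : ℕ) (H : SimpleGraph (Fin n)) : Prop :=
  H.edgeSet.ncard ≤ L ∧ M ≤ plantedSum H p ∧
    ∀ u v, H.Adj u v → τ ≤ plantedSum H p - plantedSum (H.deleteEdges {s(u, v)}) p

/-- Take a subgraph of `U` maximising the planted sum minus `τ` per edge. Deleting an edge cannot
raise this quantity, so each edge contributes at least `τ`; comparison with `U` itself loses at most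
`τ * L`. -/
theorem exists_isCore_le {n : ℕ} {p M τ : ℝ} {L : ℕ} (hτ : 0 ≤ τ) (U : SimpleGraph (Fin n))
    (hU : U.edgeSet.ncard ≤ L) (hM : M ≤ plantedSum U p) :
    ∃ H ≤ U, IsCore p (M - τ * L) τ L H := by
  classical
  obtain ⟨H, hH, hmax⟩ := Finset.exists_max_image (Finset.univ.filter fun H => H ≤ U)
    (fun H => plantedSum H p - τ * H.edgeSet.ncard) ⟨U, by simp⟩
  simp only [Finset.mem_filter, Finset.mem_univ, true_and] at hH hmax
  have hle : H.edgeSet.ncard ≤ U.edgeSet.ncard :=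
    Set.ncard_le_ncard (SimpleGraph.edgeSet_subset_edgeSet.2 hH)
  refine ⟨H, hH, hle.trans hU, ?_, ?_⟩
  · have h1 := hmax U le_rfl
    have h2 : τ * U.edgeSet.ncard ≤ τ * L := by gcongr
    have h3 : 0 ≤ τ * H.edgeSet.ncard := by positivity
    linarith
  · intro u v huv
    have h1 := hmax (H.deleteEdges {s(u, v)}) ((SimpleGraph.deleteEdges_le _).trans hH)
    have h2 : (H.deleteEdges {s(u, v)}).edgeSet.ncard + 1 = H.edgeSet.ncard := by
      rw [SimpleGraph.edgeSet_deleteEdges]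
      exact Set.ncard_sdiff_singleton_add_one huv (Set.toFinite _)
    rw [← h2] at h1
    push_cast at h1
    linarith

open scoped Classical in
/-- The upper tail is bounded by a high moment term and the expected number of cores. -/
theorem tail_le {n : ℕ} (p : I) {M x τ : ℝ} (hM : 0 ≤ M) (hx : 0 < x) (hτ : 0 ≤ τ) (L l : ℕ)
    (hl : 4 * l ≤ L) :
    (SimpleGraph.binomialRandom (Fin n) p).real {G | x ≤ (orderedCount G : ℝ)} ≤
      (M / x) ^ l + ∑ H : SimpleGraph (Fin n) with IsCore p (M - τ * L) τ L H,
        (p : ℝ) ^ H.edgeSet.ncard := by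
  have hsub : {G : SimpleGraph (Fin n) | x ≤ (orderedCount G : ℝ)} ⊆
      {G | x ≤ (orderedCount G : ℝ) ∧ NoSeed p M L G} ∪
        ⋃ H ∈ (Finset.univ.filter fun H => IsCore (p : ℝ) (M - τ * L) τ L H), {G | H ≤ G} := by
    intro G hG
    by_cases h : NoSeed p M L G
    · exact Or.inl ⟨hG, h⟩
    · right
      unfold NoSeed at h
      push Not at h
      obtain ⟨U, hUG, hUL, hUM⟩ := h
      obtain ⟨H, hHU, hH⟩ := exists_isCore_le hτ U hUL hUM
      simp only [Finset.mem_filter, Finset.mem_univ, true_and, Set.mem_iUnion]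
      exact ⟨H, hH, hHU.trans hUG⟩
  refine (measureReal_mono hsub).trans ((measureReal_union_le _ _).trans ?_)
  refine add_le_add (noSeed_tail_le p hM hx L l hl) ?_
  refine (measureReal_biUnion_finset_le _ _).trans (le_of_eq ?_)
  exact Finset.sum_congr rfl fun H _ => binomialRandom_real_ge p H

theorem upperTail_real {n : ℕ} (p : I) (δ : ℝ) :
    upperTail n p δ = ENNReal.ofReal ((SimpleGraph.binomialRandom (Fin n) p).real
      {G | (1 + δ) * (8 * mean n p) ≤ (orderedCount G : ℝ)}) := by
  rw [upperTail, ofReal_measureReal]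
  congr 1
  ext G
  simp only [Set.mem_ofPred_eq, orderedCount_eq]
  push_cast
  constructor <;> intro h <;> linarith


/-! ### Bounding the planted sum by degrees and cycle counts -/

open scoped Classical in
/-- The adjacency indicator of a graph. -/
noncomputable def adjInd {V : Type*} (H : SimpleGraph V) (u v : V) : ℝ :=
  if H.Adj u v then 1 else 0

section AdjInd
variable {V : Type*} (H : SimpleGraph V)

theorem adjInd_nonneg (u v : V) : 0 ≤ adjInd H u v := by
  unfold adjInd; split_ifs <;> simp

theorem adjInd_le_one (u v : V) : adjInd H u v ≤ 1 := by
  unfold adjInd; split_ifs <;> simp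

theorem adjInd_comm (u v : V) : adjInd H u v = adjInd H v u := by
  classical exact if_congr (H.adj_comm u v) rfl rfl

theorem edgeWeight_le_add_adjInd {p : ℝ} (hp : 0 ≤ p) (u v : V) :
    edgeWeight H p u v ≤ p + adjInd H u v := by
  unfold edgeWeight adjInd; split_ifs <;> linarith

open scoped Classical in
theorem sum_adjInd [Fintype V] (u : V) : ∑ v, adjInd H u v = H.degree u := by
  unfold adjInd
  rw [Finset.sum_boole, ← SimpleGraph.card_neighborFinset_eq_degree,
    SimpleGraph.neighborFinset_eq_filter]

open scoped Classical in
theorem sum_degree [Fintype V] : ∑ u, H.degree u = 2 * H.edgeSet.ncard := by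
  rw [SimpleGraph.sum_degrees_eq_twice_card_edges, ← SimpleGraph.coe_edgeFinset,
    Set.ncard_coe_finset]

open scoped Classical in
theorem sum_degree_real [Fintype V] : ∑ u, (H.degree u : ℝ) = 2 * H.edgeSet.ncard := by
  exact_mod_cast sum_degree H

theorem sum_sum_adjInd [Fintype V] : ∑ u, ∑ v, adjInd H u v = 2 * H.edgeSet.ncard := by
  classical
  rw [← sum_degree_real]
  exact Finset.sum_congr rfl fun u _ => sum_adjInd H u

end AdjInd

/-- Rotation of a quadruple. -/
def rotate (V : Type*) : (V × V × V × V) ≃ (V × V × V × V) where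
  toFun t := (t.2.1, t.2.2.1, t.2.2.2, t.1)
  invFun t := (t.2.2.2, t.1, t.2.1, t.2.2.1)
  left_inv _ := rfl
  right_inv _ := rfl

theorem compatible_rotate {V : Type*} {H : SimpleGraph V} {t : V × V × V × V} :
    Compatible H (rotate V t) ↔ Compatible H t := by
  obtain ⟨a, b, c, d⟩ := t
  simp only [Compatible, rotate, Equiv.coe_fn_mk, H.adj_comm c a]
  grind

theorem cycleWeight_rotate {V : Type*} (H : SimpleGraph V) (p : ℝ) (t : V × V × V × V) :
    cycleWeight H p (rotate V t) = cycleWeight H p t := by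
  simp only [cycleWeight, rotate, Equiv.coe_fn_mk]
  ring

open scoped Classical in
-- Rotation reduces the terms of the expansion to one representative of each type: one edge, two
-- adjacent edges, two opposite edges.
theorem sum_compatible_rotate {V : Type*} [Fintype V] (H : SimpleGraph V)
    (F : V × V × V × V → ℝ) :
    ∑ t with Compatible H t, F (rotate V t) = ∑ t with Compatible H t, F t := by
  rw [Finset.sum_filter, Finset.sum_filter, ← Equiv.sum_comp (rotate V) (fun t => if Compatible H t then F t else 0)]
  exact Finset.sum_congr rfl fun t _ => by simp only [compatible_rotate]

open scoped Classical in
theorem sum_compatible_pair {n : ℕ} (H : SimpleGraph (Fin n)) :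
    ∑ t with Compatible H t, adjInd H t.1 t.2.1 * adjInd H t.2.2.1 t.2.2.2 ≤
      4 * (H.edgeSet.ncard : ℝ) ^ 2 := by
  calc _ ≤ ∑ t : Fin n × Fin n × Fin n × Fin n,
        adjInd H t.1 t.2.1 * adjInd H t.2.2.1 t.2.2.2 :=
        Finset.sum_le_univ_sum_of_nonneg fun t =>
          mul_nonneg (adjInd_nonneg _ _ _) (adjInd_nonneg _ _ _)
    _ = (∑ a, ∑ b, adjInd H a b) * ∑ c, ∑ d, adjInd H c d := by
        simp only [Fintype.sum_prod_type, ← Finset.mul_sum, ← Finset.sum_mul]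
    _ = _ := by rw [sum_sum_adjInd]; ring

open scoped Classical in
theorem sum_compatible_single {n : ℕ} (H : SimpleGraph (Fin n)) :
    ∑ t with Compatible H t, adjInd H t.1 t.2.1 ≤ 2 * (H.edgeSet.ncard : ℝ) * n ^ 2 := by
  calc _ ≤ ∑ t : Fin n × Fin n × Fin n × Fin n, adjInd H t.1 t.2.1 :=
        Finset.sum_le_univ_sum_of_nonneg fun t => adjInd_nonneg _ _ _
    _ = (∑ a, ∑ b, adjInd H a b) * n ^ 2 := by
        simp only [Fintype.sum_prod_type, Finset.sum_const, Finset.card_univ, Fintype.card_fin,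
          Fintype.card_prod, nsmul_eq_mul, Finset.sum_mul]
        refine Finset.sum_congr rfl fun a _ => Finset.sum_congr rfl fun b _ => by push_cast; ring
    _ = _ := by rw [sum_sum_adjInd]

open scoped Classical in
-- The inducedness of the copies enters here: the fourth vertex is opposite to the middle vertex of
-- the path and must not be adjacent to it, which gives the factor `n - d(v)` instead of `n`.
theorem sum_compatible_path {n : ℕ} (H : SimpleGraph (Fin n)) :
    ∑ t with Compatible H t, adjInd H t.1 t.2.1 * adjInd H t.2.1 t.2.2.1 ≤
      ∑ v, (H.degree v : ℝ) ^ 2 * (n - H.degree v) := by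
  calc _ ≤ ∑ t : Fin n × Fin n × Fin n × Fin n,
        adjInd H t.1 t.2.1 * adjInd H t.2.1 t.2.2.1 * (1 - adjInd H t.2.1 t.2.2.2) := by
        rw [Finset.sum_filter]
        refine Finset.sum_le_sum fun t _ => ?_
        have h0 : 0 ≤ adjInd H t.1 t.2.1 * adjInd H t.2.1 t.2.2.1 :=
          mul_nonneg (adjInd_nonneg _ _ _) (adjInd_nonneg _ _ _)
        split_ifs with h
        · have : adjInd H t.2.1 t.2.2.2 = 0 := if_neg h.2.2.2.2
          rw [this]; linarith
        · exact mul_nonneg h0 (by linarith [adjInd_le_one H t.2.1 t.2.2.2])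
    _ = ∑ b, ∑ a, ∑ c, ∑ d, adjInd H a b * adjInd H b c * (1 - adjInd H b d) := by
        simp only [Fintype.sum_prod_type]
        exact Finset.sum_comm
    _ = _ := by
        refine Finset.sum_congr rfl fun b _ => ?_
        simp only [← Finset.mul_sum, ← Finset.sum_mul, Finset.sum_sub_distrib, sum_adjInd]
        simp only [Finset.sum_const, Finset.card_univ, Fintype.card_fin, nsmul_eq_mul, mul_one]
        rw [Finset.sum_congr rfl fun a _ => adjInd_comm H a b, sum_adjInd]
        ring

open scoped Classical in
theorem sum_compatible_cycle {n : ℕ} (H : SimpleGraph (Fin n)) :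
    ∑ t with Compatible H t, adjInd H t.1 t.2.1 * adjInd H t.2.1 t.2.2.1 *
      adjInd H t.2.2.1 t.2.2.2 * adjInd H t.2.2.2 t.1 = orderedCount H := by
  rw [orderedCount, ← Finset.sum_boole, Finset.sum_filter]
  refine Finset.sum_congr rfl fun t _ => ?_
  unfold adjInd
  by_cases h : IsInducedCycle H t
  · have := (isInducedCycle_iff.1 h).1
    obtain ⟨⟨h1, h2, h3, h4⟩, -⟩ := id h
    simp [h, this, h1, h2, h3, h4]
  · rw [if_neg h]
    split_ifs with hc h1 h2 h3 h4 <;> simp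
    exact h ⟨⟨h1, h2, h3, h4⟩, hc.2⟩

/-- Every cubic monomial contains an opposite pair `x * z` or `y * w`, and its third factor is at
most one. This turns the cubic terms into `2 * p` times the opposite pairs. -/
theorem mul_four_expand_le {p x y z w : ℝ} (hp : 0 ≤ p) (hx : 0 ≤ x) (hy : 0 ≤ y) (hz : 0 ≤ z)
    (hw : 0 ≤ w) (hx1 : x ≤ 1) (hy1 : y ≤ 1) (hz1 : z ≤ 1) (hw1 : w ≤ 1) :
    (p + x) * (p + y) * (p + z) * (p + w) ≤ p ^ 4 + p ^ 3 * (x + y + z + w) +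
      p ^ 2 * (x * y + y * z + z * w + w * x) + (p ^ 2 + 2 * p) * (x * z + y * w) +
      x * y * z * w := by
  have h1 : p * (x * z * y) ≤ p * (x * z * 1) := by gcongr
  have h2 : p * (x * z * w) ≤ p * (x * z * 1) := by gcongr
  have h3 : p * (y * w * x) ≤ p * (y * w * 1) := by gcongr
  have h4 : p * (y * w * z) ≤ p * (y * w * 1) := by gcongr
  nlinarith

open scoped Classical in
-- The coefficients count rotations: four single edges, four paths of two edges, two opposite pairs.
-- The main terms later are the first, the path term and `orderedCount H`; the others carry an extra
-- factor `p`.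
theorem plantedSum_le {n : ℕ} (H : SimpleGraph (Fin n)) {p : ℝ} (hp : 0 ≤ p) :
    plantedSum H p ≤ (n : ℝ) ^ 4 * p ^ 4 + 8 * H.edgeSet.ncard * n ^ 2 * p ^ 3 +
      4 * p ^ 2 * ∑ v, (H.degree v : ℝ) ^ 2 * (n - H.degree v) +
      (8 * p ^ 2 + 16 * p) * (H.edgeSet.ncard : ℝ) ^ 2 + orderedCount H := by
  set R := rotate (Fin n) with hR
  let X : Fin n × Fin n × Fin n × Fin n → ℝ := fun t => adjInd H t.1 t.2.1
  have hX0 : ∀ t, 0 ≤ X t := fun t => adjInd_nonneg _ _ _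
  have hX1 : ∀ t, X t ≤ 1 := fun t => adjInd_le_one _ _ _
  have hE : ∀ t, cycleWeight H p t ≤ p ^ 4 +
      p ^ 3 * (X t + X (R t) + X (R (R t)) + X (R (R (R t)))) +
      p ^ 2 * (X t * X (R t) + X (R t) * X (R (R t)) + X (R (R t)) * X (R (R (R t))) +
        X (R (R (R t))) * X (R (R (R (R t))))) +
      (p ^ 2 + 2 * p) * (X t * X (R (R t)) + X (R t) * X (R (R (R t)))) +
      X t * X (R t) * X (R (R t)) * X (R (R (R t))) := by
    intro t
    refine le_trans ?_ (mul_four_expand_le hp (hX0 t) (hX0 (R t)) (hX0 (R (R t)))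
      (hX0 (R (R (R t)))) (hX1 _) (hX1 _) (hX1 _) (hX1 _))
    have h0 := edgeWeight_nonneg H hp
    have h1 := edgeWeight_le_add_adjInd H hp
    unfold cycleWeight
    have hA : ∀ u v, 0 ≤ p + adjInd H u v := fun u v => add_nonneg hp (adjInd_nonneg _ _ _)
    exact mul_le_mul (mul_le_mul (mul_le_mul (h1 _ _) (h1 _ _) (h0 _ _) (hA _ _)) (h1 _ _)
      (h0 _ _) (mul_nonneg (hA _ _) (hA _ _))) (h1 _ _) (h0 _ _)
      (mul_nonneg (mul_nonneg (hA _ _) (hA _ _)) (hA _ _))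
  have hrot := sum_compatible_rotate H
  have s1 := sum_compatible_single H
  have s2 := sum_compatible_path H
  have s3 := sum_compatible_pair H
  have s4 := sum_compatible_cycle H
  have hcard : ((Finset.univ.filter (Compatible H)).card : ℝ) ≤ (n : ℝ) ^ 4 := by
    have : (Finset.univ.filter (Compatible H)).card ≤ n ^ 4 := by
      refine (Finset.card_le_univ _).trans (le_of_eq ?_)
      simp only [Fintype.card_prod, Fintype.card_fin]; ring
    exact_mod_cast this
  have r1 := hrot X
  have r2 := hrot (fun t => X (R t))
  have r3 := hrot (fun t => X (R (R t)))
  have q1 := hrot (fun t => X t * X (R t))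
  have q2 := hrot (fun t => X (R t) * X (R (R t)))
  have q3 := hrot (fun t => X (R (R t)) * X (R (R (R t))))
  have o1 := hrot (fun t => X t * X (R (R t)))
  rw [← hR] at r1 r2 r3 q1 q2 q3 o1
  refine (Finset.sum_le_sum fun t _ => hE t).trans ?_
  simp only [Finset.sum_add_distrib, ← Finset.mul_sum, Finset.sum_const, nsmul_eq_mul]
  rw [r3, r2, r1, q3, q2, q1, o1]
  change ∑ t with Compatible H t, X t ≤ _ at s1
  change ∑ t with Compatible H t, X t * X (R t) ≤ _ at s2
  change ∑ t with Compatible H t, X t * X (R (R t)) ≤ _ at s3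
  change ∑ t with Compatible H t, X t * X (R t) * X (R (R t)) * X (R (R (R t))) = _ at s4
  rw [s4]
  have p4 : 0 ≤ p ^ 4 := by positivity
  have p3 : 0 ≤ p ^ 3 := by positivity
  have p2 : 0 ≤ p ^ 2 := by positivity
  have e0 := mul_le_mul_of_nonneg_right hcard p4
  have e1 := mul_le_mul_of_nonneg_left s1 p3
  have e2 := mul_le_mul_of_nonneg_left s2 p2
  have e3 := mul_le_mul_of_nonneg_left s3 (by positivity : 0 ≤ p ^ 2 + 2 * p)
  linarith

/-! ### The contribution of a single edge -/

theorem mul_three_expand_le {p x y z : ℝ} (hp : 0 ≤ p) (hp1 : p ≤ 1) (hx : 0 ≤ x) (hy : 0 ≤ y)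
    (hz : 0 ≤ z) (hx1 : x ≤ 1) (hy1 : y ≤ 1) (hz1 : z ≤ 1) :
    (p + x) * (p + y) * (p + z) ≤ p ^ 3 + p ^ 2 * (x + y + z) +
      2 * p * y + 2 * (x * z) := by
  have h1 : p * (x * y) ≤ p * (1 * y) := by gcongr
  have h2 : p * (y * z) ≤ p * (y * 1) := by gcongr
  have h3 : p * (x * z) ≤ 1 * (x * z) := by gcongr
  have h4 : x * z * y ≤ x * z * 1 := by gcongr
  nlinarith

open scoped Classical in
theorem sum_adjInd_ne {n : ℕ} (H : SimpleGraph (Fin n)) {u v : Fin n} (huv : H.Adj u v) :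
    ∑ c, (if c ≠ v then adjInd H u c else 0) = H.degree u - 1 := by
  have h : ∀ c, (if c ≠ v then adjInd H u c else 0) =
      adjInd H u c - if c = v then 1 else 0 := by
    intro c
    by_cases hc : c = v
    · subst hc; simp [adjInd, huv]
    · simp [hc]
  simp only [h, Finset.sum_sub_distrib, sum_adjInd, Finset.sum_ite_eq', Finset.mem_univ, if_true]

open scoped Classical in
/-- The contribution to the planted sum of the 4-cycles in which `uv` is the first edge. -/
theorem sum_rooted_le {n : ℕ} (H : SimpleGraph (Fin n)) {p : ℝ} (hp : 0 ≤ p) (hp1 : p ≤ 1)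
    {u v : Fin n} (huv : H.Adj u v) :
    ∑ c, ∑ d, (if Compatible H (u, v, c, d) then cycleWeight H p (u, v, c, d) else 0) ≤
      n ^ 2 * p ^ 3 + p ^ 2 * (n * (H.degree u + H.degree v) + 2 * H.edgeSet.ncard) +
      4 * H.edgeSet.ncard * p + 2 * ((H.degree u - 1) * (H.degree v - 1)) := by
  -- Compatibility gives `c ≠ u` and `d ≠ v`. Keeping these restrictions produces the degrees minus
  -- one, so that the last term vanishes at a pendant edge.
  have hE : ∀ c d, (if Compatible H (u, v, c, d) then cycleWeight H p (u, v, c, d) else 0) ≤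
      p ^ 3 + p ^ 2 * (adjInd H v c + adjInd H c d + adjInd H u d) + 2 * p * adjInd H c d +
      2 * ((if c ≠ u then adjInd H v c else 0) * (if d ≠ v then adjInd H u d else 0)) := by
    intro c d
    have x1 := adjInd_nonneg H v c
    have x2 := adjInd_nonneg H c d
    have x3 := adjInd_nonneg H u d
    split_ifs with h h1 h2 h2
    · refine le_trans ?_ (mul_three_expand_le hp hp1 x1 x2 x3 (adjInd_le_one _ _ _)
        (adjInd_le_one _ _ _) (adjInd_le_one _ _ _))
      have h0 := edgeWeight_nonneg H hp
      have h1 := edgeWeight_le_add_adjInd H hp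
      have hA : ∀ u v, 0 ≤ p + adjInd H u v := fun u v => add_nonneg hp (adjInd_nonneg _ _ _)
      have : edgeWeight H p u v = 1 := if_pos huv
      simp only [cycleWeight]
      rw [this, one_mul, adjInd_comm H u d]
      exact mul_le_mul (mul_le_mul (h1 _ _) (h1 _ _) (h0 _ _) (hA _ _)) (h1 _ _) (h0 _ _)
        (mul_nonneg (hA _ _) (hA _ _))
    · exact absurd h.2.2.1.symm h2
    · exact absurd h.2.1.symm h1
    · exact absurd h.2.1.symm h1
    all_goals positivity
  refine (Finset.sum_le_sum fun c _ => Finset.sum_le_sum fun d _ => hE c d).trans (le_of_eq ?_)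
  simp only [Finset.sum_add_distrib, ← Finset.mul_sum, ← Finset.sum_mul, Finset.sum_const,
    Finset.card_univ, Fintype.card_fin, nsmul_eq_mul, sum_adjInd, sum_degree_real,
    sum_adjInd_ne H huv, sum_adjInd_ne H huv.symm]
  ring

open scoped Classical in
-- Deleting `uv` only enlarges the set of compatible quadruples and only lowers the weights of
-- cycles through `uv`. The edge can occupy four positions in two orientations, whence the factor
-- eight.
theorem plantedSum_sub_deleteEdges_le {n : ℕ} (H : SimpleGraph (Fin n)) {p : ℝ} (hp : 0 ≤ p)
    (hp1 : p ≤ 1) {u v : Fin n} (huv : H.Adj u v) :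
    plantedSum H p - plantedSum (H.deleteEdges {s(u, v)}) p ≤
      8 * (n ^ 2 * p ^ 3 + p ^ 2 * (n * (H.degree u + H.degree v) + 2 * H.edgeSet.ncard) +
        4 * H.edgeSet.ncard * p + 2 * ((H.degree u - 1) * (H.degree v - 1))) := by
  set H' := H.deleteEdges {s(u, v)} with hH'
  set R := rotate (Fin n) with hR
  let D : Fin n × Fin n × Fin n × Fin n → ℝ :=
    fun t => if s(t.1, t.2.1) = s(u, v) then cycleWeight H p t else 0
  have hw0 := cycleWeight_nonneg H hp
  have hw0' := cycleWeight_nonneg H' hp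
  have hD0 : ∀ t, 0 ≤ D t := fun t => by
    simp only [D]; split_ifs; exacts [hw0 t, le_rfl]
  have hstep : ∀ t, cycleWeight H p t - cycleWeight H' p t ≤
      D t + D (R t) + D (R (R t)) + D (R (R (R t))) := by
    intro t
    by_cases h1 : s(t.1, t.2.1) = s(u, v)
    · have : D t = cycleWeight H p t := if_pos h1
      linarith [hD0 (R t), hD0 (R (R t)), hD0 (R (R (R t))), hw0' t]
    by_cases h2 : s(t.2.1, t.2.2.1) = s(u, v)
    · have : D (R t) = cycleWeight H p t := by
        rw [← cycleWeight_rotate]; exact if_pos h2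
      linarith [hD0 t, hD0 (R (R t)), hD0 (R (R (R t))), hw0' t]
    by_cases h3 : s(t.2.2.1, t.2.2.2) = s(u, v)
    · have : D (R (R t)) = cycleWeight H p t := by
        rw [← cycleWeight_rotate, ← cycleWeight_rotate]; exact if_pos h3
      linarith [hD0 t, hD0 (R t), hD0 (R (R (R t))), hw0' t]
    by_cases h4 : s(t.2.2.2, t.1) = s(u, v)
    · have : D (R (R (R t))) = cycleWeight H p t := by
        rw [← cycleWeight_rotate, ← cycleWeight_rotate, ← cycleWeight_rotate]; exact if_pos h4
      linarith [hD0 t, hD0 (R t), hD0 (R (R t)), hw0' t]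
    have hadj : ∀ x y, s(x, y) ≠ s(u, v) → edgeWeight H' p x y = edgeWeight H p x y := by
      intro x y hxy
      unfold edgeWeight
      have : H'.Adj x y ↔ H.Adj x y := by
        rw [hH', SimpleGraph.deleteEdges_adj]; simp only [Set.mem_singleton_iff]; tauto
      rw [this]
    have : cycleWeight H' p t = cycleWeight H p t := by
      unfold cycleWeight
      rw [hadj _ _ h1, hadj _ _ h2, hadj _ _ h3, hadj _ _ h4]
    linarith [hD0 t, hD0 (R t), hD0 (R (R t)), hD0 (R (R (R t)))]
  have hsum : plantedSum H p - plantedSum H' p ≤ 4 * ∑ t with Compatible H t, D t := by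
    have hsub : ∑ t with Compatible H t, cycleWeight H' p t ≤ plantedSum H' p := by
      refine Finset.sum_le_sum_of_subset_of_nonneg ?_ fun t _ _ => hw0' t
      intro t ht
      simp only [Finset.mem_filter, Finset.mem_univ, true_and] at ht ⊢
      exact ht.mono (SimpleGraph.deleteEdges_le _)
    have h1 : plantedSum H p - ∑ t with Compatible H t, cycleWeight H' p t ≤
        ∑ t with Compatible H t, (D t + D (R t) + D (R (R t)) + D (R (R (R t)))) := by
      rw [plantedSum, ← Finset.sum_sub_distrib]
      exact Finset.sum_le_sum fun t _ => hstep t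
    have r1 := sum_compatible_rotate H D
    have r2 := sum_compatible_rotate H (fun t => D (R t))
    have r3 := sum_compatible_rotate H (fun t => D (R (R t)))
    rw [← hR] at r1 r2 r3
    simp only [Finset.sum_add_distrib] at h1
    linarith
  have hroot : ∑ t with Compatible H t, D t ≤
      ∑ c, ∑ d, (if Compatible H (u, v, c, d) then cycleWeight H p (u, v, c, d) else 0) +
      ∑ c, ∑ d, (if Compatible H (v, u, c, d) then cycleWeight H p (v, u, c, d) else 0) := by
    rw [Finset.sum_filter, Fintype.sum_prod_type]
    simp only [Fintype.sum_prod_type]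
    have h : ∀ a b, (∑ c, ∑ d, if Compatible H (a, b, c, d) then D (a, b, c, d) else 0) ≤
        (if a = u then if b = v then ∑ c, ∑ d, (if Compatible H (u, v, c, d) then
          cycleWeight H p (u, v, c, d) else 0) else 0 else 0) +
        (if a = v then if b = u then ∑ c, ∑ d, (if Compatible H (v, u, c, d) then
          cycleWeight H p (v, u, c, d) else 0) else 0 else 0) := by
      intro a b
      have hne := huv.ne
      by_cases h1 : a = u ∧ b = v
      · obtain ⟨rfl, rfl⟩ := h1
        simp [D, hne]
      by_cases h2 : a = v ∧ b = u
      · obtain ⟨rfl, rfl⟩ := h2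
        simp [D, hne, hne.symm]
      have : ¬ s(a, b) = s(u, v) := by simp only [Sym2.eq_iff]; tauto
      simp only [D, this, if_false, ite_self, Finset.sum_const_zero]
      split_ifs <;> first | tauto | simp
    refine (Finset.sum_le_sum fun a _ => Finset.sum_le_sum fun b _ => h a b).trans (le_of_eq ?_)
    simp [Finset.sum_add_distrib]
  have b1 := sum_rooted_le H hp hp1 huv
  have b2 := sum_rooted_le H hp hp1 huv.symm
  linarith


/-! ### Counting graphs that satisfy the degree condition -/

theorem card_small_subsets_le {α : Type*} [DecidableEq α] (R : Finset α) (d : ℕ) {Λ : ℝ}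
    (hΛ : 1 ≤ Λ) (hR : (R.card : ℝ) ≤ 2 * Λ * d) :
    ((R.powerset.filter fun S => S.card ≤ d).card : ℝ) ≤ (2 * Real.exp 1 * Λ) ^ d := by
  -- Exponential weighting: each counted set has weight at least `t ^ d`, while all subsets together
  -- weigh `(1 + t) ^ |R|`, at most `exp (t |R|)`; this `t` makes the exponent at most `d`.
  set t : ℝ := 1 / (2 * Λ) with ht
  have ht0 : 0 < t := by positivity
  have ht1 : t ≤ 1 := by rw [ht, div_le_one (by positivity)]; linarith
  have h1 : ((R.powerset.filter fun S => S.card ≤ d).card : ℝ) * t ^ d ≤ (t + 1) ^ R.card := by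
    rw [← Finset.sum_pow_mul_eq_add_pow, ← nsmul_eq_mul, ← Finset.sum_const]
    refine (Finset.sum_le_sum fun S hS => ?_).trans
      (Finset.sum_le_sum_of_subset_of_nonneg (Finset.filter_subset _ _) fun S _ _ => by positivity)
    rw [one_pow, mul_one]
    exact pow_le_pow_of_le_one ht0.le ht1 (Finset.mem_filter.1 hS).2
  have h2 : (t + 1) ^ R.card ≤ Real.exp 1 ^ d := by
    calc (t + 1) ^ R.card ≤ Real.exp t ^ R.card := by gcongr; exact Real.add_one_le_exp t
      _ = Real.exp (R.card * t) := by rw [← Real.exp_nat_mul]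
      _ ≤ Real.exp (d * 1) := by
        refine Real.exp_le_exp.2 ?_
        calc R.card * t ≤ 2 * Λ * d * t := by gcongr
          _ = d * 1 := by rw [ht]; field_simp
      _ = Real.exp 1 ^ d := by rw [← Real.exp_nat_mul]
  have h3 : (2 * Real.exp 1 * Λ) ^ d * t ^ d = Real.exp 1 ^ d := by
    rw [← mul_pow]; congr 1; rw [ht]; field_simp
  have h4 : 0 < t ^ d := by positivity
  refine le_of_mul_le_mul_right ?_ h4
  rw [h3]; exact h1.trans h2

open scoped Classical in
/-- Every edge of `H` joins vertices whose degrees have a large product, or has an endpoint whose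
degree is nearly linear. -/
def DegreeCondition {n : ℕ} (Λ : ℝ) (H : SimpleGraph (Fin n)) : Prop :=
  ∀ u v, H.Adj u v → (H.edgeSet.ncard : ℝ) ≤ Λ * ((H.degree u - 1) * (H.degree v - 1)) ∨
    (n : ℝ) ≤ Λ * H.degree u ∨ (n : ℝ) ≤ Λ * H.degree v

open scoped Classical in
/-- The number of non-isolated vertices. -/
noncomputable def supportCard {n : ℕ} (H : SimpleGraph (Fin n)) : ℕ :=
  (Finset.univ.filter fun u => H.degree u ≠ 0).card

open scoped Classical in
theorem supportCard_le {n : ℕ} (H : SimpleGraph (Fin n)) :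
    supportCard H ≤ 2 * H.edgeSet.ncard := by
  rw [← sum_degree, supportCard, Finset.card_eq_sum_ones, Finset.sum_filter]
  refine Finset.sum_le_sum fun u _ => ?_
  split_ifs with h <;> omega

open scoped Classical in
-- The degree sequence alone determines candidate sets `R u` such that every edge is recorded at
-- some endpoint. If `d u` is nearly linear, all vertices are candidates; otherwise averaging over
-- the degree sum bounds `R u`. In both cases `R u` has at most `2 Λ d(u)` elements, so recording
-- the neighbours within `R u` costs a factor `2eΛ` per unit of degree.
theorem card_graphs_degrees_le {n : ℕ} {Λ : ℝ} (hΛ : 1 ≤ Λ) {m : ℕ} (hm : 0 < m) (d : Fin n → ℕ)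
    (hd : ∑ u, d u = 2 * m) :
    ((Finset.univ.filter fun H : SimpleGraph (Fin n) => H.edgeSet.ncard = m ∧
      (∀ u, H.degree u = d u) ∧ DegreeCondition Λ H).card : ℝ) ≤
      (2 * Real.exp 1 * Λ) ^ (2 * m) := by
  let R : Fin n → Finset (Fin n) := fun u => Finset.univ.filter fun w =>
    (m : ℝ) ≤ Λ * (d u * d w) ∨ (n : ℝ) ≤ Λ * d u
  have hR : ∀ u, ((R u).card : ℝ) ≤ 2 * Λ * d u := by
    intro u
    by_cases hu : (n : ℝ) ≤ Λ * d u
    · have h1 : ((R u).card : ℝ) ≤ n := by exact_mod_cast card_finset_fin_le (R u)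
      have : 0 ≤ Λ * d u := by positivity
      linarith
    · have hm' : (0 : ℝ) < m := by exact_mod_cast hm
      refine le_of_mul_le_mul_right ?_ hm'
      calc ((R u).card : ℝ) * m = ∑ w ∈ R u, (m : ℝ) := by simp
        _ ≤ ∑ w ∈ R u, Λ * (d u * d w) := by
          refine Finset.sum_le_sum fun w hw => ?_
          exact (Finset.mem_filter.1 hw).2.resolve_right hu
        _ ≤ ∑ w, Λ * (d u * d w) :=
          Finset.sum_le_univ_sum_of_nonneg fun w => by positivity
        _ = Λ * d u * (∑ w, d w : ℕ) := by
          push_cast; rw [Finset.mul_sum]; exact Finset.sum_congr rfl fun w _ => by ring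
        _ = 2 * Λ * d u * m := by rw [hd]; push_cast; ring
  let P : Finset (Fin n → Finset (Fin n)) :=
    Fintype.piFinset fun u => (R u).powerset.filter fun S => S.card ≤ d u
  have hcard : (P.card : ℝ) ≤ (2 * Real.exp 1 * Λ) ^ (2 * m) := by
    rw [← hd, ← Finset.prod_pow_eq_pow_sum, Fintype.card_piFinset]
    push_cast
    exact Finset.prod_le_prod (fun u _ => by positivity) fun u _ =>
      card_small_subsets_le _ _ hΛ (hR u)
  refine le_trans ?_ hcard
  rw [Nat.cast_le]
  refine Finset.card_le_card_of_injOn (fun H u => H.neighborFinset u ∩ R u) ?_ ?_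
  · intro H hH
    simp only [Finset.coe_filter, Finset.mem_univ, true_and, Set.mem_ofPred_eq] at hH
    simp only [P, Finset.mem_coe, Fintype.mem_piFinset, Finset.mem_filter, Finset.mem_powerset]
    refine fun u => ⟨Finset.inter_subset_right, ?_⟩
    rw [← hH.2.1 u, ← SimpleGraph.card_neighborFinset_eq_degree]
    exact Finset.card_le_card Finset.inter_subset_left
  · have key : ∀ H : SimpleGraph (Fin n), H.edgeSet.ncard = m → (∀ u, H.degree u = d u) →
        DegreeCondition Λ H → ∀ u v, H.Adj u v ↔
          v ∈ H.neighborFinset u ∩ R u ∨ u ∈ H.neighborFinset v ∩ R v := by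
      intro H h1 h2 h3 u v
      simp only [Finset.mem_inter, SimpleGraph.mem_neighborFinset, R, Finset.mem_filter,
        Finset.mem_univ, true_and]
      refine ⟨fun huv => ?_, ?_⟩
      · have h := h3 u v huv
        rw [h1, h2, h2] at h
        rcases h with h | h | h
        · left
          refine ⟨huv, Or.inl (h.trans ?_)⟩
          have hu : (1 : ℝ) ≤ d u := by
            rw [← h2]; exact_mod_cast (H.degree_pos_iff_exists_adj u).2 ⟨v, huv⟩
          have hv : (1 : ℝ) ≤ d v := by
            rw [← h2]; exact_mod_cast (H.degree_pos_iff_exists_adj v).2 ⟨u, huv.symm⟩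
          gcongr <;> linarith
        · exact Or.inl ⟨huv, Or.inr h⟩
        · exact Or.inr ⟨huv.symm, Or.inr h⟩
      · rintro (h | h)
        exacts [h.1, h.1.symm]
    intro H hH H' hH' heq
    simp only [Finset.coe_filter, Finset.mem_univ, true_and, Set.mem_ofPred_eq] at hH hH'
    ext u v
    rw [key H hH.1 hH.2.1 hH.2.2, key H' hH'.1 hH'.2.1 hH'.2.2]
    have e1 := congrFun heq u
    have e2 := congrFun heq v
    simp only at e1 e2
    rw [e1, e2]

open scoped Classical in
-- Choose the support and then distribute the total degree `2m` over it. Since `v ≤ 2m`, there are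
-- at most `4 ^ (2m)` distributions, which turn `2eΛ` into `8eΛ`. Only the choice of the support
-- depends on `n`.
theorem card_graphs_le {n : ℕ} {Λ : ℝ} (hΛ : 1 ≤ Λ) {m : ℕ} (hm : 0 < m) (v : ℕ) :
    ((Finset.univ.filter fun H : SimpleGraph (Fin n) => H.edgeSet.ncard = m ∧
      supportCard H = v ∧ DegreeCondition Λ H).card : ℝ) ≤
      n.choose v * (8 * Real.exp 1 * Λ) ^ (2 * m) := by
  by_cases hv : 2 * m < v
  · rw [Finset.filter_false_of_mem]
    · simp only [Finset.card_empty, Nat.cast_zero]; positivity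
    · rintro H - ⟨h1, h2, -⟩
      have := supportCard_le H
      omega
  push Not at hv
  let D : Finset (Fin n → ℕ) :=
    (Finset.powersetCard v Finset.univ).biUnion fun S => Finset.piAntidiag S (2 * m)
  have hD : (D.card : ℝ) ≤ n.choose v * 4 ^ (2 * m) := by
    have h1 : ∀ S ∈ Finset.powersetCard v (Finset.univ : Finset (Fin n)),
        (Finset.piAntidiag S (2 * m)).card ≤ 4 ^ (2 * m) := by
      intro S hS
      have h2 : (Finset.piAntidiag S (2 * m)).card = (S.finsuppAntidiag (2 * m)).card := by
        simp [Finset.finsuppAntidiag]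
      rw [h2, Finset.card_finsuppAntidiag_nat_eq_choose, (Finset.mem_powersetCard.1 hS).2]
      calc _ ≤ 2 ^ (v + 2 * m - 1) := Nat.choose_le_two_pow _ _
        _ ≤ 2 ^ (2 * (2 * m)) := Nat.pow_le_pow_right (by norm_num) (by omega)
        _ = 4 ^ (2 * m) := by rw [pow_mul]; norm_num
    have h3 := Finset.card_biUnion_le_card_mul _ _ _ h1
    rw [Finset.card_powersetCard, Finset.card_univ, Fintype.card_fin] at h3
    exact_mod_cast h3
  have hsub : (Finset.univ.filter fun H : SimpleGraph (Fin n) => H.edgeSet.ncard = m ∧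
      supportCard H = v ∧ DegreeCondition Λ H) ⊆ D.biUnion fun d =>
        Finset.univ.filter fun H : SimpleGraph (Fin n) => (∑ u, d u = 2 * m) ∧
          H.edgeSet.ncard = m ∧ (∀ u, H.degree u = d u) ∧ DegreeCondition Λ H := by
    intro H hH
    simp only [Finset.mem_filter, Finset.mem_univ, true_and] at hH
    obtain ⟨h1, h2, h3⟩ := hH
    have h4 : ∑ u, H.degree u = 2 * m := by rw [sum_degree, h1]
    simp only [Finset.mem_biUnion, Finset.mem_filter, Finset.mem_univ, true_and, D,
      Finset.mem_powersetCard, Finset.subset_univ, Finset.mem_piAntidiag]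
    refine ⟨fun u => H.degree u, ⟨Finset.univ.filter fun u => H.degree u ≠ 0, h2, ?_, ?_⟩, h4, h1,
      fun _ => rfl, h3⟩
    · rw [Finset.sum_filter_ne_zero, h4]
    · intro i hi
      simpa using hi
  have h5 : ∀ d ∈ D, ((Finset.univ.filter fun H : SimpleGraph (Fin n) => (∑ u, d u = 2 * m) ∧
      H.edgeSet.ncard = m ∧ (∀ u, H.degree u = d u) ∧ DegreeCondition Λ H).card : ℝ) ≤
        (2 * Real.exp 1 * Λ) ^ (2 * m) := by
    intro d _
    by_cases hd : ∑ u, d u = 2 * m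
    · simp only [hd, true_and]
      exact card_graphs_degrees_le hΛ hm d hd
    · simp only [hd, false_and, Finset.filter_false, Finset.card_empty, Nat.cast_zero]
      positivity
  calc _ ≤ ((D.biUnion fun d =>
        Finset.univ.filter fun H : SimpleGraph (Fin n) => (∑ u, d u = 2 * m) ∧
          H.edgeSet.ncard = m ∧ (∀ u, H.degree u = d u) ∧ DegreeCondition Λ H).card : ℝ) := by
        exact_mod_cast Finset.card_le_card hsub
    _ ≤ ∑ d ∈ D, ((Finset.univ.filter fun H : SimpleGraph (Fin n) => (∑ u, d u = 2 * m) ∧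
          H.edgeSet.ncard = m ∧ (∀ u, H.degree u = d u) ∧ DegreeCondition Λ H).card : ℝ) := by
        exact_mod_cast Finset.card_biUnion_le
    _ ≤ ∑ d ∈ D, (2 * Real.exp 1 * Λ) ^ (2 * m) := Finset.sum_le_sum h5
    _ = D.card * (2 * Real.exp 1 * Λ) ^ (2 * m) := by simp
    _ ≤ n.choose v * 4 ^ (2 * m) * (2 * Real.exp 1 * Λ) ^ (2 * m) := by gcongr
    _ = _ := by rw [mul_assoc, ← mul_pow]; congr 2; ring

/-- Replacing `v` by `m` in the denominator costs only `exp m`, a constant factor per edge, since `m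
^ v / v!` is a term of the exponential series. -/
theorem choose_le_div_pow_mul_exp (n v : ℕ) {m : ℕ} (hm : 0 < m) :
    (n.choose v : ℝ) ≤ ((n : ℝ) / m) ^ v * Real.exp m := by
  have hm' : (0 : ℝ) < m := by exact_mod_cast hm
  calc (n.choose v : ℝ) ≤ (n : ℝ) ^ v / v.factorial := Nat.choose_le_pow_div v n
    _ = ((n : ℝ) / m) ^ v * ((m : ℝ) ^ v / v.factorial) := by rw [div_pow]; field_simp
    _ ≤ _ := by gcongr; exact Real.pow_div_factorial_le_exp _ hm'.le v

open scoped Classical in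
/-- The expected number of copies of a family of graphs satisfying the degree condition, each of
which is expensive relative to its number of vertices. -/
theorem sum_pow_ncard_le {n L : ℕ} {p Λ T : ℝ} (hp : 0 < p) (hΛ : 1 ≤ Λ)
    (F : Finset (SimpleGraph (Fin n)))
    (hF : ∀ H ∈ F, 0 < H.edgeSet.ncard ∧ H.edgeSet.ncard ≤ L ∧ DegreeCondition Λ H ∧
      T ≤ H.edgeSet.ncard * (Real.log (1 / p) - 1 - 2 * Real.log (8 * Real.exp 1 * Λ)) -
        supportCard H * Real.log (n / H.edgeSet.ncard)) :
    ∑ H ∈ F, p ^ H.edgeSet.ncard ≤ (L + 1) * (n + 1) * Real.exp (-T) := by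
  by_cases hn : n = 0
  · subst hn
    have : F = ∅ := by
      rw [Finset.eq_empty_iff_forall_notMem]
      intro H hH
      have h := (hF H hH).1
      have : H.edgeSet = ∅ := by
        rw [Set.eq_empty_iff_forall_notMem]
        rintro ⟨a, b⟩; exact a.elim0
      rw [this] at h; simp at h
    rw [this, Finset.sum_empty]; positivity
  have hn' : (0 : ℝ) < n := by exact_mod_cast Nat.pos_of_ne_zero hn
  -- Grouping by numbers of edges and of support vertices gives `(L + 1) * (n + 1)` classes, each
  -- contributing at most `exp (-T)`.
  have hmaps : ∀ H ∈ F, (H.edgeSet.ncard, supportCard H) ∈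
      Finset.range (L + 1) ×ˢ Finset.range (n + 1) := by
    intro H hH
    have h1 : supportCard H ≤ n := card_finset_fin_le _
    have h2 := (hF H hH).2.1
    simp only [Finset.mem_product, Finset.mem_range]
    omega
  rw [← Finset.sum_fiberwise_of_maps_to hmaps]
  have hb : ∀ x ∈ Finset.range (L + 1) ×ˢ Finset.range (n + 1),
      ∑ H ∈ F with (H.edgeSet.ncard, supportCard H) = x, p ^ H.edgeSet.ncard ≤ Real.exp (-T) := by
    rintro ⟨m, v⟩ -
    by_cases hne : (F.filter fun H => (H.edgeSet.ncard, supportCard H) = (m, v)).Nonempty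
    · obtain ⟨H₀, hH₀⟩ := hne
      simp only [Finset.mem_filter, Prod.mk.injEq] at hH₀
      obtain ⟨hH₀F, e1, e2⟩ := hH₀
      obtain ⟨hm, -, -, hT⟩ := hF H₀ hH₀F
      rw [e1, e2] at hT
      rw [e1] at hm
      have hm' : (0 : ℝ) < m := by exact_mod_cast hm
      calc ∑ H ∈ F with (H.edgeSet.ncard, supportCard H) = (m, v), p ^ H.edgeSet.ncard
          = ∑ H ∈ F with (H.edgeSet.ncard, supportCard H) = (m, v), p ^ m := by
            refine Finset.sum_congr rfl fun H hH => ?_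
            simp only [Finset.mem_filter, Prod.mk.injEq] at hH
            rw [hH.2.1]
        _ = ((F.filter fun H => (H.edgeSet.ncard, supportCard H) = (m, v)).card : ℝ) * p ^ m := by
            simp
        _ ≤ ((Finset.univ.filter fun H : SimpleGraph (Fin n) => H.edgeSet.ncard = m ∧
              supportCard H = v ∧ DegreeCondition Λ H).card : ℝ) * p ^ m := by
            gcongr
            intro H hH
            simp only [Finset.mem_filter, Prod.mk.injEq, Finset.mem_univ, true_and] at hH ⊢
            exact ⟨hH.2.1, hH.2.2, (hF H hH.1).2.2.1⟩
        _ ≤ n.choose v * (8 * Real.exp 1 * Λ) ^ (2 * m) * p ^ m := by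
            gcongr; exact card_graphs_le hΛ hm v
        _ ≤ ((n : ℝ) / m) ^ v * Real.exp m * (8 * Real.exp 1 * Λ) ^ (2 * m) * p ^ m := by
            gcongr; exact choose_le_div_pow_mul_exp n v hm
        _ = Real.exp (-(m * (Real.log (1 / p) - 1 - 2 * Real.log (8 * Real.exp 1 * Λ)) -
              v * Real.log (n / m))) := by
            have h1 : ((n : ℝ) / m) ^ v = Real.exp (v * Real.log (n / m)) := by
              rw [Real.exp_nat_mul, Real.exp_log (by positivity)]
            have h2 : (8 * Real.exp 1 * Λ) ^ (2 * m) =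
                Real.exp ((2 * m : ℕ) * Real.log (8 * Real.exp 1 * Λ)) := by
              rw [Real.exp_nat_mul, Real.exp_log (by positivity)]
            have h3 : p ^ m = Real.exp (m * Real.log p) := by
              rw [Real.exp_nat_mul, Real.exp_log hp]
            rw [h1, h2, h3, ← Real.exp_add, ← Real.exp_add, ← Real.exp_add]
            congr 1
            rw [one_div, Real.log_inv]
            push_cast
            ring
        _ ≤ Real.exp (-T) := Real.exp_le_exp.2 (by linarith)
    · rw [Finset.not_nonempty_iff_eq_empty.1 hne, Finset.sum_empty]
      positivity
  refine (Finset.sum_le_sum hb).trans (le_of_eq ?_)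
  simp


/-! ### Induced 4-cycles relative to an independent set -/

section StructureBound
open scoped Classical
variable {n : ℕ} (H : SimpleGraph (Fin n)) (W : Finset (Fin n))

theorem isInducedCycle_rotate {t : Fin n × Fin n × Fin n × Fin n} :
    IsInducedCycle H (rotate _ t) ↔ IsInducedCycle H t := by
  obtain ⟨a, b, c, d⟩ := t
  simp only [IsInducedCycle, rotate, Equiv.coe_fn_mk, H.adj_comm c a]
  grind

/-- The indicator of an induced 4-cycle. -/
noncomputable def cycleInd (t : Fin n × Fin n × Fin n × Fin n) : ℝ :=
  if IsInducedCycle H t then 1 else 0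

theorem sum_cycleInd_rotate (F : Fin n × Fin n × Fin n × Fin n → ℝ) :
    ∑ t, cycleInd H t * F (rotate _ t) = ∑ t, cycleInd H t * F t := by
  rw [← Equiv.sum_comp (rotate _) (fun t => cycleInd H t * F t)]
  exact Finset.sum_congr rfl fun t _ => by simp only [cycleInd, isInducedCycle_rotate]

/-- The indicator of the complement of `W`. -/
noncomputable def outInd (v : Fin n) : ℝ := if v ∈ W then 0 else 1

/-- The indicator of `W`. -/
noncomputable def inInd (v : Fin n) : ℝ := if v ∈ W then 1 else 0

/-- By independence every edge meets `W` in at most one vertex, so the degree sum over `W` counts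
each edge meeting `W` exactly once. -/
theorem sum_adjInd_outside (hW : ∀ u ∈ W, ∀ v ∈ W, ¬ H.Adj u v) :
    ∑ u, ∑ v, outInd W u * outInd W v * adjInd H u v =
      2 * (H.edgeSet.ncard - ∑ w ∈ W, (H.degree w : ℝ)) := by
  have h1 : ∀ u v, outInd W u * outInd W v * adjInd H u v =
      adjInd H u v - inInd W u * adjInd H u v - inInd W v * adjInd H u v := by
    intro u v
    unfold outInd inInd
    by_cases hu : u ∈ W <;> by_cases hv : v ∈ W <;> simp [hu, hv]
    rw [adjInd, if_neg (hW u hu v hv)]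
  have h2 : ∑ u, ∑ v, inInd W u * adjInd H u v = ∑ w ∈ W, (H.degree w : ℝ) := by
    simp only [← Finset.mul_sum, sum_adjInd]
    simp [inInd]
  have h3 : ∑ u, ∑ v, inInd W v * adjInd H u v = ∑ w ∈ W, (H.degree w : ℝ) := by
    rw [← h2, Finset.sum_comm]
    exact Finset.sum_congr rfl fun u _ => Finset.sum_congr rfl fun v _ => by rw [adjInd_comm]
  simp only [h1, Finset.sum_sub_distrib, h2, h3, sum_sum_adjInd]
  ring

/-- A cycle is determined by two opposite edges with orientations, but of `(a, b, c, d)` and `(a, b,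
d, c)` at most one is an induced cycle, because an edge of the first is a diagonal of the second.
This saves a factor two. -/
theorem sum_cycles_outside_le (hW : ∀ u ∈ W, ∀ v ∈ W, ¬ H.Adj u v) :
    ∑ t, cycleInd H t * (outInd W t.1 * outInd W t.2.1 * outInd W t.2.2.1 * outInd W t.2.2.2) ≤
      2 * (H.edgeSet.ncard - ∑ w ∈ W, (H.degree w : ℝ)) ^ 2 := by
  set z : Fin n → Fin n → Fin n → Fin n → ℝ := fun a b c d =>
    cycleInd H (a, b, c, d) * (outInd W a * outInd W b * outInd W c * outInd W d) with hz
  have h1 : ∀ a b c d, z a b c d + z a b d c ≤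
      (outInd W a * outInd W b * adjInd H a b) * (outInd W c * outInd W d * adjInd H c d) := by
    intro a b c d
    simp only [hz, cycleInd, outInd, adjInd]
    by_cases h : IsInducedCycle H (a, b, c, d)
    · have h' : ¬ IsInducedCycle H (a, b, d, c) := fun h' =>
        h.2.2.2.1 (h'.1.2.2.2.symm)
      have e1 : H.Adj a b := h.1.1
      have e2 : H.Adj c d := h.1.2.2.1
      simp only [h, h', e1, e2, if_true, if_false]
      split_ifs <;> simp
    · by_cases h' : IsInducedCycle H (a, b, d, c)
      · have e1 : H.Adj a b := h'.1.1
        have e2 : H.Adj c d := h'.1.2.2.1.symm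
        simp only [h, h', e1, e2, if_true, if_false]
        split_ifs <;> simp
      · simp only [h, h', if_false]
        split_ifs <;> simp
  have h2 : ∑ a, ∑ b, ∑ c, ∑ d, z a b c d = ∑ a, ∑ b, ∑ c, ∑ d, z a b d c :=
    Finset.sum_congr rfl fun a _ => Finset.sum_congr rfl fun b _ => Finset.sum_comm
  have h3 : ∑ a, ∑ b, ∑ c, ∑ d, (z a b c d + z a b d c) ≤
      (∑ a, ∑ b, outInd W a * outInd W b * adjInd H a b) *
        ∑ c, ∑ d, outInd W c * outInd W d * adjInd H c d := by
    simp only [Finset.sum_mul]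
    refine Finset.sum_le_sum fun a _ => Finset.sum_le_sum fun b _ => ?_
    simp only [Finset.mul_sum]
    exact Finset.sum_le_sum fun c _ => Finset.sum_le_sum fun d _ => h1 a b c d
  simp only [Finset.sum_add_distrib] at h3
  rw [sum_adjInd_outside H W hW] at h3
  simp only [Fintype.sum_prod_type]
  change ∑ a, ∑ b, ∑ c, ∑ d, z a b c d ≤ _
  nlinarith

/-- Fix `a` in `W`. Its neighbour `b` is outside `W`, and so is the opposite vertex `c`; as `a` is
adjacent to `b` but not to `c`, each edge outside `W` arises in only one orientation. There remain
`d(a) - 1` choices for the fourth vertex. -/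
theorem sum_cycles_one_le (hW : ∀ u ∈ W, ∀ v ∈ W, ¬ H.Adj u v) :
    ∑ t, cycleInd H t * (inInd W t.1 * outInd W t.2.2.1) ≤
      (∑ w ∈ W, √((H.degree w : ℝ) * (H.degree w - 1))) *
        (H.edgeSet.ncard - ∑ w ∈ W, (H.degree w : ℝ)) := by
  set D : ℝ := H.edgeSet.ncard - ∑ w ∈ W, (H.degree w : ℝ) with hD
  let y : Fin n → Fin n → Fin n → ℝ := fun a b c =>
    if H.Adj a b ∧ ¬ H.Adj a c ∧ c ∉ W ∧ H.Adj b c then 1 else 0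
  have hy : ∀ a ∈ W, ∑ b, ∑ c, y a b c ≤ D := by
    intro a ha
    have h1 : ∀ b c, y a b c + y a c b ≤ outInd W b * outInd W c * adjInd H b c := by
      intro b c
      have hb : H.Adj a b → b ∉ W := fun h hb => hW a ha b hb h
      have hc : H.Adj a c → c ∉ W := fun h hc => hW a ha c hc h
      simp only [y, outInd, adjInd, H.adj_comm c b]
      by_cases h1 : H.Adj a b <;> by_cases h2 : H.Adj a c <;> by_cases h3 : H.Adj b c <;>
        by_cases h4 : b ∈ W <;> by_cases h5 : c ∈ W <;> simp_all
    have h2 : ∑ b, ∑ c, (y a b c + y a c b) ≤ 2 * D := by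
      rw [← sum_adjInd_outside H W hW]
      exact Finset.sum_le_sum fun b _ => Finset.sum_le_sum fun c _ => h1 b c
    simp only [Finset.sum_add_distrib] at h2
    rw [Finset.sum_comm (f := fun b c => y a c b)] at h2
    linarith
  have hD0 : W.Nonempty → 0 ≤ D := by
    rintro ⟨a, ha⟩
    refine le_trans ?_ (hy a ha)
    exact Finset.sum_nonneg fun b _ => Finset.sum_nonneg fun c _ => by
      simp only [y]; split_ifs <;> simp
  have hz : ∀ a b c d, cycleInd H (a, b, c, d) * (inInd W a * outInd W c) ≤
      inInd W a * (y a b c * (if d ≠ b then adjInd H a d else 0)) := by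
    intro a b c d
    by_cases h : IsInducedCycle H (a, b, c, d)
    · obtain ⟨⟨h1, h2, h3, h4⟩, h5, h6, h7, h8⟩ := id h
      simp only at h1 h2 h3 h4 h5 h6 h7 h8
      simp only [cycleInd, h, inInd, outInd, y, adjInd, h1, h2, h7, h4.symm, h6.symm, if_true,
        not_false_eq_true, true_and, and_true, ne_eq]
      by_cases hc : c ∈ W <;> simp [hc]
    · simp only [cycleInd, h, if_false, zero_mul, inInd, y, adjInd]
      split_ifs <;> simp
  have hsum : ∀ a b c, ∑ d, inInd W a * (y a b c * (if d ≠ b then adjInd H a d else 0)) =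
      inInd W a * (y a b c * (H.degree a - 1)) := by
    intro a b c
    rw [← Finset.mul_sum, ← Finset.mul_sum]
    by_cases h : H.Adj a b
    · rw [← sum_adjInd_ne H h]
    · have : y a b c = 0 := if_neg fun h' => h h'.1
      simp [this]
  simp only [Fintype.sum_prod_type]
  calc _ ≤ ∑ a, ∑ b, ∑ c, ∑ d, inInd W a * (y a b c * (if d ≠ b then adjInd H a d else 0)) :=
        Finset.sum_le_sum fun a _ => Finset.sum_le_sum fun b _ => Finset.sum_le_sum fun c _ =>
          Finset.sum_le_sum fun d _ => hz a b c d
    _ = ∑ a ∈ W, (∑ b, ∑ c, y a b c) * (H.degree a - 1) := by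
        simp only [hsum, ← Finset.mul_sum, ← Finset.sum_mul]
        simp [inInd]
    _ ≤ ∑ a ∈ W, √((H.degree a : ℝ) * (H.degree a - 1)) * D := by
        refine Finset.sum_le_sum fun a ha => ?_
        by_cases h0 : H.degree a = 0
        · have h1 : ∀ b, ¬ H.Adj a b := fun b hb =>
            absurd ((H.degree_pos_iff_exists_adj a).2 ⟨b, hb⟩) (by omega)
          have h2 : ∑ b, ∑ c, y a b c = 0 :=
            Finset.sum_eq_zero fun b _ => Finset.sum_eq_zero fun c _ => if_neg fun h => h1 b h.1
          rw [h2, zero_mul]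
          have := hD0 ⟨a, ha⟩
          positivity
        · have hd : (1 : ℝ) ≤ H.degree a := by exact_mod_cast Nat.one_le_iff_ne_zero.2 h0
          have h2 : (H.degree a : ℝ) - 1 ≤ √((H.degree a : ℝ) * (H.degree a - 1)) := by
            apply Real.le_sqrt_of_sq_le
            nlinarith
          have h3 : 0 ≤ ∑ b, ∑ c, y a b c :=
            Finset.sum_nonneg fun b _ => Finset.sum_nonneg fun c _ => by
              simp only [y]; split_ifs <;> simp
          rw [mul_comm]
          exact mul_le_mul h2 (hy a ha) h3 (Real.sqrt_nonneg _)
    _ = _ := by rw [Finset.sum_mul]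

/-- With `k` the size of the intersection, `k (k - 1)` is at most the corresponding quantity for
either set, hence at most their geometric mean. The product form allows summation over pairs. -/
theorem card_offDiag_inter_le (S T : Finset (Fin n)) :
    (((S ∩ T).offDiag.card : ℕ) : ℝ) ≤
      √((S.card : ℝ) * (S.card - 1)) * √((T.card : ℝ) * (T.card - 1)) := by
  have key : ∀ k d : ℕ, k ≤ d → (k : ℝ) * (k - 1) ≤ d * (d - 1) := by
    intro k d h
    rcases Nat.eq_zero_or_pos k with rfl | hk
    · rcases Nat.eq_zero_or_pos d with rfl | hd
      · simp
      · have : (1 : ℝ) ≤ d := by exact_mod_cast hd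
        simp only [Nat.cast_zero, zero_mul]; nlinarith
    · have h1 : (1 : ℝ) ≤ k := by exact_mod_cast hk
      have h2 : (k : ℝ) ≤ d := by exact_mod_cast h
      nlinarith
  have hS := key _ _ (Finset.card_le_card (Finset.inter_subset_left (s₁ := S) (s₂ := T)))
  have hT := key _ _ (Finset.card_le_card (Finset.inter_subset_right (s₁ := S) (s₂ := T)))
  set k : ℝ := ((S ∩ T).card : ℝ) with hk
  have h0 : 0 ≤ k * (k - 1) := by simpa using key 0 (S ∩ T).card (Nat.zero_le _)
  have hc : (((S ∩ T).offDiag.card : ℕ) : ℝ) = k * (k - 1) := by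
    rw [Finset.offDiag_card, Nat.cast_sub (Nat.le_mul_self _)]; push_cast; ring
  rw [hc]
  calc k * (k - 1) = √(k * (k - 1)) * √(k * (k - 1)) := (Real.mul_self_sqrt h0).symm
    _ ≤ _ := by gcongr

/-- For opposite vertices `a`, `c` in `W`, the other two form an ordered pair of distinct common
neighbours. -/
theorem sum_cycles_two_le :
    ∑ t, cycleInd H t * (inInd W t.1 * inInd W t.2.2.1) ≤
      (∑ w ∈ W, √((H.degree w : ℝ) * (H.degree w - 1))) ^ 2 := by
  have hz : ∀ a b c d, cycleInd H (a, b, c, d) * (inInd W a * inInd W c) ≤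
      inInd W a * (inInd W c *
        (if (b, d) ∈ (H.neighborFinset a ∩ H.neighborFinset c).offDiag then 1 else 0)) := by
    intro a b c d
    by_cases h : IsInducedCycle H (a, b, c, d)
    · obtain ⟨⟨h1, h2, h3, h4⟩, h5, h6, h7, h8⟩ := id h
      simp only at h1 h2 h3 h4 h5 h6 h7 h8
      simp [cycleInd, h, h1, h2.symm, h4.symm, h3, h6]
    · simp only [cycleInd, h, if_false, zero_mul, inInd]
      split_ifs <;> simp
  simp only [Fintype.sum_prod_type]
  calc _ ≤ ∑ a, ∑ b, ∑ c, ∑ d, inInd W a * (inInd W c *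
        (if (b, d) ∈ (H.neighborFinset a ∩ H.neighborFinset c).offDiag then 1 else 0)) :=
        Finset.sum_le_sum fun a _ => Finset.sum_le_sum fun b _ => Finset.sum_le_sum fun c _ =>
          Finset.sum_le_sum fun d _ => hz a b c d
    _ = ∑ a, ∑ c, inInd W a * (inInd W c *
        ((H.neighborFinset a ∩ H.neighborFinset c).offDiag.card : ℝ)) := by
        refine Finset.sum_congr rfl fun a _ => ?_
        rw [Finset.sum_comm]
        refine Finset.sum_congr rfl fun c _ => ?_
        simp only [← Finset.mul_sum]
        rw [← Fintype.sum_prod_type' (f := fun b d => if (b, d) ∈ (H.neighborFinset a ∩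
          H.neighborFinset c).offDiag then (1 : ℝ) else 0)]
        simp only [Prod.mk.eta, Finset.sum_ite_mem, Finset.univ_inter, Finset.sum_const,
          nsmul_eq_mul, mul_one]
    _ = ∑ a ∈ W, ∑ c ∈ W, ((H.neighborFinset a ∩ H.neighborFinset c).offDiag.card : ℝ) := by
        simp only [← Finset.mul_sum]
        simp [inInd]
    _ ≤ ∑ a ∈ W, ∑ c ∈ W, √((H.degree a : ℝ) * (H.degree a - 1)) *
          √((H.degree c : ℝ) * (H.degree c - 1)) := by
        refine Finset.sum_le_sum fun a _ => Finset.sum_le_sum fun c _ => ?_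
        have := card_offDiag_inter_le (H.neighborFinset a) (H.neighborFinset c)
        simpa only [SimpleGraph.card_neighborFinset_eq_degree] using this
    _ = _ := by rw [pow_two, Finset.sum_mul_sum]

/-- The number of induced 4-cycles in terms of an independent set `W`. -/
theorem orderedCount_le_of_independent (hW : ∀ u ∈ W, ∀ v ∈ W, ¬ H.Adj u v) :
    (orderedCount H : ℝ) ≤ 2 * (H.edgeSet.ncard - ∑ w ∈ W, (H.degree w : ℝ) +
      ∑ w ∈ W, √((H.degree w : ℝ) * (H.degree w - 1))) ^ 2 := by
  set R := rotate (Fin n) with hR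
  have hoc : (orderedCount H : ℝ) = ∑ t, cycleInd H t := by
    rw [orderedCount, ← Finset.sum_boole]; rfl
  let P0 : Fin n × Fin n × Fin n × Fin n → ℝ := fun t =>
    outInd W t.1 * outInd W t.2.1 * outInd W t.2.2.1 * outInd W t.2.2.2
  let P1 : Fin n × Fin n × Fin n × Fin n → ℝ := fun t => inInd W t.1 * outInd W t.2.2.1
  let P2 : Fin n × Fin n × Fin n × Fin n → ℝ := fun t => inInd W t.1 * inInd W t.2.2.1
  -- A vertex in `W` has its opposite vertex either outside or inside `W`, with four and two
  -- rotations respectively. With `D` edges outside `W` and `S` the sum of the square roots, the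
  -- bounds `2D²`, `4SD` and `2S²` add up to `2 (D + S)²`.
  have h1 : ∀ t, (1 : ℝ) ≤ P0 t + (P1 t + P1 (R t) + P1 (R (R t)) + P1 (R (R (R t)))) +
      (P2 t + P2 (R t)) := by
    rintro ⟨a, b, c, d⟩
    simp only [P0, P1, P2, hR, rotate, Equiv.coe_fn_mk, outInd, inInd]
    by_cases ha : a ∈ W <;> by_cases hb : b ∈ W <;> by_cases hc : c ∈ W <;>
      by_cases hd : d ∈ W <;> simp [ha, hb, hc, hd]
  have h2 : (orderedCount H : ℝ) ≤ ∑ t, cycleInd H t * (P0 t + (P1 t + P1 (R t) + P1 (R (R t)) +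
      P1 (R (R (R t)))) + (P2 t + P2 (R t))) := by
    rw [hoc]
    refine Finset.sum_le_sum fun t _ => ?_
    have h0 : 0 ≤ cycleInd H t := by unfold cycleInd; split_ifs <;> simp
    nlinarith [h1 t]
  have r1 := sum_cycleInd_rotate H P1
  have r2 := sum_cycleInd_rotate H (fun t => P1 (R t))
  have r3 := sum_cycleInd_rotate H (fun t => P1 (R (R t)))
  have r4 := sum_cycleInd_rotate H P2
  rw [← hR] at r1 r2 r3 r4
  simp only [mul_add, Finset.sum_add_distrib] at h2
  rw [r3, r2, r1, r4] at h2
  have b0 := sum_cycles_outside_le H W hW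
  have b1 := sum_cycles_one_le H W hW
  have b2 := sum_cycles_two_le H W
  change ∑ t, cycleInd H t * P0 t ≤ _ at b0
  change ∑ t, cycleInd H t * P1 t ≤ _ at b1
  change ∑ t, cycleInd H t * P2 t ≤ _ at b2
  nlinarith

theorem orderedCount_le : (orderedCount H : ℝ) ≤ 2 * (H.edgeSet.ncard : ℝ) ^ 2 := by
  simpa using orderedCount_le_of_independent H ∅ (by simp)

end StructureBound


/-! ### Paths of two planted edges -/

section DegreeSums
open scoped Classical
variable {n : ℕ} (H : SimpleGraph (Fin n))

/-- The sum `∑ d(v)² (n - d(v))`, which counts the 4-cycles having two consecutive edges in `H`. -/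
noncomputable def pathSum : ℝ := ∑ v, (H.degree v : ℝ) ^ 2 * (n - H.degree v)

theorem degree_le_ncard (v : Fin n) : H.degree v ≤ H.edgeSet.ncard := by
  rw [← SimpleGraph.coe_edgeFinset, Set.ncard_coe_finset, ← H.card_incidenceFinset_eq_degree]
  exact Finset.card_le_card (H.incidenceFinset_subset v)

/-- The product `d (n - d)` is at most `n² / 4`. -/
theorem pathSum_le : pathSum H ≤ H.edgeSet.ncard * n ^ 2 / 2 := by
  have h : ∀ v, (H.degree v : ℝ) ^ 2 * (n - H.degree v) ≤ H.degree v * (n ^ 2 / 4) := by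
    intro v
    have h0 : (0 : ℝ) ≤ H.degree v := by positivity
    nlinarith [mul_nonneg h0 (sq_nonneg ((n : ℝ) - 2 * H.degree v))]
  refine (Finset.sum_le_sum fun v _ => h v).trans (le_of_eq ?_)
  rw [← Finset.sum_mul, sum_degree_real]; ring

theorem pathSum_le' : pathSum H ≤ 2 * n * (H.edgeSet.ncard : ℝ) ^ 2 := by
  have h : ∀ v, (H.degree v : ℝ) ^ 2 * (n - H.degree v) ≤
      H.degree v * (n * H.edgeSet.ncard) := by
    intro v
    have h0 : (0 : ℝ) ≤ H.degree v := by positivity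
    have h1 : (H.degree v : ℝ) ≤ H.edgeSet.ncard := by exact_mod_cast degree_le_ncard H v
    have h2 : (0 : ℝ) ≤ n := by positivity
    calc (H.degree v : ℝ) ^ 2 * (n - H.degree v) ≤ (H.degree v : ℝ) ^ 2 * n := by gcongr; linarith
      _ = (H.degree v : ℝ) * (n * H.degree v) := by ring
      _ ≤ _ := by gcongr
  refine (Finset.sum_le_sum fun v _ => h v).trans (le_of_eq ?_)
  rw [← Finset.sum_mul, sum_degree_real]; ring

/-- Only edges inside `W` are counted twice, and there are at most `|W|² / 2` of them. Compared with
the trivial `2m`, this gains the factor two that the dense range requires. -/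
theorem sum_degree_subset_le (W : Finset (Fin n)) :
    ∑ w ∈ W, (H.degree w : ℝ) ≤ H.edgeSet.ncard + (W.card : ℝ) ^ 2 / 2 := by
  have h1 : ∀ u v, inInd W u * adjInd H u v + inInd W v * adjInd H u v ≤
      adjInd H u v + inInd W u * inInd W v := by
    intro u v
    have h0 := adjInd_nonneg H u v
    have h1 := adjInd_le_one H u v
    unfold inInd
    by_cases hu : u ∈ W <;> by_cases hv : v ∈ W <;> simp [hu, hv] <;> linarith
  have h2 : ∑ u, ∑ v, inInd W u * adjInd H u v = ∑ w ∈ W, (H.degree w : ℝ) := by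
    simp only [← Finset.mul_sum, sum_adjInd]
    simp [inInd]
  have h3 : ∑ u, ∑ v, inInd W v * adjInd H u v = ∑ w ∈ W, (H.degree w : ℝ) := by
    rw [← h2, Finset.sum_comm]
    exact Finset.sum_congr rfl fun u _ => Finset.sum_congr rfl fun v _ => by rw [adjInd_comm]
  have h4 : ∑ u, ∑ v, inInd W u * inInd W v = (W.card : ℝ) ^ 2 := by
    rw [← Finset.sum_mul_sum]
    simp [inInd, pow_two]
  have h5 := Finset.sum_le_sum fun u (_ : u ∈ Finset.univ) =>
    Finset.sum_le_sum fun v (_ : v ∈ Finset.univ) => h1 u v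
  simp only [Finset.sum_add_distrib] at h5
  rw [h2, h3, h4, sum_sum_adjInd] at h5
  linarith

/-- When the number of edges is small compared to `n²`, the vertices of linear degree are few. -/
theorem pathSum_le_of_sparse {γ : ℝ} (hγ : 0 < γ) :
    pathSum H ≤ H.edgeSet.ncard * n ^ 2 / 4 + 2 * γ * H.edgeSet.ncard * n ^ 2 +
      (H.edgeSet.ncard : ℝ) ^ 2 / (2 * γ ^ 2) := by
  rcases Nat.eq_zero_or_pos n with rfl | hn
  · simp [pathSum]; positivity
  have hn' : (0 : ℝ) < n := by exact_mod_cast hn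
  -- The degree sum bounds `|W|` by `2m / (γ n)`, so edges inside `W` enter the error term only; the
  -- remaining vertices have `d² (n - d)` at most `γ n² d`.
  set W : Finset (Fin n) := Finset.univ.filter fun v => γ * n ≤ H.degree v with hW
  have hcard : (W.card : ℝ) * (γ * n) ≤ 2 * H.edgeSet.ncard := by
    rw [← sum_degree_real, ← nsmul_eq_mul, ← Finset.sum_const]
    refine (Finset.sum_le_sum fun v hv => (Finset.mem_filter.1 hv).2).trans ?_
    exact Finset.sum_le_univ_sum_of_nonneg fun v => by positivity
  have h : ∀ v, (H.degree v : ℝ) ^ 2 * (n - H.degree v) ≤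
      inInd W v * H.degree v * (n ^ 2 / 4) + H.degree v * (γ * n ^ 2) := by
    intro v
    have h0 : (0 : ℝ) ≤ H.degree v := by positivity
    have h1 : (0 : ℝ) ≤ H.degree v * (γ * n ^ 2) := by positivity
    by_cases hv : v ∈ W
    · simp only [inInd, hv, if_true, one_mul]
      nlinarith [mul_nonneg h0 (sq_nonneg ((n : ℝ) - 2 * H.degree v))]
    · simp only [inInd, hv, if_false, zero_mul, zero_add]
      have h2 : (H.degree v : ℝ) ≤ γ * n := by
        by_contra h'
        exact hv (Finset.mem_filter.2 ⟨Finset.mem_univ _, by linarith⟩)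
      calc (H.degree v : ℝ) ^ 2 * (n - H.degree v) ≤ (H.degree v : ℝ) ^ 2 * n := by
            gcongr; linarith
        _ = (H.degree v : ℝ) * (H.degree v * n) := by ring
        _ ≤ (H.degree v : ℝ) * (γ * n * n) := by gcongr
        _ = _ := by ring
  have h2 : ∑ v, inInd W v * (H.degree v : ℝ) = ∑ w ∈ W, (H.degree w : ℝ) := by simp [inInd]
  have h3 : pathSum H ≤ (∑ w ∈ W, (H.degree w : ℝ)) * (n ^ 2 / 4) +
      2 * H.edgeSet.ncard * (γ * n ^ 2) := by
    rw [← h2, ← sum_degree_real, Finset.sum_mul, Finset.sum_mul, ← Finset.sum_add_distrib]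
    exact Finset.sum_le_sum fun v _ => h v
  have h4 := sum_degree_subset_le H W
  have h5 : (W.card : ℝ) ^ 2 * n ^ 2 ≤ 4 * (H.edgeSet.ncard : ℝ) ^ 2 / γ ^ 2 := by
    rw [le_div_iff₀ (by positivity)]
    calc (W.card : ℝ) ^ 2 * n ^ 2 * γ ^ 2 = (W.card * (γ * n)) ^ 2 := by ring
      _ ≤ (2 * (H.edgeSet.ncard : ℝ)) ^ 2 := by gcongr
      _ = _ := by ring
  have h6 : (∑ w ∈ W, (H.degree w : ℝ)) * (n ^ 2 / 4) ≤
      (H.edgeSet.ncard + (W.card : ℝ) ^ 2 / 2) * (n ^ 2 / 4) := by gcongr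
  have h7 : (H.edgeSet.ncard : ℝ) ^ 2 / (2 * γ ^ 2) =
      4 * (H.edgeSet.ncard : ℝ) ^ 2 / γ ^ 2 / 8 := by field_simp; ring
  rw [h7]
  linarith

end DegreeSums

/-! ### Reduction of the upper tail to the cost of cores -/

open scoped Classical in
theorem plantedSum_le_pathSum {n : ℕ} (H : SimpleGraph (Fin n)) {p : ℝ} (hp : 0 ≤ p) :
    plantedSum H p ≤ (n ^ 2 * p ^ 2) ^ 2 + 8 * p * H.edgeSet.ncard * (n ^ 2 * p ^ 2) +
      4 * p ^ 2 * pathSum H +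
      (8 * p ^ 2 + 16 * p) * (H.edgeSet.ncard : ℝ) ^ 2 + orderedCount H := by
  refine (plantedSum_le H hp).trans (le_of_eq ?_)
  unfold pathSum
  ring

/-- The consequences of being a core: `m` is at most of order `Q a`, the degree condition holds,
and the 4-cycles sharing at least two edges with the core make up for the deviation. -/
theorem IsCore.properties {n : ℕ} {p δ ε K : ℝ} {L : ℕ} {H : SimpleGraph (Fin n)} (hp : 0 < p)
    (hp1 : p ≤ 1) (hε : 0 < ε) (hK : 1 ≤ K)
    {a Q : ℝ} (ha : 1 ≤ a) (hQ : Q = n ^ 2 * p ^ 2) (hQ0 : 0 < Q) (hL0 : 0 < L)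
    (hL : (L : ℝ) ≤ 8 * K * Q * a) (hsmall : 8192 * K ^ 2 * (p * a ^ 2) ≤ ε)
    (hH : IsCore p ((1 + δ - 2 * ε) * Q ^ 2) (ε * Q ^ 2 / L) L H) :
    (H.edgeSet.ncard : ℝ) ≤ 8 * K * Q * a ∧ DegreeCondition (4096 * K ^ 2 / ε * a ^ 2) H ∧
      (δ - 3 * ε) * Q ^ 2 ≤ orderedCount H + 4 * p ^ 2 * pathSum H := by
  classical
  obtain ⟨h1, h2, h3⟩ := hH
  set m : ℝ := (H.edgeSet.ncard : ℝ) with hm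
  have hm0 : 0 ≤ m := by positivity
  have hmL : m ≤ L := Nat.cast_le.2 h1
  have hmQ : m ≤ 8 * K * Q * a := hmL.trans hL
  have hKa : 1 ≤ K * a := one_le_mul_of_one_le_of_one_le hK ha
  have hpKa : 0 ≤ p * (K * a) := by positivity
  have hs2 : 8192 * (p * (K * a) ^ 2) ≤ ε := by
    calc _ = 8192 * K ^ 2 * (p * a ^ 2) := by ring
      _ ≤ _ := hsmall
  have hs1 : p * (K * a) ≤ p * (K * a) ^ 2 := by
    have : K * a ≤ (K * a) ^ 2 := le_self_pow₀ hKa (by norm_num)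
    gcongr
  have hpp : p ^ 2 ≤ p := by nlinarith
  refine ⟨hmQ, ?_, ?_⟩
  · intro u v huv
    have hc := (h3 u v huv).trans (plantedSum_sub_deleteEdges_le H hp.le hp1 huv)
    rw [← hm] at hc ⊢
    have hLpos : (0 : ℝ) < L := by exact_mod_cast hL0
    have hτ : ε * Q / (8 * (K * a)) ≤ ε * Q ^ 2 / L := by
      rw [div_le_div_iff₀ (by positivity) hLpos]
      calc ε * Q * L ≤ ε * Q * (8 * K * Q * a) := by gcongr
        _ = _ := by ring
    have e1 : p ^ 2 * m ≤ p * (8 * K * Q * a) := by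
      calc p ^ 2 * m ≤ p * m := by gcongr
        _ ≤ _ := by gcongr
    have e2 : m * p ≤ p * (8 * K * Q * a) := by rw [mul_comm]; gcongr
    have e3 : (n : ℝ) ^ 2 * p ^ 3 ≤ p * (K * a) * Q := by
      calc (n : ℝ) ^ 2 * p ^ 3 = p * 1 * Q := by rw [hQ]; ring
        _ ≤ _ := by gcongr
    have e4 : 512 * (p * (K * a) * Q) ≤ ε * Q / (16 * (K * a)) := by
      rw [le_div_iff₀ (by positivity)]
      calc 512 * (p * (K * a) * Q) * (16 * (K * a)) = 8192 * (p * (K * a) ^ 2) * Q := by ring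
        _ ≤ ε * Q := by gcongr
    have e5 : ε * Q / (8 * (K * a)) = 2 * (ε * Q / (16 * (K * a))) := by field_simp; norm_num
    -- Each edge contributes at least `2B`. The terms with an extra factor `p` use up at most `B`,
    -- so one of the two terms involving the degrees is at least `B / 2`, and this decides which
    -- alternative of the degree condition holds.
    set B := ε * Q / (16 * (K * a)) with hB
    have e6 : B ≤ 8 * p ^ 2 * n * (H.degree u + H.degree v) +
        16 * ((H.degree u - 1) * (H.degree v - 1)) := by nlinarith
    by_cases hcase : B / 2 ≤ 16 * (((H.degree u : ℝ) - 1) * (H.degree v - 1))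
    · left
      set X := ((H.degree u : ℝ) - 1) * (H.degree v - 1) with hX
      have e7 : m ≤ 128 * (K * a) ^ 2 / ε * B := by
        refine hmQ.trans (le_of_eq ?_)
        rw [hB]; field_simp; norm_num
      calc m ≤ 128 * (K * a) ^ 2 / ε * B := e7
        _ ≤ 128 * (K * a) ^ 2 / ε * (32 * X) := by gcongr; linarith
        _ = _ := by ring
    · right
      have e8 : B / 2 ≤ 8 * p ^ 2 * n * (H.degree u + H.degree v) := by linarith
      have hn0 : (0 : ℝ) < n := by
        rcases Nat.eq_zero_or_pos n with h | h
        · subst h; simp [hQ] at hQ0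
        · exact_mod_cast h
      have e9 : (n : ℝ) ≤ 256 * (K * a) / ε * (H.degree u + H.degree v) := by
        have h8 : 0 < 8 * p ^ 2 * n := by positivity
        refine le_of_mul_le_mul_left ?_ h8
        calc 8 * p ^ 2 * n * n = 256 * (K * a) / ε * (B / 2) := by
              rw [hB, hQ]; field_simp; norm_num
          _ ≤ 256 * (K * a) / ε * (8 * p ^ 2 * n * (H.degree u + H.degree v)) := by gcongr
          _ = _ := by ring
      have e10 : 512 * (K * a) / ε ≤ 4096 * K ^ 2 / ε * a ^ 2 := by
        rw [div_mul_eq_mul_div, div_le_div_iff_of_pos_right hε]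
        have : K * a ≤ (K * a) ^ 2 := le_self_pow₀ hKa (by norm_num)
        linarith [mul_pow K a 2, sq_nonneg (K * a)]
      rcases le_total (H.degree u : ℝ) (H.degree v) with h | h
      · right
        calc (n : ℝ) ≤ 256 * (K * a) / ε * (H.degree u + H.degree v) := e9
          _ ≤ 256 * (K * a) / ε * (H.degree v + H.degree v) := by gcongr
          _ = 512 * (K * a) / ε * H.degree v := by ring
          _ ≤ _ := by gcongr
      · left
        calc (n : ℝ) ≤ 256 * (K * a) / ε * (H.degree u + H.degree v) := e9
          _ ≤ 256 * (K * a) / ε * (H.degree u + H.degree u) := by gcongr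
          _ = 512 * (K * a) / ε * H.degree u := by ring
          _ ≤ _ := by gcongr
  · have hc := h2.trans (plantedSum_le_pathSum H hp.le)
    rw [← hQ, ← hm] at hc
    have e1 : 8 * p * m * Q ≤ 64 * (p * (K * a)) * Q ^ 2 := by
      calc 8 * p * m * Q ≤ 8 * p * (8 * K * Q * a) * Q := by gcongr
        _ = _ := by ring
    have e2 : (8 * p ^ 2 + 16 * p) * m ^ 2 ≤ 1536 * (p * (K * a) ^ 2) * Q ^ 2 := by
      calc (8 * p ^ 2 + 16 * p) * m ^ 2 ≤ (8 * p + 16 * p) * (8 * K * Q * a) ^ 2 := by gcongr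
        _ = _ := by ring
    have hQ2 : 0 < Q ^ 2 := by positivity
    have e3 : (64 * (p * (K * a)) + 1536 * (p * (K * a) ^ 2)) * Q ^ 2 ≤ ε * Q ^ 2 := by
      gcongr; linarith
    linarith

theorem one_sub_le_sq {y p : ℝ} (hy0 : 0 ≤ y) (hy1 : y ≤ 1) (hp0 : 0 ≤ p) :
    1 - 4 * y - 2 * p ≤ ((1 - y) ^ 2 * (1 - p)) ^ 2 := by
  have e2 : 1 - 4 * y ≤ (1 - y) ^ 4 := by
    have h := one_add_mul_le_pow (show (-2 : ℝ) ≤ -y by linarith) 4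
    rw [← sub_eq_add_neg] at h
    push_cast at h
    linarith
  have e3 : 1 - 2 * p ≤ (1 - p) ^ 2 := by nlinarith [sq_nonneg p]
  have e4 : (1 - y) ^ 4 ≤ 1 := pow_le_one₀ (by linarith) (by linarith)
  have e6 : (1 - y) ^ 4 * (1 - 2 * p) ≤ (1 - y) ^ 4 * (1 - p) ^ 2 := by gcongr
  have e7 : (1 - y) ^ 4 * p ≤ 1 * p := by gcongr
  have e8 : ((1 - y) ^ 2 * (1 - p)) ^ 2 = (1 - y) ^ 4 * (1 - p) ^ 2 := by ring
  rw [e8]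
  linarith

theorem le_mean' (n : ℕ) (hn : 3 ≤ n) (p : I) :
    (1 - 12 / (n : ℝ) - 2 * p) * ((n : ℝ) ^ 2 * (p : ℝ) ^ 2) ^ 2 ≤ 8 * mean n p := by
  refine le_trans ?_ (le_mean n hn p)
  have hn0 : (0 : ℝ) < n := by positivity
  rw [mul_pow _ ((n : ℝ) ^ 2 * (p : ℝ) ^ 2)]
  gcongr
  have h := one_sub_le_sq (y := 3 / (n : ℝ)) (by positivity)
    (by rw [div_le_one hn0]; exact_mod_cast hn) p.2.1
  have e : 12 / (n : ℝ) = 4 * (3 / (n : ℝ)) := by ring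
  rw [e]
  exact h

/-- The basic upper tail estimate: if all graphs `H` that can be cores are expensive, then the
upper tail is small. -/
theorem tail_le_of_cores {δ ε B : ℝ} (hδ : 0 < δ) (hε : 0 < ε) (hε1 : ε ≤ 1) (hεδ : 4 * ε ≤ δ) :
    ∃ a₀ A K : ℝ, 1 ≤ a₀ ∧ 1 ≤ A ∧ 1 ≤ K ∧ ∃ n₁ : ℕ, ∀ n : ℕ, n₁ ≤ n → ∀ p : I, 0 < (p : ℝ) →
      ∀ a Q : ℝ, a = Real.log (1 / p) → Q = (n : ℝ) ^ 2 * (p : ℝ) ^ 2 → a₀ ≤ a → 1 ≤ Q →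
      ∀ T : ℝ, T ≤ B * Q * a →
      (∀ H : SimpleGraph (Fin n), 0 < H.edgeSet.ncard → DegreeCondition (A * a ^ 2) H →
        (δ - 3 * ε) * Q ^ 2 ≤ orderedCount H + 4 * (p : ℝ) ^ 2 * pathSum H →
        T ≤ (1 - ε) * (H.edgeSet.ncard * a) -
          supportCard H * Real.log (n / H.edgeSet.ncard)) →
      (SimpleGraph.binomialRandom (Fin n) p).real
        {G | (1 + δ) * (8 * mean n p) ≤ (orderedCount G : ℝ)} ≤
          (8 * K * Q * a + 2) * (n + 1) * Real.exp (-T) := by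
  classical
  -- The ratio `M / x` is at most `exp (-θ)`. With `θ K ≥ B`, a moment of order `l ≥ K Q a` makes
  -- `(M / x) ^ l` at most `exp (-T)`.
  set θ : ℝ := Real.log ((1 + δ - ε / 2) / (1 + δ - ε)) with hθ
  have hθ0 : 0 < θ := by
    refine Real.log_pos ?_
    rw [one_lt_div (by linarith)]; linarith
  set K : ℝ := max 1 (B / θ) with hK
  have hK1 : 1 ≤ K := le_max_left _ _
  have hKθ : B ≤ θ * K := by
    have : B / θ ≤ K := le_max_right _ _
    rw [div_le_iff₀ hθ0] at this
    linarith
  set A : ℝ := 4096 * K ^ 2 / ε with hA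
  have hA1 : 1 ≤ A := by
    have : 1 ≤ K ^ 2 := one_le_pow₀ hK1
    rw [hA, one_le_div hε]; linarith
  -- The left side is the logarithm of the counting factor per edge for `Λ = A a²`; it is absorbed
  -- in the factor `1 - ε` of the cost.
  have hlog : ∀ᶠ a : ℝ in atTop, 1 + 2 * Real.log (8 * Real.exp 1 * A) + 4 * Real.log a ≤ ε * a := by
    have h1 := Real.isLittleO_log_id_atTop.def (by positivity : (0 : ℝ) < ε / 8)
    filter_upwards [h1, eventually_ge_atTop (1 : ℝ),
      eventually_ge_atTop (2 / ε * (1 + 2 * Real.log (8 * Real.exp 1 * A)))] with a ha ha1 ha2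
    rw [id, Real.norm_of_nonneg (Real.log_nonneg ha1), Real.norm_of_nonneg (by linarith)] at ha
    rw [div_mul_eq_mul_div, div_le_iff₀ hε] at ha2
    linarith
  obtain ⟨a₁, ha₁⟩ := eventually_atTop.1 hlog
  set a₀ : ℝ := max (max 1 a₁) (max (49152 * K ^ 2 / ε) (8 * (1 + δ) / ε)) with ha₀
  obtain ⟨n₁, hn₁⟩ := exists_nat_ge (max 3 (48 * (1 + δ) / ε))
  refine ⟨a₀, A, K, (le_max_left _ _).trans (le_max_left _ _), hA1, hK1, n₁, ?_⟩
  intro n hn p hp a Q ha hQ haa hQ1 T hT hcore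
  have hn' : (n₁ : ℝ) ≤ n := by exact_mod_cast hn
  have hn3 : 3 ≤ n := by
    have : (3 : ℝ) ≤ n := (le_max_left _ _).trans (hn₁.trans hn')
    exact_mod_cast this
  have hn0 : (0 : ℝ) < n := by positivity
  have hnδ : 48 * (1 + δ) / ε ≤ n := (le_max_right _ _).trans (hn₁.trans hn')
  have ha1 : 1 ≤ a := ((le_max_left _ _).trans (le_max_left _ _)).trans haa
  have ha2 : a₁ ≤ a := ((le_max_right _ _).trans (le_max_left _ _)).trans haa
  have ha3 : 49152 * K ^ 2 / ε ≤ a := ((le_max_left _ _).trans (le_max_right _ _)).trans haa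
  have ha4 : 8 * (1 + δ) / ε ≤ a := ((le_max_right _ _).trans (le_max_right _ _)).trans haa
  have ha0 : 0 < a := by linarith
  have hp1 : (p : ℝ) ≤ 1 := p.2.2
  have hpa : (p : ℝ) = Real.exp (-a) := by
    rw [ha, one_div, Real.log_inv, neg_neg, Real.exp_log hp]
  have hpa3 : (p : ℝ) * a ^ 3 ≤ 6 := by
    have h := Real.pow_div_factorial_le_exp a ha0.le 3
    rw [show ((Nat.factorial 3 : ℕ) : ℝ) = 6 by norm_num [Nat.factorial]] at h
    rw [hpa, Real.exp_neg, inv_mul_le_iff₀ (Real.exp_pos a)]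
    linarith
  have hpa1 : (p : ℝ) * a ≤ 1 := by
    rw [hpa, Real.exp_neg, inv_mul_le_iff₀ (Real.exp_pos a)]
    linarith [Real.add_one_le_exp a]
  have hsmall : 8192 * K ^ 2 * ((p : ℝ) * a ^ 2) ≤ ε := by
    rw [div_le_iff₀ hε] at ha3
    refine le_of_mul_le_mul_right ?_ ha0
    calc 8192 * K ^ 2 * ((p : ℝ) * a ^ 2) * a = 8192 * K ^ 2 * ((p : ℝ) * a ^ 3) := by ring
      _ ≤ 8192 * K ^ 2 * 6 := by gcongr
      _ ≤ ε * a := by linarith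
  have hQ0 : 0 < Q := by linarith
  have hKQa : 1 ≤ K * Q * a :=
    one_le_mul_of_one_le_of_one_le (one_le_mul_of_one_le_of_one_le hK1 hQ1) ha1
  set l : ℕ := ⌈K * Q * a⌉₊ with hl
  have hl1 : K * Q * a ≤ l := Nat.le_ceil _
  have hl2 : (l : ℝ) ≤ 2 * (K * Q * a) := by
    have := Nat.ceil_lt_add_one (by linarith : 0 ≤ K * Q * a)
    linarith
  have hl0 : 0 < l := by
    have : (0 : ℝ) < l := by linarith
    exact_mod_cast this
  set L : ℕ := 4 * l with hLdef
  have hL : (L : ℝ) ≤ 8 * K * Q * a := by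
    rw [hLdef]; push_cast; linarith
  have hL0 : 0 < L := by omega
  have hLpos : (0 : ℝ) < L := by exact_mod_cast hL0
  set M : ℝ := (1 + δ - ε) * Q ^ 2 with hM
  have hM0 : 0 < M := by
    have : 0 < 1 + δ - ε := by linarith
    positivity
  set x : ℝ := (1 + δ) * (8 * mean n p) with hx
  -- The relative error `12 / n + 2 p` of the mean, multiplied by `1 + δ`, is at most `ε / 2`.
  have hxM : (1 + δ - ε / 2) * Q ^ 2 ≤ x := by
    rw [div_le_iff₀ hε] at hnδ ha4
    have h3 : 12 / (n : ℝ) * (1 + δ) ≤ ε / 4 := by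
      rw [div_mul_eq_mul_div, div_le_iff₀ hn0]; linarith
    have h4 : 2 * (p : ℝ) * (1 + δ) ≤ ε / 4 := by
      refine le_of_mul_le_mul_right ?_ ha0
      calc 2 * (p : ℝ) * (1 + δ) * a = 2 * (1 + δ) * (p * a) := by ring
        _ ≤ 2 * (1 + δ) * 1 := by gcongr
        _ ≤ ε / 4 * a := by linarith
    calc (1 + δ - ε / 2) * Q ^ 2 ≤ ((1 + δ) * (1 - 12 / (n : ℝ) - 2 * p)) * Q ^ 2 := by
          gcongr; linarith
      _ = (1 + δ) * ((1 - 12 / (n : ℝ) - 2 * p) * Q ^ 2) := by ring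
      _ ≤ x := by
        rw [hx, hQ]; exact mul_le_mul_of_nonneg_left (le_mean' n hn3 p) (by linarith)
  have hx0 : 0 < x := by
    have : 0 < 1 + δ - ε / 2 := by linarith
    have : 0 < (1 + δ - ε / 2) * Q ^ 2 := by positivity
    linarith
  have hτ0 : 0 ≤ ε * Q ^ 2 / L := by positivity
  have htail := tail_le (n := n) p hM0.le hx0 hτ0 L l le_rfl
  have hMτ : M - ε * Q ^ 2 / L * L = (1 + δ - 2 * ε) * Q ^ 2 := by
    rw [div_mul_cancel₀ _ hLpos.ne', hM]; ring
  rw [hMτ] at htail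
  have hfirst : (M / x) ^ l ≤ Real.exp (-T) := by
    have h1 : M / x ≤ Real.exp (-θ) := by
      rw [Real.exp_neg, hθ, Real.exp_log (by
        apply div_pos <;> linarith), inv_div, hM, div_le_div_iff₀ hx0 (by linarith)]
      have : 0 ≤ 1 + δ - ε := by linarith
      calc (1 + δ - ε) * Q ^ 2 * (1 + δ - ε / 2) = (1 + δ - ε) * ((1 + δ - ε / 2) * Q ^ 2) := by
            ring
        _ ≤ _ := by gcongr
    calc (M / x) ^ l ≤ Real.exp (-θ) ^ l := by gcongr
      _ = Real.exp (l * -θ) := by rw [Real.exp_nat_mul]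
      _ ≤ Real.exp (-T) := by
        refine Real.exp_le_exp.2 ?_
        have h2 : B * (Q * a) ≤ θ * K * (Q * a) := by gcongr
        have h3 : θ * (K * Q * a) ≤ θ * l := by gcongr
        linarith
  have hsum : ∑ H : SimpleGraph (Fin n) with
      IsCore (p : ℝ) ((1 + δ - 2 * ε) * Q ^ 2) (ε * Q ^ 2 / L) L H, (p : ℝ) ^ H.edgeSet.ncard ≤
        (L + 1) * (n + 1) * Real.exp (-T) := by
    have hΛ : 1 ≤ A * a ^ 2 := one_le_mul_of_one_le_of_one_le hA1 (one_le_pow₀ ha1)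
    refine sum_pow_ncard_le hp hΛ _ fun H hH => ?_
    simp only [Finset.mem_filter, Finset.mem_univ, true_and] at hH
    obtain ⟨c1, c2, c3⟩ := hH.properties hp hp1 hε hK1 ha1 hQ hQ0 hL0 hL hsmall
    have hpos : 0 < H.edgeSet.ncard := by
      by_contra h0
      have h0' : H.edgeSet.ncard = 0 := by omega
      have d1 := orderedCount_le H
      have d2 := pathSum_le H
      rw [h0'] at d1 d2
      have d3 : 4 * (p : ℝ) ^ 2 * pathSum H ≤ 0 :=
        mul_nonpos_of_nonneg_of_nonpos (by positivity) (by simpa using d2)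
      have d4 : 0 < (δ - 3 * ε) * Q ^ 2 := by
        have : 0 < δ - 3 * ε := by linarith
        positivity
      norm_num at d1
      rw [d1, Nat.cast_zero] at c3
      linarith
    refine ⟨hpos, hH.1, c2, ?_⟩
    refine (hcore H hpos c2 c3).trans ?_
    rw [← ha]
    have e1 : Real.log (8 * Real.exp 1 * (A * a ^ 2)) =
        Real.log (8 * Real.exp 1 * A) + 2 * Real.log a := by
      rw [← mul_assoc, Real.log_mul (by positivity) (by positivity), Real.log_pow]
      push_cast; ring
    have e2 := ha₁ a ha2
    have e3 : (H.edgeSet.ncard : ℝ) * ((1 - ε) * a) ≤ H.edgeSet.ncard *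
        (a - 1 - 2 * Real.log (8 * Real.exp 1 * (A * a ^ 2))) := by
      gcongr
      rw [e1]; linarith
    linarith
  refine htail.trans ((add_le_add hfirst hsum).trans ?_)
  have hE : 0 < Real.exp (-T) := Real.exp_pos _
  have hnn : (1 : ℝ) ≤ n + 1 := by linarith
  calc Real.exp (-T) + (L + 1) * (n + 1) * Real.exp (-T)
      ≤ (n + 1) * Real.exp (-T) + (L + 1) * (n + 1) * Real.exp (-T) := by
        have : 1 * Real.exp (-T) ≤ (n + 1) * Real.exp (-T) := by gcongr
        linarith
    _ = (L + 2) * (n + 1) * Real.exp (-T) := by ring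
    _ ≤ _ := by gcongr


/-! ### The cost of cores in the sparse range -/

/-- A core has at least a constant times `Q` edges. -/
theorem le_ncard_of_core {n : ℕ} {p δ ε Q : ℝ} {H : SimpleGraph (Fin n)} (hεδ : 4 * ε ≤ δ)
    (hδ : 0 < δ) (hQ : Q = n ^ 2 * p ^ 2) (hQ0 : 0 < Q)
    (hH : (δ - 3 * ε) * Q ^ 2 ≤ orderedCount H + 4 * p ^ 2 * pathSum H) :
    min 1 (δ / 17) * Q ≤ H.edgeSet.ncard := by
  by_contra hlt
  push Not at hlt
  set m : ℝ := (H.edgeSet.ncard : ℝ) with hm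
  have hm0 : 0 ≤ m := by positivity
  set c₀ : ℝ := min 1 (δ / 17) with hc₀
  have hc1 : c₀ ≤ 1 := min_le_left _ _
  have hc2 : c₀ ≤ δ / 17 := min_le_right _ _
  have hc0 : 0 < c₀ := lt_min one_pos (by positivity)
  have e1 := orderedCount_le H
  have e2 : 4 * p ^ 2 * pathSum H ≤ 4 * p ^ 2 * (m * n ^ 2 / 2) := by
    gcongr; exact pathSum_le H
  have e3 : 4 * p ^ 2 * (m * n ^ 2 / 2) = 2 * Q * m := by rw [hQ]; ring
  have e4 : 2 * m ^ 2 ≤ 2 * (c₀ * Q) ^ 2 := by gcongr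
  have e5 : 2 * Q * m ≤ 2 * Q * (c₀ * Q) := by gcongr
  have hQ2 : 0 < Q ^ 2 := by positivity
  -- Contradictory, since `4 c₀ ≤ 4 δ / 17 < δ / 4`; hence the constant `17`.
  have e6 : (δ / 4) * Q ^ 2 ≤ (4 * c₀) * Q ^ 2 := by
    have e7 : c₀ ^ 2 * Q ^ 2 ≤ c₀ * Q ^ 2 := by gcongr; nlinarith
    have e8 : (δ / 4) * Q ^ 2 ≤ (δ - 3 * ε) * Q ^ 2 := by gcongr; linarith
    rw [← hm] at e1
    linarith [mul_pow c₀ Q 2]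
  have := le_of_mul_le_mul_right e6 hQ2
  linarith

open scoped Classical in
theorem supportCard_eq {n : ℕ} (H : SimpleGraph (Fin n)) (D : ℕ) :
    supportCard H = (Finset.univ.filter fun v => H.degree v ≠ 0 ∧ H.degree v ≤ D).card +
      (Finset.univ.filter fun v => D < H.degree v).card := by
  rw [supportCard, ← Finset.card_union_of_disjoint]
  · congr 1
    ext v
    simp only [Finset.mem_union, Finset.mem_filter, Finset.mem_univ, true_and]
    omega
  · rw [Finset.disjoint_filter]
    intro v _ h; omega

open scoped Classical in
theorem card_high_degree_le {n : ℕ} (H : SimpleGraph (Fin n)) (D : ℕ) :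
    ((Finset.univ.filter fun v => D < H.degree v).card : ℝ) * D ≤ 2 * H.edgeSet.ncard := by
  rw [← sum_degree_real, ← nsmul_eq_mul, ← Finset.sum_const]
  refine (Finset.sum_le_sum fun v hv => ?_).trans
    (Finset.sum_le_univ_sum_of_nonneg fun v => Nat.cast_nonneg _)
  exact_mod_cast (Finset.mem_filter.1 hv).2.le

set_option maxHeartbeats 1000000 in
/-- The cost of a core in the sparse range. -/
theorem cost_of_core {n : ℕ} {p δ ε Q a A C C₁ lam : ℝ} {H : SimpleGraph (Fin n)} {D : ℕ}
    (hε : 0 < ε) (hε8 : ε ≤ 1 / 8) (hεδ : 4 * ε ≤ δ) (hn : 0 < n) (hp : 0 < p)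
    (hQ : Q = n ^ 2 * p ^ 2) (ha : a = Real.log (1 / p)) (ha0 : 0 < a)
    (hC : C = -Real.log (min 1 (δ / 17))) (hC₁ : C₁ = 8 * (1 + δ))
    (hD : 8 ≤ D) (hDε : 1 / ε ≤ D) (hA : 1 ≤ A * a ^ 2)
    (h1 : A * a ^ 2 * D ^ 2 < min 1 (δ / 17) * Q) (h2 : A * a ^ 2 * D < n)
    (h3 : Real.log (A * a ^ 2) ≤ 3 / 8 * a) (h4 : C ≤ Real.log n - a)
    (h5 : 8 * (n * p ^ 2) * C₁ ^ 2 ≤ ε) (h6 : 2 * C ≤ ε * a)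
    (hlam0 : 0 ≤ lam) (hlam : lam ≤ a)
    (hlamj : ∀ j : ℕ, 1 ≤ j → lam * √((j : ℝ) * (j - 1)) ≤ j * a - (2 * a - Real.log n))
    (hH0 : 0 < H.edgeSet.ncard) (hHd : DegreeCondition (A * a ^ 2) H)
    (hH : (δ - 3 * ε) * Q ^ 2 ≤ orderedCount H + 4 * p ^ 2 * pathSum H) :
    lam * Q * √((δ - 4 * ε) / 2) - 4 * C₁ * ε * Q * a ≤
      (1 - ε) * (H.edgeSet.ncard * a) - supportCard H * Real.log (n / H.edgeSet.ncard) := by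
  classical
  have hδ : 0 < δ := by linarith
  have hn0 : (0 : ℝ) < n := by exact_mod_cast hn
  have hQ0 : 0 < Q := by rw [hQ]; positivity
  set c₀ : ℝ := min 1 (δ / 17) with hc₀
  have hc0 : 0 < c₀ := lt_min one_pos (by positivity)
  have hmQ := le_ncard_of_core hεδ hδ hQ hQ0 hH
  set m : ℝ := (H.edgeSet.ncard : ℝ) with hm
  have hm0 : 0 < m := by rw [hm]; exact_mod_cast hH0
  have hC0 : 0 ≤ C := by
    rw [hC, neg_nonneg]
    exact Real.log_nonpos hc0.le (min_le_left _ _)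
  have hC₁0 : 0 < C₁ := by rw [hC₁]; positivity
  set Λ : ℝ := A * a ^ 2 with hΛ
  have hD0 : (8 : ℝ) ≤ D := by exact_mod_cast hD
  -- the logarithm of `n / m`
  set b : ℝ := Real.log (n / m) with hb
  -- As `m ≥ c₀ Q`, the gain per vertex is at most `log (n / Q) = 2a - log n`, up to the constant
  -- `C`.
  have hbC : b ≤ 2 * a - Real.log n + C := by
    have e1 : b ≤ Real.log (n / (c₀ * Q)) := by
      apply Real.log_le_log (by positivity)
      gcongr
    have e2 : Real.log (n / (c₀ * Q)) = 2 * a - Real.log n + C := by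
      rw [Real.log_div (by positivity) (by positivity), Real.log_mul (by positivity)
        (by positivity), hQ, Real.log_mul (by positivity) (by positivity), Real.log_pow,
        Real.log_pow, hC, ha, one_div, Real.log_inv]
      push_cast; ring
    linarith
  -- The logarithm may be negative; truncation makes the cost monotone in the number of vertices.
  set b' : ℝ := max b 0 with hb'
  have hb'0 : 0 ≤ b' := le_max_right _ _
  have hb'a : b' ≤ a := max_le (by linarith) ha0.le
  have hbb' : b ≤ b' := le_max_left _ _
  suffices hs : lam * Q * √((δ - 4 * ε) / 2) - 4 * C₁ * ε * Q * a ≤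
      (1 - ε) * (m * a) - supportCard H * b' by
    have : (supportCard H : ℝ) * b ≤ supportCard H * b' := by gcongr
    linarith
  -- low and high degree vertices
  set W : Finset (Fin n) := Finset.univ.filter fun v => H.degree v ≠ 0 ∧ H.degree v ≤ D with hW
  set B : Finset (Fin n) := Finset.univ.filter fun v => D < H.degree v with hB
  -- Two adjacent vertices of degree at most `D` would violate the degree condition, because `Λ D² <
  -- c₀ Q ≤ m` and `Λ D < n`.
  have hWind : ∀ u ∈ W, ∀ v ∈ W, ¬ H.Adj u v := by
    intro u hu v hv huv
    simp only [hW, Finset.mem_filter, Finset.mem_univ, true_and] at hu hv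
    have u1 : (1 : ℝ) ≤ H.degree u := by exact_mod_cast Nat.one_le_iff_ne_zero.2 hu.1
    have v1 : (1 : ℝ) ≤ H.degree v := by exact_mod_cast Nat.one_le_iff_ne_zero.2 hv.1
    have u2 : (H.degree u : ℝ) ≤ D := by exact_mod_cast hu.2
    have v2 : (H.degree v : ℝ) ≤ D := by exact_mod_cast hv.2
    rcases hHd u v huv with h | h | h
    · have : Λ * (((H.degree u : ℝ) - 1) * (H.degree v - 1)) ≤ Λ * (D * D) := by
        gcongr <;> linarith
      rw [← hm] at h
      linarith
    · have : Λ * (H.degree u : ℝ) ≤ Λ * D := by gcongr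
      linarith
    · have : Λ * (H.degree v : ℝ) ≤ Λ * D := by gcongr
      linarith
  have hsupp : (supportCard H : ℝ) = W.card + B.card := by
    rw [supportCard_eq H D]; push_cast; rfl
  have hBcard : (B.card : ℝ) * D ≤ 2 * m := card_high_degree_le H D
  have hsupp2 : (supportCard H : ℝ) ≤ 2 * m := by rw [hm]; exact_mod_cast supportCard_le H
  have hm₂ : 0 ≤ m - ∑ w ∈ W, (H.degree w : ℝ) := by
    have h := sum_adjInd_outside H W hWind
    have h0 : 0 ≤ ∑ u, ∑ v, outInd W u * outInd W v * adjInd H u v :=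
      Finset.sum_nonneg fun u _ => Finset.sum_nonneg fun v _ => by
        have := adjInd_nonneg H u v
        unfold outInd; split_ifs <;> simp [this]
    rw [h] at h0
    linarith
  by_cases hcase : C₁ * Q ≤ m
  · -- many edges
    have hkey : supportCard H * b' ≤ 3 / 4 * (m * a) := by
      -- At a vertex of degree one the product in the degree condition vanishes, so its neighbour
      -- has nearly linear degree; then `n ≤ Λ m` and the gain per vertex is at most `log Λ`.
      -- Without such vertices, `W` has at most `m / 2` and `B` at most `m / 4` elements. Either way
      -- at least `m a / 8` of the cost remains, whence `C₁ = 8 (1 + δ)`.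
      by_cases hone : ∃ u, H.degree u = 1
      · obtain ⟨u, hu⟩ := hone
        obtain ⟨w, huw⟩ := (H.degree_pos_iff_exists_adj u).1 (by omega)
        have hu' : (H.degree u : ℝ) = 1 := by rw [hu]; simp
        have hnm : (n : ℝ) ≤ Λ * m := by
          rcases hHd u w huw with h | h | h
          · rw [hu', ← hm] at h; linarith
          · rw [hu'] at h
            have : Λ * 1 ≤ Λ * D := by gcongr; linarith
            linarith
          · refine h.trans ?_
            have : (H.degree w : ℝ) ≤ m := by rw [hm]; exact_mod_cast degree_le_ncard H w
            gcongr
        have hbΛ : b ≤ Real.log Λ := by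
          apply Real.log_le_log (by positivity)
          rw [div_le_iff₀ hm0]; exact hnm
        have hb'Λ : b' ≤ 3 / 8 * a := max_le (hbΛ.trans h3) (by positivity)
        calc (supportCard H : ℝ) * b' ≤ 2 * m * (3 / 8 * a) := by gcongr
          _ = _ := by ring
      · push Not at hone
        have e1 : (W.card : ℝ) * 2 ≤ ∑ w ∈ W, (H.degree w : ℝ) := by
          rw [← nsmul_eq_mul, ← Finset.sum_const]
          refine Finset.sum_le_sum fun w hw => ?_
          simp only [hW, Finset.mem_filter, Finset.mem_univ, true_and] at hw
          have h2 : 2 ≤ H.degree w := by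
            have := hone w
            omega
          exact_mod_cast h2
        have e2 : (B.card : ℝ) * 8 ≤ B.card * D := by gcongr
        have e3 : (supportCard H : ℝ) ≤ 3 / 4 * m := by rw [hsupp]; linarith
        calc (supportCard H : ℝ) * b' ≤ 3 / 4 * m * a := by gcongr
          _ = _ := by ring
    have e1 : √((δ - 4 * ε) / 2) ≤ 1 + δ := by
      rw [Real.sqrt_le_left (by positivity), show (1 + δ) ^ 2 = 1 + 2 * δ + δ ^ 2 by ring]
      linarith [sq_nonneg δ]
    have e2 : lam * Q * √((δ - 4 * ε) / 2) ≤ a * Q * (1 + δ) := by gcongr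
    have e3 : C₁ * Q * a ≤ m * a := by gcongr
    have e4 : 0 ≤ 4 * C₁ * ε * Q * a := by positivity
    have e5 : ε * (m * a) ≤ 1 / 8 * (m * a) := by gcongr
    rw [hC₁] at e3
    linarith
  · -- few edges
    push Not at hcase
    -- With at most `C₁ Q` edges the path term is of order `n p² Q²`, which is negligible in this
    -- range.
    have hpath : 4 * p ^ 2 * pathSum H ≤ ε * Q ^ 2 := by
      calc 4 * p ^ 2 * pathSum H ≤ 4 * p ^ 2 * (2 * n * m ^ 2) := by
            gcongr; exact pathSum_le' H
        _ ≤ 4 * p ^ 2 * (2 * n * (C₁ * Q) ^ 2) := by gcongr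
        _ = 8 * (n * p ^ 2) * C₁ ^ 2 * Q ^ 2 := by ring
        _ ≤ ε * Q ^ 2 := by gcongr
    set S : ℝ := ∑ w ∈ W, √((H.degree w : ℝ) * (H.degree w - 1)) with hS
    have hS0 : 0 ≤ S := Finset.sum_nonneg fun w _ => Real.sqrt_nonneg _
    have hcount := orderedCount_le_of_independent H W hWind
    rw [← hm, ← hS] at hcount
    set m₂ : ℝ := m - ∑ w ∈ W, (H.degree w : ℝ) with hm₂def
    have hroot : Q * √((δ - 4 * ε) / 2) ≤ m₂ + S := by
      have e1 : Q ^ 2 * ((δ - 4 * ε) / 2) ≤ (m₂ + S) ^ 2 := by linarith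
      have e2 : √(Q ^ 2 * ((δ - 4 * ε) / 2)) ≤ m₂ + S := by
        rw [Real.sqrt_le_left (by positivity)]; exact e1
      rwa [Real.sqrt_mul (by positivity), Real.sqrt_sq hQ0.le] at e2
    -- The local inequality: a vertex of `W` pays at least `lam` times its contribution to the cycle
    -- bound, up to `C`. An edge outside `W` pays `a ≥ lam` for a contribution of one, so the total
    -- cost is at least `lam * (m₂ + S)` up to errors.
    have hj : ∀ w ∈ W, lam * √((H.degree w : ℝ) * (H.degree w - 1)) ≤
        H.degree w * a - b' + C := by
      intro w hw
      simp only [hW, Finset.mem_filter, Finset.mem_univ, true_and] at hw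
      have hd : 1 ≤ H.degree w := Nat.one_le_iff_ne_zero.2 hw.1
      have hd' : (1 : ℝ) ≤ H.degree w := by exact_mod_cast hd
      have hj1 := hlamj _ hd
      have hj2 : lam * √((H.degree w : ℝ) * (H.degree w - 1)) ≤ H.degree w * a := by
        have : √((H.degree w : ℝ) * (H.degree w - 1)) ≤ H.degree w := by
          rw [Real.sqrt_le_left (by positivity), mul_sub, mul_one, ← pow_two]; linarith
        calc _ ≤ a * (H.degree w : ℝ) := by gcongr
          _ = _ := by ring
      rcases max_choice b 0 with h | h
      · rw [hb', h]; linarith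
      · rw [hb', h]; linarith
    have hsum : lam * S ≤ a * ∑ w ∈ W, (H.degree w : ℝ) - W.card * b' + W.card * C := by
      rw [hS, Finset.mul_sum]
      refine (Finset.sum_le_sum hj).trans (le_of_eq ?_)
      rw [Finset.sum_add_distrib, Finset.sum_sub_distrib, Finset.sum_const, Finset.sum_const,
        nsmul_eq_mul, nsmul_eq_mul, ← Finset.sum_mul]
      ring
    have hBb : (B.card : ℝ) * b' ≤ 2 * C₁ * ε * Q * a := by
      have hDpos : (0 : ℝ) < D := by linarith
      have e1 : (B.card : ℝ) ≤ 2 * m * ε := by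
        have e2 : 1 ≤ ε * D := by rw [div_le_iff₀ hε] at hDε; linarith
        calc (B.card : ℝ) = B.card * 1 := (mul_one _).symm
          _ ≤ B.card * (ε * D) := by gcongr
          _ = B.card * D * ε := by ring
          _ ≤ 2 * m * ε := by gcongr
      calc (B.card : ℝ) * b' ≤ 2 * m * ε * a := by gcongr
        _ ≤ 2 * (C₁ * Q) * ε * a := by gcongr
        _ = _ := by ring
    have hWC : (W.card : ℝ) * C ≤ C₁ * ε * Q * a := by
      have e1 : (W.card : ℝ) ≤ 2 * m := by
        have : (0 : ℝ) ≤ B.card := by positivity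
        linarith
      calc (W.card : ℝ) * C ≤ 2 * m * C := by gcongr
        _ = m * (2 * C) := by ring
        _ ≤ (C₁ * Q) * (ε * a) := by gcongr
        _ = _ := by ring
    have hεm : ε * (m * a) ≤ C₁ * ε * Q * a := by
      calc ε * (m * a) ≤ ε * (C₁ * Q * a) := by gcongr
        _ = _ := by ring
    have hl1 : lam * (Q * √((δ - 4 * ε) / 2)) ≤ lam * (m₂ + S) := by gcongr
    have hl2 : lam * m₂ ≤ a * m₂ := by gcongr
    have hl3 : a * m₂ = a * m - a * ∑ w ∈ W, (H.degree w : ℝ) := by rw [hm₂def]; ring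
    rw [hsupp]
    linarith


/-! ### Upper tail estimates in the sparse and dense ranges -/

theorem prefactor_le {n : ℕ} {κ K Q a : ℝ} (hn : 1 ≤ n) (hκ : 0 < κ) (hK : 1 ≤ K)
    (hQa : 1 ≤ Q * a) (h1 : 80 * K ≤ κ ^ 2 * (Q * a)) (h2 : 4 * Real.log n + 2 ≤ κ * (Q * a)) :
    (8 * K * Q * a + 2) * (n + 1) ≤ Real.exp (κ * Q * a) := by
  set y : ℝ := κ * (Q * a) / 2 with hy
  have hy0 : 0 ≤ y := by positivity
  have hn' : (1 : ℝ) ≤ n := by exact_mod_cast hn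
  have e1 : 8 * K * Q * a + 2 ≤ Real.exp y := by
    have h := Real.pow_div_factorial_le_exp y hy0 2
    rw [show ((Nat.factorial 2 : ℕ) : ℝ) = 2 by norm_num [Nat.factorial]] at h
    refine le_trans ?_ h
    have h3 : 80 * K * (Q * a) ≤ κ ^ 2 * (Q * a) * (Q * a) := by gcongr
    have h4 : 1 ≤ K * (Q * a) := one_le_mul_of_one_le_of_one_le hK hQa
    have h5 : y ^ 2 = κ ^ 2 * (Q * a) * (Q * a) / 4 := by rw [hy]; ring
    rw [h5]
    linarith
  have e2 : (n : ℝ) + 1 ≤ Real.exp y := by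
    calc (n : ℝ) + 1 ≤ n * Real.exp 1 := by
          have : (2 : ℝ) ≤ Real.exp 1 := by linarith [Real.add_one_le_exp (1 : ℝ)]
          nlinarith
      _ = Real.exp (Real.log n + 1) := by rw [Real.exp_add, Real.exp_log (by linarith)]
      _ ≤ Real.exp y := by
          refine Real.exp_le_exp.2 ?_
          have := Real.log_nonneg hn'
          rw [hy]; linarith
  calc (8 * K * Q * a + 2) * (n + 1) ≤ Real.exp y * Real.exp y := by
        gcongr
    _ = Real.exp (κ * Q * a) := by rw [← Real.exp_add]; congr 1; rw [hy]; ring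

set_option maxHeartbeats 1000000 in
/-- The upper tail in the sparse range, in terms of the exponent `lam` of the best balanced
structure. -/
theorem sparse_tail {δ ε : ℝ} (hε : 0 < ε) (hε8 : ε ≤ 1 / 8) (hεδ : 4 * ε ≤ δ) :
    ∃ N₀ : ℝ, ∀ n : ℕ, N₀ ≤ Real.log n → ∀ p : I, Real.log n ^ 9 ≤ n * p →
      n * (p : ℝ) ^ 2 * Real.log n ^ 2 ≤ 1 →
      ∀ a Q lam : ℝ, a = Real.log (1 / p) → Q = (n : ℝ) ^ 2 * (p : ℝ) ^ 2 → 0 ≤ lam → lam ≤ a →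
      (∀ j : ℕ, 1 ≤ j → lam * √((j : ℝ) * (j - 1)) ≤ j * a - (2 * a - Real.log n)) →
      (SimpleGraph.binomialRandom (Fin n) p).real
        {G | (1 + δ) * (8 * mean n p) ≤ (orderedCount G : ℝ)} ≤
          Real.exp (-(lam * Q * √((δ - 4 * ε) / 2) - 40 * (1 + δ) * ε * Q * a)) := by
  have hδ : 0 < δ := by linarith
  obtain ⟨a₀, A, K, ha₀, hA, hK, n₁, hmain⟩ := tail_le_of_cores hδ hε (by linarith) hεδ
    (B := 1 + δ)
  obtain ⟨C₁, hC₁⟩ : ∃ C₁ : ℝ, C₁ = 8 * (1 + δ) := ⟨_, rfl⟩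
  obtain ⟨c₀, hc₀⟩ : ∃ c₀ : ℝ, c₀ = min 1 (δ / 17) := ⟨_, rfl⟩
  obtain ⟨C, hC⟩ : ∃ C : ℝ, C = -Real.log c₀ := ⟨_, rfl⟩
  have hc0 : 0 < c₀ := by rw [hc₀]; exact lt_min one_pos (by positivity)
  have hC₁0 : 0 < C₁ := by rw [hC₁]; positivity
  obtain ⟨D, hD8, hDε⟩ : ∃ D : ℕ, 8 ≤ D ∧ 1 / ε ≤ D := by
    obtain ⟨D, hD⟩ := exists_nat_ge (max 8 (1 / ε))
    refine ⟨D, ?_, (le_max_right _ _).trans hD⟩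
    exact_mod_cast (le_max_left _ _).trans hD
  have hlog : ∀ᶠ a : ℝ in atTop, Real.log (A * a ^ 2) ≤ 3 / 8 * a := by
    have h1 := Real.isLittleO_log_id_atTop.def (by norm_num : (0 : ℝ) < 1 / 16)
    filter_upwards [h1, eventually_ge_atTop (1 : ℝ), eventually_ge_atTop (4 * Real.log A)]
      with a ha ha1 ha2
    rw [id, Real.norm_of_nonneg (Real.log_nonneg ha1), Real.norm_of_nonneg (by linarith)] at ha
    rw [Real.log_mul (by positivity) (by positivity), Real.log_pow]
    push_cast
    linarith
  have hev : ∀ᶠ N : ℝ in atTop, (∀ a, N / 2 ≤ a → a₀ ≤ a ∧ Real.log (A * a ^ 2) ≤ 3 / 8 * a ∧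
      2 * C ≤ ε * a) ∧ 2 ≤ N ∧ A * D ^ 2 / c₀ < N ∧ C ≤ Real.log N ∧ 8 * C₁ ^ 2 / ε ≤ N ∧
      80 * K / (C₁ * ε) ^ 2 ≤ N ∧ 12 / (C₁ * ε) ≤ N ∧ Real.log n₁ ≤ N := by
    have h2 : Tendsto (fun N : ℝ => N / 2) atTop atTop := tendsto_id.atTop_div_const (by norm_num)
    refine Filter.Eventually.and ?_ ((eventually_ge_atTop _).and ((eventually_gt_atTop _).and
      ((Real.tendsto_log_atTop.eventually_ge_atTop C).and ((eventually_ge_atTop _).and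
      ((eventually_ge_atTop _).and ((eventually_ge_atTop _).and (eventually_ge_atTop _)))))))
    have h3 : ∀ᶠ a : ℝ in atTop, a₀ ≤ a ∧ Real.log (A * a ^ 2) ≤ 3 / 8 * a ∧ 2 * C / ε ≤ a :=
      (eventually_ge_atTop a₀).and (hlog.and (eventually_ge_atTop (2 * C / ε)))
    obtain ⟨b₀, hb₀⟩ := eventually_atTop.1 h3
    filter_upwards [h2.eventually_ge_atTop b₀] with N hN a ha
    obtain ⟨q1, q2, q3⟩ := hb₀ a (hN.trans ha)
    rw [div_le_iff₀ hε] at q3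
    exact ⟨q1, q2, by linarith⟩
  obtain ⟨N₀, hN₀⟩ := eventually_atTop.1 hev
  refine ⟨N₀, ?_⟩
  intro n hn p hp1 hp2 a Q lam ha hQ hlam0 hlam hlamj
  obtain ⟨hNa, hN2, hNA, hNC, hNε, hNK, hN8, hNn⟩ := hN₀ _ hn
  set N : ℝ := Real.log n with hN
  have hn0 : (0 : ℝ) < n := by
    by_contra h
    have : (n : ℝ) = 0 := le_antisymm (not_lt.1 h) (Nat.cast_nonneg n)
    rw [hN, this, Real.log_zero] at hN2
    linarith
  have hnpos : 0 < n := by exact_mod_cast hn0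
  have hN9 : N ≤ N ^ 9 := le_self_pow₀ (by linarith) (by norm_num)
  have hnp : 0 < n * (p : ℝ) := by linarith
  have hp0 : 0 < (p : ℝ) := by
    rcases p.2.1.lt_or_eq with h | h
    · exact h
    · rw [← h, mul_zero] at hnp; exact absurd hnp (lt_irrefl _)
  have hloginv : Real.log (p : ℝ) = -a := by rw [ha, one_div, Real.log_inv, neg_neg]
  have hlognp : Real.log (n * (p : ℝ)) = N - a := by
    rw [Real.log_mul hn0.ne' hp0.ne', hloginv]; ring
  have hx : Real.log N ≤ N - a := by
    rw [← hlognp]; exact Real.log_le_log (by linarith) (hN9.trans hp1)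
  have hlogN : 0 ≤ Real.log N := Real.log_nonneg (by linarith)
  have haN : a ≤ N := by linarith
  have haN2 : N / 2 ≤ a := by
    have h := Real.log_nonpos (by positivity) hp2
    rw [Real.log_mul (by positivity) (by positivity), Real.log_mul (by positivity) (by positivity),
      Real.log_pow, Real.log_pow, hloginv] at h
    push_cast at h
    linarith
  obtain ⟨haa₀, halog, haC⟩ := hNa a haN2
  have ha1 : 1 ≤ a := by linarith
  have hQ2 : Q = (n * (p : ℝ)) ^ 2 := by rw [hQ]; ring
  have hNN : N ^ 9 ≤ n * (p : ℝ) := hp1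
  have hQN : N ^ 3 ≤ Q := by
    rw [hQ2]
    calc N ^ 3 ≤ N ^ 18 := pow_le_pow_right₀ (by linarith) (by norm_num)
      _ = (N ^ 9) ^ 2 := by ring
      _ ≤ _ := by gcongr
  have hN3 : N ≤ N ^ 3 := le_self_pow₀ (by linarith) (by norm_num)
  have hQNN : N ≤ Q := hN3.trans hQN
  have hQ0 : 0 < Q := by linarith
  have hnN : N ^ 3 ≤ n := by
    calc N ^ 3 ≤ N ^ 9 := pow_le_pow_right₀ (by linarith) (by norm_num)
      _ ≤ n * (p : ℝ) := hNN
      _ ≤ n * 1 := by gcongr; exact p.2.2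
      _ = n := mul_one _
  have hAD : A * D ^ 2 < c₀ * N := by
    rw [div_lt_iff₀ hc0] at hNA; linarith
  -- Since `a ≤ N`, the threshold on the left is quadratic in `N`, hence eventually below the cubic
  -- lower bounds for `Q` and `n`.
  have hAaN : A * a ^ 2 * D ^ 2 < c₀ * N ^ 3 := by
    calc A * a ^ 2 * D ^ 2 ≤ A * N ^ 2 * D ^ 2 := by gcongr
      _ = (A * D ^ 2) * N ^ 2 := by ring
      _ < (c₀ * N) * N ^ 2 := by gcongr
      _ = _ := by ring
  have hDD : (D : ℝ) ≤ D ^ 2 := le_self_pow₀ (by exact_mod_cast (by omega : 1 ≤ D)) (by norm_num)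
  have hc1 : c₀ ≤ 1 := by rw [hc₀]; exact min_le_left _ _
  have k1 : A * a ^ 2 * D ^ 2 < c₀ * Q := hAaN.trans_le (by gcongr)
  have k2 : A * a ^ 2 * D < n := by
    calc A * a ^ 2 * D ≤ A * a ^ 2 * D ^ 2 := by gcongr
      _ < c₀ * N ^ 3 := hAaN
      _ ≤ 1 * N ^ 3 := by gcongr
      _ ≤ n := by linarith
  have k5 : 8 * (n * (p : ℝ) ^ 2) * C₁ ^ 2 ≤ ε := by
    rw [div_le_iff₀ hε] at hNε
    have hNsq : N ≤ N ^ 2 := le_self_pow₀ (by linarith) (by norm_num)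
    have hN0 : 0 < N ^ 2 := by positivity
    refine le_of_mul_le_mul_right ?_ hN0
    calc 8 * (n * (p : ℝ) ^ 2) * C₁ ^ 2 * N ^ 2 = 8 * C₁ ^ 2 * (n * (p : ℝ) ^ 2 * N ^ 2) := by ring
      _ ≤ 8 * C₁ ^ 2 * 1 := by gcongr
      _ ≤ N * ε := by linarith
      _ ≤ N ^ 2 * ε := by gcongr
      _ = ε * N ^ 2 := by ring
  have hQa : N ≤ Q * a := by
    calc N = N * 1 := (mul_one _).symm
      _ ≤ Q * a := by gcongr
  have hpre : (8 * K * Q * a + 2) * (n + 1) ≤ Real.exp (C₁ * ε * Q * a) := by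
    refine prefactor_le (by omega) (by positivity) hK (by linarith) ?_ ?_
    · rw [div_le_iff₀ (by positivity)] at hNK
      calc 80 * K ≤ N * (C₁ * ε) ^ 2 := hNK
        _ = (C₁ * ε) ^ 2 * N := by ring
        _ ≤ _ := by gcongr
    · rw [div_le_iff₀ (by positivity)] at hN8
      have h3 : N * (N / 2) ≤ Q * a := by gcongr
      have h4 : N * (N / 2) * 2 ≤ Q * a * 2 := by gcongr
      have h5 : N * N ≤ Q * a := by
        calc N * N ≤ N ^ 3 := by
              calc N * N = N ^ 2 := by ring
                _ ≤ N ^ 3 := pow_le_pow_right₀ (by linarith) (by norm_num)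
          _ ≤ Q * 1 := by linarith
          _ ≤ Q * a := by gcongr
      calc 4 * N + 2 ≤ 12 * N := by linarith
        _ ≤ (N * (C₁ * ε)) * N := by gcongr
        _ = C₁ * ε * (N * N) := by ring
        _ ≤ _ := by gcongr
  have hn1' : n₁ ≤ n := by
    by_contra h
    push Not at h
    have h' : (n : ℝ) < n₁ := by exact_mod_cast h
    have := Real.log_lt_log hn0 h'
    linarith
  set T : ℝ := lam * Q * √((δ - 4 * ε) / 2) - 4 * C₁ * ε * Q * a with hT
  have hTB : T ≤ (1 + δ) * Q * a := by
    have e1 : √((δ - 4 * ε) / 2) ≤ 1 + δ := by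
      rw [Real.sqrt_le_left (by positivity), show (1 + δ) ^ 2 = 1 + 2 * δ + δ ^ 2 by ring]
      linarith [sq_nonneg δ]
    have e2 : lam * Q * √((δ - 4 * ε) / 2) ≤ a * Q * (1 + δ) := by gcongr
    have e3 : 0 ≤ 4 * C₁ * ε * Q * a := by positivity
    rw [hT]; linarith
  have hA1 : 1 ≤ A * a ^ 2 := one_le_mul_of_one_le_of_one_le hA (one_le_pow₀ ha1)
  have hfin := hmain n hn1' p hp0 a Q ha hQ haa₀ (by linarith) T hTB (fun H hH0 hHd hH =>
    cost_of_core hε hε8 hεδ hnpos hp0 hQ ha (by linarith) (by rw [hC, hc₀]) hC₁ hD8 hDε hA1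
      (by rw [← hc₀]; exact k1) k2 halog (by rw [← hN]; linarith) k5 haC hlam0 hlam
      (by rw [← hN]; exact hlamj) hH0 hHd hH)
  refine hfin.trans ?_
  calc (8 * K * Q * a + 2) * (n + 1) * Real.exp (-T)
      ≤ Real.exp (C₁ * ε * Q * a) * Real.exp (-T) := by gcongr
    _ = Real.exp (-(lam * Q * √((δ - 4 * ε) / 2) - 40 * (1 + δ) * ε * Q * a)) := by
      rw [← Real.exp_add, hT, hC₁]; congr 1; ring

/-- The upper tail when `n⁻¹ᐟ² ≪ p ≪ 1`. -/
theorem dense_tail {δ ε z : ℝ} (hε : 0 < ε) (hε8 : ε ≤ 1 / 8) (hεδ : 4 * ε ≤ δ) (hz0 : 0 ≤ z)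
    (hz : 2 * z ^ 2 + (1 + ε) * z ≤ δ - 4 * ε) :
    ∃ κ : ℝ, 0 < κ ∧ ∃ n₂ : ℕ, ∀ n : ℕ, n₂ ≤ n → ∀ p : I, 0 < (p : ℝ) → (p : ℝ) ≤ κ →
      1 ≤ κ * (n * (p : ℝ) ^ 2) →
      ∀ a Q : ℝ, a = Real.log (1 / p) → Q = (n : ℝ) ^ 2 * (p : ℝ) ^ 2 →
      (SimpleGraph.binomialRandom (Fin n) p).real
        {G | (1 + δ) * (8 * mean n p) ≤ (orderedCount G : ℝ)} ≤
          Real.exp (-((1 - ε) * z * Q * a - ε * Q * a)) := by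
  have hδ : 0 < δ := by linarith
  obtain ⟨a₀, A, K, ha₀, hA, hK, n₁, hmain⟩ := tail_le_of_cores hδ hε (by linarith) hεδ
    (B := 1 + δ)
  have hzδ : z ≤ δ := by nlinarith [sq_nonneg z]
  obtain ⟨C₁, hC₁⟩ : ∃ C₁ : ℝ, C₁ = 1 + δ := ⟨_, rfl⟩
  obtain ⟨c₀, hc₀⟩ : ∃ c₀ : ℝ, c₀ = min 1 (δ / 17) := ⟨_, rfl⟩
  have hc0 : 0 < c₀ := by rw [hc₀]; exact lt_min one_pos (by positivity)
  have hC₁0 : 0 < C₁ := by rw [hC₁]; positivity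
  -- The first bound gives `a ≥ a₀`, the second `n ≤ c₀ Q ≤ m`, and the third makes the error of
  -- `pathSum_le_of_sparse` at most `ε Q²`.
  obtain ⟨κ, hκ⟩ : ∃ κ : ℝ, κ = min (min (Real.exp (-a₀)) c₀) (ε ^ 3 / (128 * C₁ ^ 2)) := ⟨_, rfl⟩
  have hκ0 : 0 < κ := by
    rw [hκ]; exact lt_min (lt_min (Real.exp_pos _) hc0) (by positivity)
  have hκ1 : κ ≤ Real.exp (-a₀) := by rw [hκ]; exact (min_le_left _ _).trans (min_le_left _ _)
  have hκ2 : κ ≤ c₀ := by rw [hκ]; exact (min_le_left _ _).trans (min_le_right _ _)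
  have hκ3 : κ ≤ ε ^ 3 / (128 * C₁ ^ 2) := by rw [hκ]; exact min_le_right _ _
  have hc1 : c₀ ≤ 1 := by rw [hc₀]; exact min_le_left _ _
  have hκ4 : κ ≤ 1 := hκ2.trans hc1
  obtain ⟨n₂, hn₂⟩ : ∃ n₂ : ℕ, ∀ n : ℕ, n₂ ≤ n → n₁ ≤ n ∧ 1 ≤ n ∧ 80 * K / ε ^ 2 ≤ n ∧
      4 * Real.log n + 2 ≤ ε * n := by
    have h1 : ∀ᶠ x : ℝ in atTop, 4 * Real.log x + 2 ≤ ε * x := by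
      have h1 := Real.isLittleO_log_id_atTop.def (by positivity : (0 : ℝ) < ε / 8)
      filter_upwards [h1, eventually_ge_atTop (1 : ℝ), eventually_ge_atTop (4 / ε)] with x hx hx1 hx2
      rw [id, Real.norm_of_nonneg (Real.log_nonneg hx1), Real.norm_of_nonneg (by linarith)] at hx
      rw [div_le_iff₀ hε] at hx2
      linarith
    have h2 := (eventually_ge_atTop n₁).and ((eventually_ge_atTop 1).and
      ((tendsto_natCast_atTop_atTop.eventually_ge_atTop (80 * K / ε ^ 2)).and
      (tendsto_natCast_atTop_atTop.eventually h1)))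
    exact eventually_atTop.1 h2
  refine ⟨κ, hκ0, n₂, ?_⟩
  intro n hn p hp0 hpκ hnp a Q ha hQ
  obtain ⟨hn1, hn1', hnK, hnlog⟩ := hn₂ n hn
  have hn0 : (0 : ℝ) < n := by exact_mod_cast hn1'
  have haa₀ : a₀ ≤ a := by
    have h := Real.log_le_log hp0 (hpκ.trans hκ1)
    rw [Real.log_exp] at h
    rw [ha, one_div, Real.log_inv]; linarith
  have ha1 : 1 ≤ a := by linarith
  have hnQ : (n : ℝ) ≤ κ * Q := by
    calc (n : ℝ) = n * 1 := (mul_one _).symm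
      _ ≤ n * (κ * (n * (p : ℝ) ^ 2)) := by gcongr
      _ = κ * Q := by rw [hQ]; ring
  have hQ0 : 0 < Q := by rw [hQ]; positivity
  have hnQ' : (n : ℝ) ≤ Q := by
    calc (n : ℝ) ≤ κ * Q := hnQ
      _ ≤ 1 * Q := by gcongr
      _ = Q := one_mul _
  have hQa : (n : ℝ) ≤ Q * a := by
    calc (n : ℝ) = n * 1 := (mul_one _).symm
      _ ≤ Q * a := by gcongr
  have hnone : (1 : ℝ) ≤ n := by exact_mod_cast hn1'
  have hpre : (8 * K * Q * a + 2) * (n + 1) ≤ Real.exp (ε * Q * a) := by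
    refine prefactor_le hn1' hε hK (by linarith) ?_ ?_
    · rw [div_le_iff₀ (by positivity)] at hnK
      calc 80 * K ≤ n * ε ^ 2 := hnK
        _ = ε ^ 2 * n := by ring
        _ ≤ _ := by gcongr
    · exact hnlog.trans (by gcongr)
  set T : ℝ := (1 - ε) * z * Q * a with hT
  have hε1 : 0 ≤ 1 - ε := by linarith
  have hTB : T ≤ (1 + δ) * Q * a := by
    rw [hT]
    gcongr
    nlinarith
  have hcost : ∀ H : SimpleGraph (Fin n), 0 < H.edgeSet.ncard → DegreeCondition (A * a ^ 2) H →
      (δ - 3 * ε) * Q ^ 2 ≤ orderedCount H + 4 * (p : ℝ) ^ 2 * pathSum H →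
      T ≤ (1 - ε) * (H.edgeSet.ncard * a) -
        supportCard H * Real.log (n / H.edgeSet.ncard) := by
    intro H hH0 _ hH
    have hmQ := le_ncard_of_core hεδ hδ hQ hQ0 hH
    have e1 := orderedCount_le H
    rw [← hc₀] at hmQ
    -- For this `γ` the path term becomes `(1 + ε) Q m` plus an error of order `p² m²`. If `m < z
    -- Q`, the quadratic inequality for `z` contradicts the lower bound on the number of cycles.
    have hpath := pathSum_le_of_sparse H (γ := ε / 8) (by positivity)
    have hm0 : (0 : ℝ) < H.edgeSet.ncard := by exact_mod_cast hH0
    generalize (H.edgeSet.ncard : ℝ) = m at *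
    have hlog : Real.log (n / m) ≤ 0 := by
      refine Real.log_nonpos (by positivity) ?_
      rw [div_le_one hm0]
      calc (n : ℝ) ≤ κ * Q := hnQ
        _ ≤ c₀ * Q := by gcongr
        _ ≤ m := hmQ
    have hsl : (supportCard H : ℝ) * Real.log (n / m) ≤ 0 :=
      mul_nonpos_of_nonneg_of_nonpos (Nat.cast_nonneg _) hlog
    suffices hzm : z * Q ≤ m by
      have : (1 - ε) * (z * Q * a) ≤ (1 - ε) * (m * a) := by gcongr
      rw [hT]; linarith
    by_contra hlt
    push Not at hlt
    have hmC : m ≤ C₁ * Q := by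
      refine hlt.le.trans ?_
      gcongr
      rw [hC₁]; linarith
    have e2 : 4 * (p : ℝ) ^ 2 * pathSum H ≤ 4 * (p : ℝ) ^ 2 * (m * n ^ 2 / 4 +
        2 * (ε / 8) * m * n ^ 2 + m ^ 2 / (2 * (ε / 8) ^ 2)) := by gcongr
    have e3 : 4 * (p : ℝ) ^ 2 * (m * n ^ 2 / 4 + 2 * (ε / 8) * m * n ^ 2 +
        m ^ 2 / (2 * (ε / 8) ^ 2)) = (1 + ε) * Q * m + 128 / ε ^ 2 * (p : ℝ) ^ 2 * m ^ 2 := by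
      rw [hQ]; field_simp; ring
    have e4 : 128 / ε ^ 2 * (p : ℝ) ^ 2 * m ^ 2 ≤ ε * Q ^ 2 := by
      have hpp : (p : ℝ) ^ 2 ≤ ε ^ 3 / (128 * C₁ ^ 2) := by
        calc (p : ℝ) ^ 2 = p * p := by ring
          _ ≤ 1 * κ := by gcongr; exact p.2.2
          _ = κ := one_mul _
          _ ≤ _ := hκ3
      calc 128 / ε ^ 2 * (p : ℝ) ^ 2 * m ^ 2 ≤
            128 / ε ^ 2 * (ε ^ 3 / (128 * C₁ ^ 2)) * (C₁ * Q) ^ 2 := by gcongr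
        _ = ε * Q ^ 2 := by field_simp
    have e5 : (δ - 4 * ε) * Q ^ 2 ≤ 2 * m ^ 2 + (1 + ε) * Q * m := by linarith
    have e6 : 2 * m ^ 2 + (1 + ε) * Q * m < 2 * (z * Q) ^ 2 + (1 + ε) * Q * (z * Q) := by
      have h1 : m ^ 2 < (z * Q) ^ 2 := by gcongr
      have h2 : (1 + ε) * Q * m < (1 + ε) * Q * (z * Q) := by gcongr
      linarith
    have e7 : 2 * (z * Q) ^ 2 + (1 + ε) * Q * (z * Q) ≤ (δ - 4 * ε) * Q ^ 2 := by
      calc _ = (2 * z ^ 2 + (1 + ε) * z) * Q ^ 2 := by ring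
        _ ≤ _ := by gcongr
    linarith
  have hQ1 : 1 ≤ Q := by linarith
  refine (hmain n hn1 p hp0 a Q ha hQ haa₀ hQ1 T hTB hcost).trans ?_
  calc (8 * K * Q * a + 2) * (n + 1) * Real.exp (-T)
      ≤ Real.exp (ε * Q * a) * Real.exp (-T) := by gcongr
    _ = Real.exp (-((1 - ε) * z * Q * a - ε * Q * a)) := by
      rw [← Real.exp_add, hT]; congr 1; ring


/-! ### The optimal degree -/

theorem c_nonneg (k : ℕ) : 0 ≤ c k := by
  unfold c; split_ifs <;> positivity

theorem c_eq {k : ℕ} (hk : 2 ≤ k) :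
    c k = 1 / (2 + √(((k : ℝ) + 1) / ((k : ℝ) - 1))) := if_neg (by omega)

/-- The square root in `c k` is at least one. Consequently `p ≤ n ^ (-2/3)` throughout the ranges
defined by the exponents `c k`. -/
theorem c_le_third {k : ℕ} (hk : 1 ≤ k) : c k ≤ 1 / 3 := by
  rcases hk.eq_or_lt with rfl | hk
  · simp [c]
  rw [c_eq hk]
  have hk' : (2 : ℝ) ≤ k := by exact_mod_cast hk
  have h : 1 ≤ √(((k : ℝ) + 1) / ((k : ℝ) - 1)) := by
    rw [Real.one_le_sqrt, one_le_div (by linarith)]; linarith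
  apply one_div_le_one_div_of_le (by norm_num); linarith

theorem c_le_succ {k : ℕ} (hk : 1 ≤ k) : c k ≤ c (k + 1) := by
  rcases hk.eq_or_lt with rfl | hk
  · exact le_trans (by simp [c]) (c_nonneg _)
  have hk' : (2 : ℝ) ≤ k := by exact_mod_cast hk
  rw [c_eq hk, c_eq (by omega)]
  have h : √(((k + 1 : ℕ) + 1 : ℝ) / ((k + 1 : ℕ) - 1)) ≤ √(((k : ℝ) + 1) / ((k : ℝ) - 1)) := by
    apply Real.sqrt_le_sqrt
    push_cast
    rw [div_le_div_iff₀ (by linarith) (by linarith)]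
    nlinarith
  apply one_div_le_one_div_of_le (by positivity)
  linarith

theorem c_mono {j k : ℕ} (hj : 1 ≤ j) (hjk : j ≤ k) : c j ≤ c k := by
  induction k, hjk using Nat.le_induction with
  | base => exact le_rfl
  | succ k hk ih => exact ih.trans (c_le_succ (hj.trans hk))

/-- The cost of a vertex of degree `j` relative to its contribution to the number of 4-cycles. -/
noncomputable def costRatio (N x : ℝ) (j : ℕ) : ℝ :=
  (j * (N - x) - (N - 2 * x)) / √((j : ℝ) * (j - 1))

/-- For `s = √(j - 1)` and `u = √(j + 1)`, the left side is the cross-multiplied difference of the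
cost ratios at `j + 1` and `j`. The last factor vanishes at `x = s N / (2s + u) = c j * N`, which
explains the definition of `c`. -/
theorem costRatio_identity (N x s u : ℝ) (h : u ^ 2 = s ^ 2 + 2) :
    ((s ^ 2 + 2) * (N - x) - (N - 2 * x)) * s - ((s ^ 2 + 1) * (N - x) - (N - 2 * x)) * u =
      (u - s) ^ 2 / 2 * (s * N - x * (2 * s + u)) := by
  linear_combination (u * x / 2 - s * N / 2) * h

/-- Together with the monotonicity of `c`, this makes the cost ratio unimodal in `j`. -/
theorem costRatio_step {N x : ℝ} {j : ℕ} (hj : 2 ≤ j) :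
    (x ≤ c j * N → costRatio N x j ≤ costRatio N x (j + 1)) ∧
      (c j * N ≤ x → costRatio N x (j + 1) ≤ costRatio N x j) := by
  have hj' : (2 : ℝ) ≤ j := by exact_mod_cast hj
  obtain ⟨s, hs⟩ : ∃ s, s = √((j : ℝ) - 1) := ⟨_, rfl⟩
  obtain ⟨u, hu⟩ : ∃ u, u = √((j : ℝ) + 1) := ⟨_, rfl⟩
  have hs0 : 0 < s := by rw [hs]; exact Real.sqrt_pos.2 (by linarith)
  have hu0 : 0 < u := by rw [hu]; exact Real.sqrt_pos.2 (by linarith)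
  have hs2 : s ^ 2 = j - 1 := by rw [hs]; exact Real.sq_sqrt (by linarith)
  have hu2 : u ^ 2 = j + 1 := by rw [hu]; exact Real.sq_sqrt (by linarith)
  obtain ⟨q, hq⟩ : ∃ q, q = √(j : ℝ) := ⟨_, rfl⟩
  have hq0 : 0 < q := by rw [hq]; exact Real.sqrt_pos.2 (by linarith)
  have hc : c j = s / (2 * s + u) := by
    rw [c_eq hj, Real.sqrt_div (by linarith), ← hs, ← hu]
    field_simp
  have e1 : √((j : ℝ) * (j - 1)) = q * s := by rw [Real.sqrt_mul (by linarith), ← hq, ← hs]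
  have e2 : √(((j + 1 : ℕ) : ℝ) * ((j + 1 : ℕ) - 1)) = q * u := by
    push_cast
    rw [add_sub_cancel_right, mul_comm, Real.sqrt_mul (by linarith), ← hq, ← hu]
  have hid := costRatio_identity N x s u (by linarith)
  have hj1 : (j : ℝ) = s ^ 2 + 1 := by linarith
  unfold costRatio
  rw [e1, e2, hc]
  push_cast
  rw [hj1, show s ^ 2 + 1 + 1 = s ^ 2 + 2 by ring]
  have hsu : 0 < 2 * s + u := by positivity
  have hsq := sq_nonneg (u - s)
  constructor
  · intro h
    rw [div_mul_eq_mul_div, le_div_iff₀ hsu] at h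
    rw [div_le_div_iff₀ (by positivity) (by positivity)]
    have : 0 ≤ (u - s) ^ 2 / 2 * (s * N - x * (2 * s + u)) := by
      apply mul_nonneg (by positivity); linarith
    nlinarith
  · intro h
    rw [div_mul_eq_mul_div, div_le_iff₀ hsu] at h
    rw [div_le_div_iff₀ (by positivity) (by positivity)]
    have : 0 ≤ (u - s) ^ 2 / 2 * (x * (2 * s + u) - s * N) := by
      apply mul_nonneg (by positivity); linarith
    nlinarith

/-- In the range `c_{k-1} N ≤ x ≤ c_k N`, degree `k` is optimal. -/
theorem costRatio_min {N x : ℝ} {k j : ℕ} (hN : 0 ≤ N) (hk : 2 ≤ k) (h1 : c (k - 1) * N ≤ x)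
    (h2 : x ≤ c k * N) (hj : 2 ≤ j) : costRatio N x k ≤ costRatio N x j := by
  rcases le_total k j with hkj | hjk
  · induction j, hkj using Nat.le_induction with
    | base => exact le_rfl
    | succ j hkj ih =>
      refine (ih (hk.trans hkj)).trans ((costRatio_step (hk.trans hkj)).1 (h2.trans ?_))
      exact mul_le_mul_of_nonneg_right (c_mono (by omega) hkj) hN
  · have : ∀ i, j ≤ i → i ≤ k → costRatio N x i ≤ costRatio N x j := by
      intro i hji
      induction i, hji using Nat.le_induction with
      | base => exact fun _ => le_rfl
      | succ i hji ih =>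
        intro hik
        refine ((costRatio_step (hj.trans hji)).2 (le_trans ?_ h1)).trans (ih (by omega))
        exact mul_le_mul_of_nonneg_right (c_mono (by omega) (by omega)) hN
    exact this k hjk le_rfl

theorem r_eq {k : ℕ} (hk : 2 ≤ k) : r k = 2 * √((k : ℝ) / ((k : ℝ) - 1)) :=
  if_neg (by omega)

theorem two_le_r {k : ℕ} (hk : 2 ≤ k) : 2 ≤ r k := by
  rw [r_eq hk]
  have hk' : (2 : ℝ) ≤ k := by exact_mod_cast hk
  have h : 1 ≤ √((k : ℝ) / ((k : ℝ) - 1)) := by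
    rw [Real.one_le_sqrt, one_le_div (by linarith)]; linarith
  linarith

/-- Here `r k / 2 = k / √(k (k - 1))` is the number of edges per unit of contribution when all
vertices have degree `k`. -/
theorem r_mul_eq_costRatio {N x : ℝ} {k : ℕ} (hk : 2 ≤ k) :
    r k / 2 * ((N - x) - (N - 2 * x) / k) = costRatio N x k := by
  have hk' : (2 : ℝ) ≤ k := by exact_mod_cast hk
  rw [r_eq hk, costRatio, Real.sqrt_div (by linarith), Real.sqrt_mul (by linarith)]
  have h1 : 0 < √((k : ℝ) - 1) := Real.sqrt_pos.2 (by linarith)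
  have h2 : 0 < √(k : ℝ) := Real.sqrt_pos.2 (by linarith)
  have h3 : √(k : ℝ) ^ 2 = k := Real.sq_sqrt (by linarith)
  field_simp
  rw [h3]

/-- With `x = log (n p)`, one has `N - x = a`, and the rate considered is the cost ratio at the
optimal degree `k`. The lower bound allows errors of order `Q a` to be compared with the main term;
the other two are the hypotheses of `sparse_tail`. -/
theorem lam_conditions {N x : ℝ} {k : ℕ} (hN : 0 ≤ N) (hk : 2 ≤ k) (h1 : c (k - 1) * N ≤ x)
    (h2 : x ≤ c k * N) :
    (N - x) / 2 ≤ r k / 2 * ((N - x) - (N - 2 * x) / k) ∧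
    r k / 2 * ((N - x) - (N - 2 * x) / k) ≤ N - x ∧
      ∀ j : ℕ, 1 ≤ j → r k / 2 * ((N - x) - (N - 2 * x) / k) * √((j : ℝ) * (j - 1)) ≤
        j * (N - x) - (2 * (N - x) - N) := by
  have hx0 : 0 ≤ x := (mul_nonneg (c_nonneg _) hN).trans h1
  have hx3 : x ≤ N / 3 := by
    have := mul_le_mul_of_nonneg_right (c_le_third (k := k) (by omega)) hN
    linarith
  have hj : ∀ j : ℕ, 1 ≤ j → r k / 2 * ((N - x) - (N - 2 * x) / k) * √((j : ℝ) * (j - 1)) ≤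
        j * (N - x) - (2 * (N - x) - N) := by
    intro j hj
    rcases hj.eq_or_lt with rfl | hj
    · norm_num; linarith
    have hj' : (2 : ℝ) ≤ j := by exact_mod_cast hj
    have h := costRatio_min hN hk h1 h2 hj
    rw [r_mul_eq_costRatio hk]
    have h0 : 0 < √((j : ℝ) * (j - 1)) := Real.sqrt_pos.2 (by nlinarith)
    rw [costRatio.eq_def N x j, le_div_iff₀ h0] at h
    linarith
  have hk' : (2 : ℝ) ≤ k := by exact_mod_cast hk
  refine ⟨?_, ?_, hj⟩
  · have h3 : (N - 2 * x) / k ≤ (N - x) / 2 := by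
      rw [div_le_div_iff₀ (by linarith) (by norm_num)]
      nlinarith
    have h4 := two_le_r hk
    calc (N - x) / 2 = 1 * ((N - x) - (N - x) / 2) := by ring
      _ ≤ r k / 2 * ((N - x) - (N - 2 * x) / k) := by
        gcongr
        · linarith
        · linarith
  · set lam := r k / 2 * ((N - x) - (N - 2 * x) / k) with hlam
    -- The bound is the limit of `hj` as `j` tends to infinity; it fails at `j = i + 1` once `i`
    -- exceeds `x` over the gap.
    by_contra hlt
    push Not at hlt
    have hgap : 0 < lam - (N - x) := by linarith
    obtain ⟨i, hi⟩ := exists_nat_gt (x / (lam - (N - x)))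
    rw [div_lt_iff₀ hgap] at hi
    have h5 := hj (i + 1) (by omega)
    have h6 : (i : ℝ) ≤ √(((i + 1 : ℕ) : ℝ) * ((i + 1 : ℕ) - 1)) := by
      apply Real.le_sqrt_of_sq_le
      push_cast
      have : (0 : ℝ) ≤ i := Nat.cast_nonneg i
      nlinarith
    have h7 : 0 ≤ lam := by linarith
    have h8 : lam * i ≤ lam * √(((i + 1 : ℕ) : ℝ) * ((i + 1 : ℕ) - 1)) := by gcongr
    push_cast at h5 h8
    nlinarith

/-- The square root is at most `j - 1/2`, and `2a - N ≤ a / 2`. So for `p ≥ n ^ (-2/3)` the full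
rate `a` is admissible. -/
theorem half_conditions {N a : ℝ} (ha0 : 0 ≤ a) (ha : a ≤ 2 / 3 * N) (j : ℕ) (hj : 1 ≤ j) :
    a * √((j : ℝ) * (j - 1)) ≤ j * a - (2 * a - N) := by
  have hj' : (1 : ℝ) ≤ j := by exact_mod_cast hj
  have h : √((j : ℝ) * (j - 1)) ≤ j - 1 / 2 := by
    rw [Real.sqrt_le_left (by linarith)]; nlinarith
  have := mul_le_mul_of_nonneg_left h ha0
  linarith


/-! ### Comparison with the stated exponents -/

theorem log_upperTail_le {n : ℕ} {p : I} {δ x y : ℝ}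
    (h : (SimpleGraph.binomialRandom (Fin n) p).real
      {G | (1 + δ) * (8 * mean n p) ≤ (orderedCount G : ℝ)} ≤ Real.exp x) (hxy : x ≤ y) :
    ENNReal.log (upperTail n p δ) ≤ (y : EReal) := by
  rw [upperTail_real]
  calc ENNReal.log (ENNReal.ofReal _) ≤ ENNReal.log (ENNReal.ofReal (Real.exp y)) :=
        ENNReal.log_monotone (ENNReal.ofReal_le_ofReal (h.trans (Real.exp_le_exp.2 hxy)))
    _ = (y : EReal) := by rw [ENNReal.log_ofReal_of_pos (Real.exp_pos y), Real.log_exp]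

/-- Only this direction is needed, as the claimed bounds become weaker when `m` and `mStar` are
replaced by something smaller. -/
theorem sqrt_mean_le (n : ℕ) (p : I) :
    √(mean n p) ≤ (n : ℝ) ^ 2 * (p : ℝ) ^ 2 / (2 * √2) := by
  apply Real.sqrt_le_iff.2
  refine ⟨by positivity, ?_⟩
  rw [div_pow, mul_pow (2 : ℝ), Real.sq_sqrt (by norm_num), le_div_iff₀ (by norm_num)]
  have := mean_le n p
  linarith

theorem r_nonneg (k : ℕ) : 0 ≤ r k := by
  unfold r; split_ifs <;> positivity

theorem m_nonneg (k n : ℕ) (p : I) (δ ε : ℝ) : 0 ≤ m k n p δ ε :=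
  mul_nonneg (r_nonneg k) (Real.sqrt_nonneg _)

theorem m_le (k n : ℕ) (p : I) {δ ε : ℝ} (h : 0 ≤ δ + ε) :
    m k n p δ ε ≤ r k / 2 * √((δ + ε) / 2) * ((n : ℝ) ^ 2 * (p : ℝ) ^ 2) := by
  have h1 := sqrt_mean_le n p
  have h2 : (0 : ℝ) < √2 := by positivity
  calc m k n p δ ε = r k * (√(δ + ε) * √(mean n p)) := by rw [m, Real.sqrt_mul h]
    _ ≤ r k * (√(δ + ε) * ((n : ℝ) ^ 2 * (p : ℝ) ^ 2 / (2 * √2))) := by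
      have := r_nonneg k
      gcongr
    _ = _ := by
      rw [Real.sqrt_div h]
      field_simp

/-- In the quotient of `(n + 1 - t) ^ t` by `t!`, the base is at least `n / 2` and `t!` is at most
`S ^ t`. -/
theorem mul_log_le_log_choose {n t : ℕ} {S : ℝ} (hS : 0 < S) (ht : (t : ℝ) ≤ S)
    (hn : 2 * S ≤ n) : t * Real.log (n / (2 * S)) ≤ Real.log (n.choose t) := by
  have hn0 : (0 : ℝ) < n := by linarith
  rw [← Real.log_pow]
  apply Real.log_le_log (by positivity)
  refine le_trans ?_ (Nat.pow_le_choose (α := ℝ) t n)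
  have htn : t ≤ n := by
    have : (t : ℝ) ≤ n := by linarith
    exact_mod_cast this
  have h1 : (n : ℝ) / 2 ≤ ((n + 1 - t : ℕ) : ℝ) := by
    rw [Nat.cast_sub (by omega)]
    push_cast
    linarith
  have h2 : (t.factorial : ℝ) ≤ S ^ t := by
    calc (t.factorial : ℝ) ≤ (t : ℝ) ^ t := by exact_mod_cast Nat.factorial_le_pow t
      _ ≤ S ^ t := by gcongr
  calc ((n : ℝ) / (2 * S)) ^ t = (n / 2) ^ t / S ^ t := by rw [← div_div, div_pow]
    _ ≤ _ := by
      have : (0 : ℝ) < t.factorial := by exact_mod_cast t.factorial_pos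
      gcongr

/-- The cost `log (1 / (p ^ s * (n choose s / k)))` of planting `s / k` vertices of degree `k`. -/
theorem log_plant_bounds {n k : ℕ} {p s S b L : ℝ} (hp : 0 < p) (hk : 2 ≤ k) (hs : 0 ≤ s)
    (hS : 0 < S) (hsS : s ≤ S) (hn : 2 * S ≤ n) (hb : 0 ≤ b) (hL : 0 ≤ L)
    (hbL : b - L ≤ Real.log (n / (2 * S))) (hnp : Real.log n ≤ 2 * (-Real.log p)) :
    0 ≤ -Real.log (p ^ s * (n.choose ⌊s / k⌋₊ : ℝ)) ∧
      -Real.log (p ^ s * (n.choose ⌊s / k⌋₊ : ℝ)) ≤ s * (-Real.log p - b / k) + b + S * L := by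
  obtain ⟨t, ht⟩ : ∃ t, t = ⌊s / k⌋₊ := ⟨_, rfl⟩
  have hk' : (2 : ℝ) ≤ k := by exact_mod_cast hk
  have hsk : 0 ≤ s / k := by positivity
  have ht1 : (t : ℝ) ≤ s / k := ht ▸ Nat.floor_le hsk
  have ht2 : s / k < t + 1 := ht ▸ Nat.lt_floor_add_one _
  have hsk2 : s / k ≤ s / 2 := div_le_div_of_nonneg_left hs (by norm_num) hk'
  have htS : (t : ℝ) ≤ S := by linarith
  have hn0 : (0 : ℝ) < n := by linarith
  have hn1 : 1 ≤ n := by exact_mod_cast hn0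
  have htn : t ≤ n := by
    have : (t : ℝ) ≤ n := by linarith
    exact_mod_cast this
  have hch : (0 : ℝ) < (n.choose t : ℝ) := by exact_mod_cast Nat.choose_pos htn
  rw [← ht, Real.log_mul (Real.rpow_pos_of_pos hp s).ne' hch.ne', Real.log_rpow hp]
  have hlogn : 0 ≤ Real.log n := Real.log_nonneg (by exact_mod_cast hn1)
  constructor
  -- Since `t ≤ s / 2` and `log n ≤ 2 log (1/p)`, the binomial coefficient cannot outweigh `p ^ s`.
  · have h1 : Real.log (n.choose t) ≤ t * Real.log n := by
      rw [← Real.log_pow]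
      apply Real.log_le_log hch
      exact_mod_cast Nat.choose_le_pow n t
    nlinarith
  · have h1 := mul_log_le_log_choose hS htS hn
    have h2 : t * (b - L) ≤ t * Real.log (n / (2 * S)) := by gcongr
    have h3 : t * L ≤ S * L := by gcongr
    have h4 : s * (b / k) = s / k * b := by ring
    -- Rounding down loses at most one vertex, which accounts for the summand `b`.
    have h5 : (s / k - 1) * b ≤ t * b := by gcongr; linarith
    linarith

/-- At zero the inequality is strict because `max 0 (1 - η) < 1`, so continuity provides `e`. The
maximum covers `η > 1`. The internal parameter `e` is fixed first, so that the claim holds for all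
small `ε`. -/
theorem exists_sparse_parameters {δ η : ℝ} (hδ : 0 < δ) (hη : 0 < η) (K : ℝ) :
    ∃ e : ℝ, 0 < e ∧ e ≤ 1 / 8 ∧ 4 * e ≤ δ ∧ ∀ ε, 0 < ε → ε < e →
      max 0 (1 - η) * √((δ + ε) / 2) + K * e ≤ √((δ - 4 * e) / 2) := by
  have hh : max 0 (1 - η) < 1 := max_lt one_pos (by linarith)
  have hc : ContinuousAt (fun e : ℝ => √((δ - 4 * e) / 2) -
      (max 0 (1 - η) * √((δ + e) / 2) + K * e)) 0 := by fun_prop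
  have h0 : 0 < √((δ - 4 * 0) / 2) - (max 0 (1 - η) * √((δ + 0) / 2) + K * 0) := by
    have : 0 < √(δ / 2) := by positivity
    simp only [mul_zero, sub_zero, add_zero]
    nlinarith
  have h1 := hc.eventually (lt_mem_nhds h0)
  have h2 := h1.and ((ge_mem_nhds (show (0 : ℝ) < 1 / 8 by norm_num)).and
    (ge_mem_nhds (show (0 : ℝ) < δ / 4 by linarith)))
  obtain ⟨e, ⟨he1, he2, he3⟩, he0⟩ :=
    ((h2.filter_mono nhdsWithin_le_nhds).and (self_mem_nhdsWithin (s := Set.Ioi (0 : ℝ)))).exists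
  refine ⟨e, he0, he2, by linarith, fun ε hε hεe => ?_⟩
  have h3 : √((δ + ε) / 2) ≤ √((δ + e) / 2) := Real.sqrt_le_sqrt (by linarith)
  have h4 := mul_le_mul_of_nonneg_left h3 (le_max_left 0 (1 - η))
  linarith

/-- Here `z` is the positive root of `2z² + (1 + e) z = δ - 4e`. At `e = ε = 0` both this root and
the coefficient coming from `mStar` equal `z₀ = (√(1 + 8δ) - 1) / 4`; the factor `max 0 (1 - η)`
leaves room for a separating value `w`, and continuity does the rest. -/
theorem exists_dense_parameters {δ η : ℝ} (hδ : 0 < δ) (hη : 0 < η) :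
    ∃ e z : ℝ, 0 < e ∧ e ≤ 1 / 8 ∧ 4 * e ≤ δ ∧ 0 ≤ z ∧ 2 * z ^ 2 + (1 + e) * z ≤ δ - 4 * e ∧
      ∃ ε₀, 0 < ε₀ ∧ ∀ ε, 0 < ε → ε < ε₀ →
      max 0 (1 - η) * ((√(16 * (δ + 3 * ε / 2) + (√2 / (1 + ε)) ^ 2) - √2 / (1 + ε)) / (4 * √2)) ≤
        (1 - e) * z - e := by
  obtain ⟨h, hh⟩ : ∃ h, h = max 0 (1 - η) := ⟨_, rfl⟩
  have hh1 : h < 1 := hh ▸ max_lt one_pos (by linarith)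
  have hh0 : 0 ≤ h := hh ▸ le_max_left _ _
  rw [← hh]
  obtain ⟨z₀, hz₀⟩ : ∃ z₀, z₀ = (√(1 + 8 * δ) - 1) / 4 := ⟨_, rfl⟩
  have hz0 : 0 < z₀ := by
    have : 1 < √(1 + 8 * δ) := by rw [Real.lt_sqrt (by norm_num)]; linarith
    rw [hz₀]; linarith
  obtain ⟨w, hw1, hw2⟩ := exists_between (show h * z₀ < z₀ by nlinarith)
  obtain ⟨Z, hZ⟩ : ∃ Z : ℝ → ℝ, Z = fun e => (√((1 + e) ^ 2 + 8 * (δ - 4 * e)) - (1 + e)) / 4 :=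
    ⟨_, rfl⟩
  have hZc : ContinuousAt (fun e : ℝ => (1 - e) * Z e - e) 0 := by rw [hZ]; fun_prop
  have hZ0 : w < (1 - 0) * Z 0 - 0 := by
    rw [hZ]; simp only [sub_zero, one_mul, add_zero, mul_zero, one_pow]; rwa [← hz₀]
  have h1 := hZc.eventually (lt_mem_nhds hZ0)
  have h2 := h1.and ((ge_mem_nhds (show (0 : ℝ) < 1 / 8 by norm_num)).and
    (ge_mem_nhds (show (0 : ℝ) < δ / 4 by linarith)))
  obtain ⟨e, ⟨he1, he2, he3⟩, he0⟩ :=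
    ((h2.filter_mono nhdsWithin_le_nhds).and (self_mem_nhdsWithin (s := Set.Ioi (0 : ℝ)))).exists
  have he0' : 0 < e := he0
  have hs : √((1 + e) ^ 2 + 8 * (δ - 4 * e)) ^ 2 = (1 + e) ^ 2 + 8 * (δ - 4 * e) :=
    Real.sq_sqrt (by nlinarith)
  have hs1 : 1 + e ≤ √((1 + e) ^ 2 + 8 * (δ - 4 * e)) := by
    apply Real.le_sqrt_of_sq_le; linarith
  refine ⟨e, Z e, he0, he2, by linarith, ?_, ?_, ?_⟩
  · rw [hZ]; simp only; linarith
  · rw [hZ]; simp only; nlinarith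
  have hF : ContinuousAt (fun ε : ℝ =>
      h * ((√(16 * (δ + 3 * ε / 2) + (√2 / (1 + ε)) ^ 2) - √2 / (1 + ε)) / (4 * √2))) 0 := by
    have : ContinuousAt (fun ε : ℝ => √2 / (1 + ε)) 0 :=
      ContinuousAt.div (by fun_prop) (by fun_prop) (by norm_num)
    fun_prop
  have hF0 : h * ((√(16 * (δ + 3 * 0 / 2) + (√2 / (1 + 0)) ^ 2) - √2 / (1 + 0)) / (4 * √2)) < w := by
    have h2 : √(16 * (δ + 3 * 0 / 2) + (√2 / (1 + 0)) ^ 2) = √2 * √(1 + 8 * δ) := by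
      rw [← Real.sqrt_mul (by norm_num)]
      congr 1
      rw [add_zero, div_one, Real.sq_sqrt (by norm_num)]
      ring
    have h3 : (0 : ℝ) < √2 := by positivity
    have h4 : (√2 * √(1 + 8 * δ) - √2 / (1 + 0)) / (4 * √2) = z₀ := by
      rw [hz₀]; field_simp; ring
    rw [h2, h4]; exact hw1
  obtain ⟨ε₀, hε₀, hlt⟩ := Metric.eventually_nhds_iff.1 (hF.eventually (gt_mem_nhds hF0))
  refine ⟨ε₀, hε₀, fun ε h1 h2 => ?_⟩
  have := hlt (y := ε) (by rw [Real.dist_eq, sub_zero, abs_of_pos h1]; exact h2)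
  exact (this.trans he1).le


/-! ### The three ranges of the theorem -/

theorem sparse_exponent_le {η T lam Q a e S₁ S₂ K : ℝ} (hη : 0 < η) (hT0 : 0 ≤ T)
    (hT : T ≤ lam * Q * S₁ + e * Q * a) (hlam : a / 2 ≤ lam) (hQ : 0 ≤ Q) (ha : 0 ≤ a)
    (he : 0 ≤ e) (hK : 0 ≤ K) (hS : max 0 (1 - η) * S₁ + 2 * (K + 1) * e ≤ S₂) :
    -(lam * Q * S₂ - K * e * Q * a) ≤ (1 - η) * (-T) := by
  obtain ⟨h, hh⟩ : ∃ h, h = max 0 (1 - η) := ⟨_, rfl⟩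
  have hh1 : h ≤ 1 := hh ▸ max_le zero_le_one (by linarith)
  have hh0 : 0 ≤ h := hh ▸ le_max_left _ _
  have hh2 : 1 - η ≤ h := hh ▸ le_max_right _ _
  rw [← hh] at hS
  have h1 : (1 - η) * T ≤ h * T := by gcongr
  have h2 : h * T ≤ h * (lam * Q * S₁ + e * Q * a) := by gcongr
  have h3 : h * (e * Q * a) ≤ 1 * (e * Q * a) := by gcongr
  have h4 : lam * Q * (h * S₁ + 2 * (K + 1) * e) ≤ lam * Q * S₂ := by
    have : 0 ≤ lam := by linarith
    gcongr
  -- As `lam ≥ a / 2`, an error `(K + 1) e Q a` is covered by a slack of `2 (K + 1) e` in the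
  -- coefficient of `lam * Q`.
  have h5 : a / 2 * (Q * (2 * (K + 1) * e)) ≤ lam * (Q * (2 * (K + 1) * e)) := by gcongr
  linarith

theorem star_tail {δ ε e η : ℝ} (hδ : 0 < δ) (hη : 0 < η) (he : 0 < e) (he8 : e ≤ 1 / 8)
    (heδ : 4 * e ≤ δ) (hε : 0 < ε)
    (hS : max 0 (1 - η) * √((δ + ε) / 2) + 2 * (40 * (1 + δ) + 1) * e ≤ √((δ - 4 * e) / 2)) :
    ∃ n₀ : ℕ, ∀ n : ℕ, n₀ < n → ∀ p : I, (n : ℝ) ^ (-(2 / 3) : ℝ) ≤ (p : ℝ) →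
      (p : ℝ) ≤ 1 / (√(n : ℝ) * Real.log n) →
      ENNReal.log (upperTail n p δ) ≤ (((1 - η) * m 0 n p δ ε * Real.log p : ℝ) : EReal) := by
  obtain ⟨N₀, hN₀⟩ := sparse_tail he he8 heδ
  -- Then `9 log N ≤ N / 3`, that is, `log⁹ n ≤ n ^ (1/3) ≤ n p`.
  have hlog : ∀ᶠ N : ℝ in atTop, Real.log N ≤ 1 / 27 * N := by
    filter_upwards [Real.isLittleO_log_id_atTop.bound (show (0 : ℝ) < 1 / 27 by norm_num),
      eventually_ge_atTop (1 : ℝ)] with N h1 h2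
    rwa [id, Real.norm_of_nonneg (Real.log_nonneg h2), Real.norm_of_nonneg (by linarith)] at h1
  have hev := (Real.tendsto_log_atTop.comp tendsto_natCast_atTop_atTop).eventually
    ((eventually_ge_atTop N₀).and ((eventually_ge_atTop (1 : ℝ)).and hlog))
  obtain ⟨n₀, hn₀⟩ := eventually_atTop.1 hev
  refine ⟨n₀, fun n hn p hp1 hp2 => ?_⟩
  obtain ⟨hN, hN1, hNlog⟩ := hn₀ n hn.le
  simp only [Function.comp] at hN hN1 hNlog
  have hn0 : (0 : ℝ) < n := by exact_mod_cast (by omega : 0 < n)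
  have hp : (0 : ℝ) < p := (Real.rpow_pos_of_pos hn0 _).trans_le hp1
  obtain ⟨N, hNe⟩ : ∃ N, N = Real.log n := ⟨_, rfl⟩
  obtain ⟨a, hae⟩ : ∃ a, a = Real.log (1 / p) := ⟨_, rfl⟩
  have hap : Real.log p = -a := by rw [hae, one_div, Real.log_inv, neg_neg]
  have ha0 : 0 ≤ a := by
    rw [hae]; exact Real.log_nonneg ((one_le_div hp).2 p.2.2)
  have ha : a ≤ 2 / 3 * N := by
    have h := Real.log_le_log (Real.rpow_pos_of_pos hn0 _) hp1
    rw [Real.log_rpow hn0, hap, ← hNe] at h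
    linarith
  rw [← hNe] at hN1 hNlog
  have c1 : Real.log n ^ 9 ≤ n * p := by
    rw [← hNe, ← Real.log_le_log_iff (by positivity) (by positivity), Real.log_pow,
      Real.log_mul hn0.ne' hp.ne', hap, ← hNe]
    push_cast
    linarith
  have c2 : n * (p : ℝ) ^ 2 * Real.log n ^ 2 ≤ 1 := by
    rw [← hNe] at hp2 ⊢
    have h := pow_le_pow_left₀ hp.le hp2 2
    rw [div_pow, mul_pow, Real.sq_sqrt hn0.le, one_pow, le_div_iff₀ (by positivity)] at h
    linarith
  refine log_upperTail_le (hN₀ n hN p c1 c2 a _ a hae rfl ha0 le_rfl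
    (fun j hj => half_conditions ha0 (hNe ▸ ha) j hj)) ?_
  have hm := m_le 0 n p (show 0 ≤ δ + ε by linarith)
  have hr : r 0 = 2 := by simp [r]
  rw [hr, div_self (by norm_num), one_mul] at hm
  have := sparse_exponent_le (T := m 0 n p δ ε * a) (lam := a) (Q := (n : ℝ) ^ 2 * (p : ℝ) ^ 2)
    hη (mul_nonneg (m_nonneg _ _ _ _ _) ha0) (by
      have h1 := mul_le_mul_of_nonneg_right hm ha0
      have h2 : 0 ≤ e * ((n : ℝ) ^ 2 * (p : ℝ) ^ 2) * a := by positivity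
      linarith) (by linarith) (by positivity) ha0 he.le (by positivity) hS
  rw [hap]
  linarith

theorem plant_tail {δ ε e η : ℝ} {k : ℕ} (hk : 2 ≤ k) (hδ : 0 < δ) (hη : 0 < η) (he : 0 < e)
    (he8 : e ≤ 1 / 8) (heδ : 4 * e ≤ δ) (hε : 0 < ε)
    (hS : max 0 (1 - η) * √((δ + ε) / 2) + 2 * (40 * (1 + δ) + 1) * e ≤ √((δ - 4 * e) / 2)) :
    ∃ n₀ : ℕ, ∀ n : ℕ, n₀ < n → ∀ p : I,
      max (Real.log n ^ 9 / n) ((n : ℝ) ^ (-1 + c (k - 1))) ≤ (p : ℝ) →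
      (p : ℝ) ≤ (n : ℝ) ^ (-1 + c k) →
      ENNReal.log (upperTail n p δ) ≤ (((1 - η) * Real.log ((p : ℝ) ^ m k n p δ ε *
        (n.choose ⌊m k n p δ ε / k⌋₊ : ℝ)) : ℝ) : EReal) := by
  obtain ⟨N₀, hN₀⟩ := sparse_tail he he8 heδ
  obtain ⟨D, hD⟩ : ∃ D, D = r k / 2 * √((δ + ε) / 2) := ⟨_, rfl⟩
  have hr2 := two_le_r hk
  have hD0 : 0 < D := by
    rw [hD]
    have : 0 < r k := by linarith
    have : 0 < δ + ε := by linarith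
    positivity
  obtain ⟨L, hL⟩ : ∃ L, L = |Real.log (2 * D)| := ⟨_, rfl⟩
  have hL0 : 0 ≤ L := hL ▸ abs_nonneg _
  -- Then `2 log N ≤ N / 3`, so `n p² log² n ≤ 1` because `p ≤ n ^ (-2/3)`.
  have hlog : ∀ᶠ N : ℝ in atTop, Real.log N ≤ 1 / 6 * N := by
    filter_upwards [Real.isLittleO_log_id_atTop.bound (show (0 : ℝ) < 1 / 6 by norm_num),
      eventually_ge_atTop (1 : ℝ)] with N h1 h2
    rwa [id, Real.norm_of_nonneg (Real.log_nonneg h2), Real.norm_of_nonneg (by linarith)] at h1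
  have hev := (Real.tendsto_log_atTop.comp tendsto_natCast_atTop_atTop).eventually
    ((eventually_ge_atTop N₀).and ((eventually_ge_atTop (1 : ℝ)).and (hlog.and
      ((eventually_ge_atTop (2 * D)).and ((eventually_ge_atTop (2 / e)).and
      (eventually_ge_atTop (4 * D * L / e)))))))
  obtain ⟨n₀, hn₀⟩ := eventually_atTop.1 hev
  refine ⟨n₀, fun n hn p hp1 hp2 => ?_⟩
  obtain ⟨hN, hN1, hNlog, hND, hNe2, hNL⟩ := hn₀ n hn.le
  simp only [Function.comp] at hN hN1 hNlog hND hNe2 hNL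
  have hn0 : (0 : ℝ) < n := by exact_mod_cast (by omega : 0 < n)
  have hp3 := (le_max_right _ _).trans hp1
  have hp4 := (le_max_left _ _).trans hp1
  have hp : (0 : ℝ) < p := (Real.rpow_pos_of_pos hn0 _).trans_le hp3
  rw [div_le_iff₀ hn0, mul_comm (p : ℝ)] at hp4
  have hN₀' := hN₀ n hN p hp4
  obtain ⟨N, hNe⟩ : ∃ N, N = Real.log n := ⟨_, rfl⟩
  obtain ⟨a, hae⟩ : ∃ a, a = Real.log (1 / p) := ⟨_, rfl⟩
  rw [← hNe] at hN1 hNlog hND hNe2 hNL hp4 hN₀'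
  have hap : Real.log p = -a := by rw [hae, one_div, Real.log_inv, neg_neg]
  have hx1 : c (k - 1) * N ≤ N - a := by
    have h := Real.log_le_log (Real.rpow_pos_of_pos hn0 _) hp3
    rw [Real.log_rpow hn0, hap, ← hNe] at h
    linarith
  have hx2 : N - a ≤ c k * N := by
    have h := Real.log_le_log hp hp2
    rw [Real.log_rpow hn0, hap, ← hNe] at h
    linarith
  have hx0 : 0 ≤ N - a := (mul_nonneg (c_nonneg _) (by linarith)).trans hx1
  have hx3 : N - a ≤ N / 3 := by
    have := mul_le_mul_of_nonneg_right (c_le_third (k := k) (by omega))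
      (show 0 ≤ N by linarith)
    linarith
  -- The cost ratio at degree `k`, in which `2a - N` is the logarithm of `n / Q`.
  obtain ⟨lam, hlam⟩ : ∃ lam, lam = r k / 2 * (a - (2 * a - N) / k) := ⟨_, rfl⟩
  obtain ⟨l1, l2, l3⟩ := lam_conditions (show 0 ≤ N by linarith) hk hx1 hx2
  rw [show N - (N - a) = a by ring, show N - 2 * (N - a) = 2 * a - N by ring, ← hlam]
    at l1 l2 l3
  have c2 : n * (p : ℝ) ^ 2 * N ^ 2 ≤ 1 := by
    rw [← Real.log_le_log_iff (by positivity) one_pos, Real.log_one,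
      Real.log_mul (by positivity) (by positivity), Real.log_mul hn0.ne' (by positivity),
      Real.log_pow, Real.log_pow, hap, ← hNe]
    push_cast
    linarith
  obtain ⟨Q, hQ⟩ : ∃ Q, Q = (n : ℝ) ^ 2 * (p : ℝ) ^ 2 := ⟨_, rfl⟩
  refine log_upperTail_le (hN₀' c2 a Q lam hae hQ (by linarith) l2 l3) ?_
  have hm := m_le k n p (show 0 ≤ δ + ε by linarith)
  rw [← hD, ← hQ] at hm
  have hQ0 : 0 < Q := by rw [hQ]; positivity
  have hQN : N ≤ Q := by
    have h1 : N ≤ N ^ 9 := le_self_pow₀ hN1 (by norm_num)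
    have h2 : (1 : ℝ) ≤ n * p := by linarith
    have h3 : (n : ℝ) * p ≤ (n * p) ^ 2 := le_self_pow₀ h2 (by norm_num)
    rw [mul_pow, ← hQ] at h3
    linarith
  have hQn : Q / n = n * (p : ℝ) ^ 2 := by rw [hQ]; field_simp
  have hSn : 2 * (D * Q) ≤ n := by
    have h1 : 2 * D ≤ N ^ 2 := hND.trans (le_self_pow₀ hN1 (by norm_num))
    have h2 : Q / n * (2 * D) ≤ Q / n * N ^ 2 := by gcongr
    have h3 : Q / n * (2 * D) ≤ 1 := by rw [hQn] at h2 ⊢; linarith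
    rw [div_mul_eq_mul_div, div_le_one hn0] at h3
    linarith
  have hbL : (2 * a - N) - L ≤ Real.log (n / (2 * (D * Q))) := by
    have h1 : Real.log Q = 2 * N - 2 * a := by
      rw [hQ, Real.log_mul (by positivity) (by positivity), Real.log_pow, Real.log_pow, hap,
        ← hNe]
      push_cast
      ring
    rw [← mul_assoc, Real.log_div hn0.ne' (by positivity),
      Real.log_mul (by positivity) hQ0.ne', h1, ← hNe]
    have := le_abs_self (Real.log (2 * D))
    linarith
  obtain ⟨t1, t2⟩ := log_plant_bounds hp hk (m_nonneg k n p δ ε) (mul_pos hD0 hQ0) hm hSn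
    (show 0 ≤ 2 * a - N by linarith) hL0 hbL (by rw [hap, ← hNe]; linarith)
  have ha0 : 0 ≤ a := by linarith
  have hac : 0 ≤ a - (2 * a - N) / k := by
    have h1 : (2 * a - N) / k ≤ 2 * a - N :=
      div_le_self (by linarith) (by exact_mod_cast (by omega : 1 ≤ k))
    linarith
  have h1 : m k n p δ ε * (a - (2 * a - N) / k) ≤ D * Q * (a - (2 * a - N) / k) := by gcongr
  have h2 : D * Q * (a - (2 * a - N) / k) = lam * Q * √((δ + ε) / 2) := by
    rw [hD, hlam]; ring
  -- This and the next bound absorb the rounding to whole vertices and the constant factor inside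
  -- `log (n / (2 D Q))`.
  have h3 : 2 * a - N ≤ e * Q * a / 2 := by
    rw [div_le_iff₀ he] at hNe2
    have h4 : N * e ≤ Q * e := by gcongr
    have h5 : 2 * a ≤ Q * e * a := by gcongr; linarith
    linarith
  have h4 : D * Q * L ≤ e * Q * a / 2 := by
    rw [div_le_iff₀ he] at hNL
    have h5 : N * e ≤ 2 * a * e := by gcongr; linarith
    have h6 : Q * (4 * D * L) ≤ Q * (2 * a * e) :=
      mul_le_mul_of_nonneg_left (hNL.trans h5) hQ0.le
    linarith
  have := sparse_exponent_le hη t1 (lam := lam) (Q := Q) (a := a) (e := e)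
    (by rw [hap, neg_neg] at t2; linarith) l1 hQ0.le ha0 he.le
    (show 0 ≤ 40 * (1 + δ) by positivity) hS
  rwa [neg_neg] at this

theorem mStar_tail {δ ε e z η : ℝ} (he : 0 < e) (he8 : e ≤ 1 / 8)
    (heδ : 4 * e ≤ δ) (hε : 0 < ε) (hz0 : 0 ≤ z) (hz : 2 * z ^ 2 + (1 + e) * z ≤ δ - 4 * e)
    (hS : max 0 (1 - η) * ((√(16 * (δ + 3 * ε / 2) + (√2 / (1 + ε)) ^ 2) - √2 / (1 + ε)) /
      (4 * √2)) ≤ (1 - e) * z - e) (p : ℕ → I)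
    (hp1 : (fun n : ℕ => (n : ℝ) ^ (-(1 / 2) : ℝ)) =o[atTop] (fun n : ℕ => (p n : ℝ)))
    (hp2 : (fun n : ℕ => (p n : ℝ)) =o[atTop] (fun _ : ℕ => (1 : ℝ))) :
    ∃ n₀ : ℕ, ∀ n : ℕ, n₀ < n → ENNReal.log (upperTail n (p n) δ) ≤
      (((1 - η) * mStar n (p n) δ ε * Real.log (p n) : ℝ) : EReal) := by
  obtain ⟨κ, hκ, n₂, hn₂⟩ := dense_tail he he8 heδ hz0 hz
  obtain ⟨n₀, hn₀⟩ := eventually_atTop.1 ((hp1.bound (Real.sqrt_pos.2 hκ)).and (hp2.bound hκ))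
  refine ⟨max n₀ n₂, fun n hn => ?_⟩
  obtain ⟨h1, h2⟩ := hn₀ n ((le_max_left _ _).trans hn.le)
  have hn0 : (0 : ℝ) < n := by exact_mod_cast (by omega : 0 < n)
  rw [Real.norm_of_nonneg (p n).2.1, norm_one, mul_one] at h2
  rw [Real.norm_of_nonneg (p n).2.1, Real.norm_of_nonneg (by positivity)] at h1
  have hpos : (0 : ℝ) < (n : ℝ) ^ (-(1 / 2) : ℝ) := Real.rpow_pos_of_pos hn0 _
  have hp : (0 : ℝ) < p n := by
    refine lt_of_le_of_ne (p n).2.1 fun h => ?_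
    rw [← h, mul_zero] at h1
    linarith
  -- Squaring `n ^ (-1/2) ≤ √κ p`.
  have h3 : 1 ≤ κ * (n * (p n : ℝ) ^ 2) := by
    have h := pow_le_pow_left₀ hpos.le h1 2
    rw [mul_pow, Real.sq_sqrt hκ.le, ← Real.rpow_natCast, ← Real.rpow_mul hn0.le] at h
    norm_num at h
    rw [Real.rpow_neg_one, inv_le_iff_one_le_mul₀ hn0] at h
    linarith
  obtain ⟨a, hae⟩ : ∃ a, a = Real.log (1 / (p n : ℝ)) := ⟨_, rfl⟩
  have hap : Real.log (p n) = -a := by rw [hae, one_div, Real.log_inv, neg_neg]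
  have ha0 : 0 ≤ a := by
    rw [hae]; exact Real.log_nonneg ((one_le_div hp).2 (p n).2.2)
  refine log_upperTail_le (hn₂ n ((le_max_right _ _).trans hn.le) (p n) hp h2 h3 a _ hae rfl) ?_
  obtain ⟨Q, hQ⟩ : ∃ Q, Q = (n : ℝ) ^ 2 * (p n : ℝ) ^ 2 := ⟨_, rfl⟩
  obtain ⟨W, hW⟩ : ∃ W, W = √(16 * (δ + 3 * ε / 2) + (√2 / (1 + ε)) ^ 2) - √2 / (1 + ε) :=
    ⟨_, rfl⟩
  have hW0 : 0 ≤ W := by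
    rw [hW, sub_nonneg]
    apply Real.le_sqrt_of_sq_le
    linarith
  have hm : mStar n (p n) δ ε ≤ W / (4 * √2) * Q := by
    have h5 := sqrt_mean_le n (p n)
    rw [← hQ] at h5
    calc mStar n (p n) δ ε = W * √(mean n (p n)) / 2 := by rw [mStar, hW]
      _ ≤ W * (Q / (2 * √2)) / 2 := by gcongr
      _ = _ := by field_simp; norm_num
  have hm0 : 0 ≤ mStar n (p n) δ ε := by rw [mStar, ← hW]; positivity
  rw [← hW] at hS
  rw [← hQ, hap]
  obtain ⟨h, hh⟩ : ∃ h, h = max 0 (1 - η) := ⟨_, rfl⟩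
  have hh0 : 0 ≤ h := hh ▸ le_max_left _ _
  have hh2 : 1 - η ≤ h := hh ▸ le_max_right _ _
  rw [← hh] at hS
  have hQ0 : 0 ≤ Q := by rw [hQ]; positivity
  have q1 : (1 - η) * (mStar n (p n) δ ε * a) ≤ h * (mStar n (p n) δ ε * a) := by gcongr
  have q2 : h * (mStar n (p n) δ ε * a) ≤ h * (W / (4 * √2) * Q * a) := by gcongr
  have q3 : h * (W / (4 * √2)) * (Q * a) ≤ ((1 - e) * z - e) * (Q * a) := by gcongr
  linarith

end InducedC4

theorem theorem6p1 (k : ℕ) (hk : 1 < k) (δ η : ℝ) (hδ : 0 < δ) (hη : 0 < η) :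
    ∃ ε₀ : ℝ, 0 < ε₀ ∧ ∀ ε : ℝ, 0 < ε → ε < ε₀ →
      (∃ n₀ : ℕ, ∀ n : ℕ, n₀ < n → ∀ p : I,
        max (Real.log n ^ 9 / n) ((n : ℝ) ^ (-1 + InducedC4.c (k - 1))) ≤ (p : ℝ) →
        (p : ℝ) ≤ (n : ℝ) ^ (-1 + InducedC4.c k) →
        ENNReal.log (InducedC4.upperTail n p δ) ≤
          (((1 - η) * Real.log ((p : ℝ) ^ InducedC4.m k n p δ ε *
            (n.choose ⌊InducedC4.m k n p δ ε / k⌋₊ : ℝ)) : ℝ) : EReal)) ∧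
      (∃ n₀ : ℕ, ∀ n : ℕ, n₀ < n → ∀ p : I,
        (n : ℝ) ^ (-(2 / 3) : ℝ) ≤ (p : ℝ) →
        (p : ℝ) ≤ 1 / (√(n : ℝ) * Real.log n) →
        ENNReal.log (InducedC4.upperTail n p δ) ≤
          (((1 - η) * InducedC4.m 0 n p δ ε * Real.log p : ℝ) : EReal)) ∧
      (∀ p : ℕ → I,
        (fun n : ℕ => (n : ℝ) ^ (-(1 / 2) : ℝ)) =o[atTop] (fun n : ℕ => (p n : ℝ)) →
        (fun n : ℕ => (p n : ℝ)) =o[atTop] (fun _ : ℕ => (1 : ℝ)) →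
        ∃ n₀ : ℕ, ∀ n : ℕ, n₀ < n →
          ENNReal.log (InducedC4.upperTail n (p n) δ) ≤
            (((1 - η) * InducedC4.mStar n (p n) δ ε * Real.log (p n) : ℝ) : EReal)) := by
  -- The constant consists of the error `40 (1 + δ)` of `sparse_tail` and `1` for the planting
  -- estimate, doubled because `lam ≥ a / 2`.
  obtain ⟨e, he0, he8, heδ, he⟩ :=
    InducedC4.exists_sparse_parameters hδ hη (2 * (40 * (1 + δ) + 1))
  obtain ⟨e', z, he0', he8', heδ', hz0, hz, ε₁, hε₁, he'⟩ :=
    InducedC4.exists_dense_parameters hδ hη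
  refine ⟨min e ε₁, lt_min he0 hε₁, fun ε hε hε' => ?_⟩
  have hS := he ε hε (hε'.trans_le (min_le_left _ _))
  exact ⟨InducedC4.plant_tail hk hδ hη he0 he8 heδ hε hS,
    InducedC4.star_tail hδ hη he0 he8 heδ hε hS,
    fun p hp1 hp2 => InducedC4.mStar_tail he0' he8' heδ' hε hz0 hz
      (he' ε hε (hε'.trans_le (min_le_right _ _))) p hp1 hp2⟩
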